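/- Let $d\ge 1$ and let $\vec p=(p_1,\dots,p_d)$ with $0<p_i<\infty$ for all $i$. There is a constant $c>0$, depending only on $d$ and $\vec p$, such that the following holds. Let $(\Omega_i,\mathcal F^i,\mathbb P_i)$, $i=1,\dots,d$, be probability spaces with increasing sequences of $\sigma$-algebras $(\mathcal F^i_n)_{n\in\mathbb N}$ satisfying $\mathcal F^i=\sigma\bigl(\bigcup_n\mathcal F^i_n\bigr)$. Let $(\Omega,\mathcal F,\mathbb P)$ be their product, $\mathcal F_n=\sigma\bigl(\prod_{i}\mathcal F^i_n\bigr)$, and let $\mathbb E_n$ be the conditional expectation with respect to $\mathcal F_n$ (for nonnegative functions it takes values in $[0,\infty]$). For a measurable function $g$ on $\Omega$ put $$\|g\|_{\vec p}=\Bigl(\int_{\Omega_d}\cdots\Bigl(\int_{\Omega_1}|g(x_1,\dots,x_d)|^{p_1}\,dx_1\Bigr)^{p_2/p_1}\cdots dx_d\Bigr)^{1/p_d}\in[0,\infty].$$ For a real martingale $f=(f_n)_{n\in\mathbb N}$ with respect to $(\mathcal F_n)$ with $f_0=0$, put $d_0f=0$, $d_nf=f_n-f_{n-1}$ for $n\ge1$,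 and $$M(f)=\sup_n|f_n|,\quad S_n(f)=\Bigl(\sum_{k\le n}|d_kf|^2\Bigr)^{1/2},\quad S(f)=\Bigl(\sum_{k\ge 0}|d_kf|^2\Bigr)^{1/2},\quad s(f)=\Bigl(\sum_{k\ge1}\mathbb E_{k-1}|d_kf|^2\Bigr)^{1/2},$$ $$\|f\|_{H^M_{\vec p}}=\|M(f)\|_{\vec p},\qquad \|f\|_{H^S_{\vec p}}=\|S(f)\|_{\vec p},\qquad \|f\|_{H^s_{\vec p}}=\|s(f)\|_{\vec p}.$$ Let $\Lambda$ be the set of sequences $(\lambda_n)_{n\in\mathbb N}$ of nonnegative, non-decreasing, $(\mathcal F_n)$-adapted functions, with $\lambda_\infty=\lim_n\lambda_n$. Let $\|f\|_{\mathcal P_{\vec p}}$ (respectively $\|f\|_{\mathcal Q_{\vec p}}$) be the infimum of $\|\lambda_\infty\|_{\vec p}$ over all $(\lambda_n)\in\Lambda$ with $|f_n|\le\lambda_{n-1}$ (respectively $S_n(f)\le\lambda_{n-1}$) almost surely for all $n\ge1$, where $\inf\emptyset=\infty$. The space $\mathcal P_{\vec p}$ (respectively $\mathcal Q_{\vec p}$)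 consists of those $f$ for which such a sequence with $\|\lambda_\infty\|_{\vec p}<\infty$ exists. Then for every such martingale $f$ (inequalities in $[0,\infty]$): 1. if $p_i<2$ for all $i$, then $\|f\|_{H^M_{\vec p}}\le c\,\|f\|_{H^s_{\vec p}}$ and $\|f\|_{H^S_{\vec p}}\le c\,\|f\|_{H^s_{\vec p}}$; 2. $\|f\|_{H^M_{\vec p}}\le\|f\|_{\mathcal P_{\vec p}}$ and $\|f\|_{H^S_{\vec p}}\le\|f\|_{\mathcal Q_{\vec p}}$; 3. $\|f\|_{H^S_{\vec p}}\le c\,\|f\|_{\mathcal P_{\vec p}}$ and $\|f\|_{H^M_{\vec p}}\le c\,\|f\|_{\mathcal Q_{\vec p}}$; 4. $\|f\|_{\mathcal P_{\vec p}}\le c\,\|f\|_{\mathcal Q_{\vec p}}$ and $\|f\|_{\mathcal Q_{\vec p}}\le c\,\|f\|_{\mathcal P_{\vec p}}$; in particular $\mathcal P_{\vec p}=\mathcal Q_{\vec p}$; 5. $\|f\|_{H^s_{\vec p}}\le c\,\|f\|_{\mathcal P_{\vec p}}$ and $\|f\|_{H^s_{\vec p}}\le c\,\|f\|_{\mathcal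 Q_{\vec p}}$. -/

import Mathlib

open MeasureTheory ProbabilityTheory
open scoped ENNReal NNReal

noncomputable section

namespace MixedHardy

/-- The mixed (quasi-)norm of a nonnegative extended-real function on a finite product: take
successively the `L_{p 0}` quasi-norm in the first variable, then the `L_{p 1}` quasi-norm in the
second variable, and so on (with the essential supremum for an exponent `∞`). -/
def mixedNorm : {d : ℕ} → {Ω : Fin d → Type*} → [∀ i, MeasurableSpace (Ω i)] →
    (∀ i, Measure (Ω i)) → (Fin d → ℝ≥0∞) → ((∀ i, Ω i) → ℝ≥0∞) → ℝ≥0∞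
  | 0, _, _, _, _, g => g (fun i => i.elim0)
  | _ + 1, _, _, μ, p, g =>
      mixedNorm (fun i => μ i.succ) (fun i => p i.succ)
        (fun x => eLpNorm (fun y => g (Fin.cons y x)) (p 0) (μ 0))

variable {d : ℕ} {Ω : Fin d → Type*} [mΩ : ∀ i, MeasurableSpace (Ω i)]

/-- The filtration `F_n = σ(∏ᵢ F_n^i)` on the product space. -/
def prodFiltration (ℱ : ∀ i, Filtration ℕ (mΩ i)) :
    Filtration ℕ (MeasurableSpace.pi : MeasurableSpace (∀ i, Ω i)) where
  seq n := MeasurableSpace.pi (m := fun i => ℱ i n)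
  mono' := fun _ _ hnm => iSup_mono fun i => MeasurableSpace.comap_mono ((ℱ i).mono hnm)
  le' := fun n => iSup_mono fun i => MeasurableSpace.comap_mono ((ℱ i).le n)

/-- The real martingales on the product probability space, with the convention `f₀ = 0`. -/
def martingales (μ : ∀ i, Measure (Ω i)) (ℱ : ∀ i, Filtration ℕ (mΩ i)) :
    Set (ℕ → (∀ i, Ω i) → ℝ) :=
  {f | Martingale f (prodFiltration ℱ) (Measure.pi μ) ∧ f 0 =ᵐ[Measure.pi μ] 0}

/-- Martingale differences: `d₀ f = 0` and `dₙ f = fₙ - fₙ₋₁` for `n ≥ 1`. -/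
def mdiff {X : Type*} (f : ℕ → X → ℝ) : ℕ → X → ℝ
  | 0 => 0
  | n + 1 => f (n + 1) - f n

/-- The maximal function `M(f) = supₙ |fₙ|`. -/
def maximal {X : Type*} (f : ℕ → X → ℝ) (x : X) : ℝ≥0∞ := ⨆ n, ‖f n x‖ₑ

/-- The partial quadratic variation `S_m(f) = (∑_{n ≤ m} |dₙ f|²)^{1/2}`. -/
def quadVarUpTo {X : Type*} (f : ℕ → X → ℝ) (m : ℕ) (x : X) : ℝ≥0∞ :=
  (∑ n ∈ Finset.range (m + 1), ‖mdiff f n x‖ₑ ^ 2) ^ (1 / 2 : ℝ)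

/-- The quadratic variation `S(f) = (∑ₙ |dₙ f|²)^{1/2}`. -/
def quadVar {X : Type*} (f : ℕ → X → ℝ) (x : X) : ℝ≥0∞ :=
  (∑' n, ‖mdiff f n x‖ₑ ^ 2) ^ (1 / 2 : ℝ)

/-- The conditional quadratic variation `s(f) = (∑_{n ≥ 1} E_{n-1} |dₙ f|²)^{1/2}` (the term `n = 0`
vanishes because `d₀ f = 0`). The conditional expectation is that of nonnegative functions, so it
is meaningful without square integrability and may take the value `∞`. -/
def condQuadVar (μ : ∀ i, Measure (Ω i)) (ℱ : ∀ i, Filtration ℕ (mΩ i))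
    (f : ℕ → (∀ i, Ω i) → ℝ) (x : ∀ i, Ω i) : ℝ≥0∞ :=
  (∑' n, condLExp (prodFiltration ℱ n) (Measure.pi μ)
    (fun y => ‖mdiff f (n + 1) y‖ₑ ^ 2) x) ^ (1 / 2 : ℝ)

/-- `‖f‖_{H^M}`, with values in `[0, ∞]`. -/
def normHM (μ : ∀ i, Measure (Ω i)) (p : Fin d → ℝ≥0∞) (f : ℕ → (∀ i, Ω i) → ℝ) : ℝ≥0∞ :=
  mixedNorm μ p (maximal f)

/-- `‖f‖_{H^S}`, with values in `[0, ∞]`. -/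
def normHS (μ : ∀ i, Measure (Ω i)) (p : Fin d → ℝ≥0∞) (f : ℕ → (∀ i, Ω i) → ℝ) : ℝ≥0∞ :=
  mixedNorm μ p (quadVar f)

/-- `‖f‖_{H^s}`, with values in `[0, ∞]`. -/
def normHs (μ : ∀ i, Measure (Ω i)) (ℱ : ∀ i, Filtration ℕ (mΩ i)) (p : Fin d → ℝ≥0∞)
    (f : ℕ → (∀ i, Ω i) → ℝ) : ℝ≥0∞ :=
  mixedNorm μ p (condQuadVar μ ℱ f)

/-- The set `Λ` of non-decreasing, nonnegative, adapted sequences of functions. -/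
def controls (ℱ : ∀ i, Filtration ℕ (mΩ i)) : Set (ℕ → (∀ i, Ω i) → ℝ≥0) :=
  {l | Adapted (prodFiltration ℱ) l ∧ Monotone l}

/-- The limit `λ_∞` of a non-decreasing sequence. -/
def controlLim {X : Type*} (l : ℕ → X → ℝ≥0) (x : X) : ℝ≥0∞ := ⨆ n, (l n x : ℝ≥0∞)

/-- The sequences in `Λ` with `|fₙ| ≤ λₙ₋₁` almost surely for all `n ≥ 1`. -/
def controlsP (μ : ∀ i, Measure (Ω i)) (ℱ : ∀ i, Filtration ℕ (mΩ i))
    (f : ℕ → (∀ i, Ω i) → ℝ) : Set (ℕ → (∀ i, Ω i) → ℝ≥0) :=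
  {l | l ∈ controls ℱ ∧ ∀ n, ∀ᵐ x ∂(Measure.pi μ), ‖f (n + 1) x‖ₑ ≤ l n x}

/-- The sequences in `Λ` with `Sₙ(f) ≤ λₙ₋₁` almost surely for all `n ≥ 1`. -/
def controlsQ (μ : ∀ i, Measure (Ω i)) (ℱ : ∀ i, Filtration ℕ (mΩ i))
    (f : ℕ → (∀ i, Ω i) → ℝ) : Set (ℕ → (∀ i, Ω i) → ℝ≥0) :=
  {l | l ∈ controls ℱ ∧ ∀ n, ∀ᵐ x ∂(Measure.pi μ), quadVarUpTo f (n + 1) x ≤ l n x}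

/-- `‖f‖_P`, with values in `[0, ∞]`. -/
def normP (μ : ∀ i, Measure (Ω i)) (ℱ : ∀ i, Filtration ℕ (mΩ i)) (p : Fin d → ℝ≥0∞)
    (f : ℕ → (∀ i, Ω i) → ℝ) : ℝ≥0∞ :=
  ⨅ l ∈ controlsP μ ℱ f, mixedNorm μ p (controlLim l)

/-- `‖f‖_Q`, with values in `[0, ∞]`. -/
def normQ (μ : ∀ i, Measure (Ω i)) (ℱ : ∀ i, Filtration ℕ (mΩ i)) (p : Fin d → ℝ≥0∞)
    (f : ℕ → (∀ i, Ω i) → ℝ) : ℝ≥0∞ :=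
  ⨅ l ∈ controlsQ μ ℱ f, mixedNorm μ p (controlLim l)

/-- The space `P` of martingales with a predictable majorant whose limit is in the mixed space. -/
def spaceP (μ : ∀ i, Measure (Ω i)) (ℱ : ∀ i, Filtration ℕ (mΩ i)) (p : Fin d → ℝ≥0∞) :
    Set (ℕ → (∀ i, Ω i) → ℝ) :=
  {f | f ∈ martingales μ ℱ ∧ ∃ l ∈ controlsP μ ℱ f, mixedNorm μ p (controlLim l) < ∞}

/-- The space `Q` of martingales whose quadratic variations have a predictable majorant whose limit
is in the mixed space. -/
def spaceQ (μ : ∀ i, Measure (Ω i)) (ℱ : ∀ i, Filtration ℕ (mΩ i)) (p : Fin d → ℝ≥0∞) :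
    Set (ℕ → (∀ i, Ω i) → ℝ) :=
  {f | f ∈ martingales μ ℱ ∧ ∃ l ∈ controlsQ μ ℱ f, mixedNorm μ p (controlLim l) < ∞}

end MixedHardy

end

open MixedHardy

/-! Every nontrivial inequality has the form `‖T‖ ≤ c ‖λ_∞‖`, where `T` is `M(f)`, `S(f)` or `s(f)`
and `λ` is an adapted increasing control that is known one step before the quantity it dominates:
`|f_n|`, `S_n(f)`, or the partial sums of `s(f)²` (dominated by `λ²`). Such an inequality is proved
in one ordinary `L_Q` with `Q` above all exponents, and then carried down to the mixed norm by
`mixedNorm_extrapolation`.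

The mechanism is the martingale transform. If `w` is adapted and decreasing, then `∑ w_k d_{k+1} f`
is controlled by `∑ (λ_k - λ_{k-1}) w_k`, again an adapted increasing sequence. In a single `L_p`
with `p < Q`, take `w_k = λ_k^{-(1-p/Q)}`: the new control is at most `(Q/p) λ_∞^{p/Q}`, while `T ≤
2 λ_∞^{1-p/Q} T'`, so the `L_Q` estimate for `T'` and Hölder's inequality give the `L_p` estimate
for `T`.

For mixed norms the exponents are raised to `Q` one variable at a time, from the innermost outwards
(`extrapolation_step`). The weight is built from `u`, the norm of the control in the variables
already treated, and `v`, the norm of `u` in the current variable; both remain adapted because the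
filtration is a product. The outer norms then lose only a factor `v^δ` with small `δ`, which
Hölder's inequality absorbs by replacing the outer exponents `p_j` by `p_j/(1-δ)`, still below `Q`.

The `L_Q` estimates are Doob's inequality and orthogonality of increments for `Q = 2`; an induction
through `f² = S² + 2 ∑ f_k d_{k+1}` for `M(f)` under a control of `S_n(f)`
(`lintegral_runMax_pow_le`); and one argument for both `S(f)` and `s(f)` under a control of `|f_n|`
(`lintegral_bracket_pow_le`).

The passage between the two predictable spaces uses that `λ_n + max_{k≤n} |f_k|` controls `f` when
`λ` controls `S_n(f)`, and that `2λ_n + S_n(f)` controls `S_n(f)` when `λ` controls `f`. For the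
first item, the partial sums of `s(f)²` are themselves predictable and provide the control. -/

noncomputable section

namespace MixedHardy

/-! ### Iterated norms, one coordinate at a time: measurability, Hölder, Minkowski, monotone limits.
-/

section CoordNorm

variable {d : ℕ} {Ω : Fin d → Type*} [mΩ : ∀ i, MeasurableSpace (Ω i)]

/-- The `L_r` quasi-norm in the `i`-th variable, as a function on the whole product. -/
def coordNorm (μ : ∀ i, Measure (Ω i)) (i : Fin d) (r : ℝ) (g : (∀ i, Ω i) → ℝ≥0∞)
    (x : ∀ i, Ω i) : ℝ≥0∞ :=
  (∫⁻ y, g (Function.update x i y) ^ r ∂μ i) ^ (1 / r)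

/-- The iterated quasi-norm in the variables of a list, the head of the list being innermost. -/
def iterNorm (μ : ∀ i, Measure (Ω i)) (p : Fin d → ℝ) :
    List (Fin d) → ((∀ i, Ω i) → ℝ≥0∞) → (∀ i, Ω i) → ℝ≥0∞
  | [], g => g
  | i :: l, g => iterNorm μ p l (coordNorm μ i (p i) g)

/-- The function does not depend on the `i`-th variable. -/
def IndepOf {β : Type*} (i : Fin d) (g : (∀ i, Ω i) → β) : Prop :=
  ∀ x y, g (Function.update x i y) = g x

variable {μ : ∀ i, Measure (Ω i)} {p q : Fin d → ℝ} {i : Fin d} {r : ℝ}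
  {f g h : (∀ i, Ω i) → ℝ≥0∞} {l l' : List (Fin d)}

lemma measurable_coordNorm [∀ i, SFinite (μ i)] (hg : Measurable g) :
    Measurable (coordNorm μ i r g) := by
  unfold coordNorm
  refine Measurable.pow_const ?_ _
  refine Measurable.lintegral_prod_right' (f := fun z : (∀ i, Ω i) × Ω i =>
    g (Function.update z.1 i z.2) ^ r) ?_
  exact (hg.comp measurable_update').pow_const _

lemma measurable_iterNorm [∀ i, SFinite (μ i)] (hg : Measurable g) :
    Measurable (iterNorm μ p l g) := by
  induction l generalizing g with
  | nil => exact hg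
  | cons i l ih => exact ih (measurable_coordNorm hg)

/-- This is where the product form of the filtration enters: integrating out one variable keeps
`F_n`-measurability. The unfiltered lemma is applied with every factor carrying the σ-algebra `ℱ i
n` and the trimmed measure, which gives the same integrals. -/
lemma measurable_coordNorm_prodFiltration [∀ i, IsFiniteMeasure (μ i)]
    {ℱ : ∀ i, Filtration ℕ (mΩ i)} {n : ℕ} (hg : Measurable[prodFiltration ℱ n] g) :
    Measurable[prodFiltration ℱ n] (coordNorm μ i r g) := by
  have hfin : ∀ i, @SFinite _ (ℱ i n) ((μ i).trim ((ℱ i).le n)) := fun i =>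
    have := isFiniteMeasure_trim (μ := μ i) ((ℱ i).le n)
    inferInstance
  have key := @measurable_coordNorm d Ω (fun i => ℱ i n) (fun i => (μ i).trim ((ℱ i).le n))
    i r g hfin hg
  suffices heq : coordNorm μ i r g = @coordNorm d Ω (fun i => ℱ i n)
      (fun i => (μ i).trim ((ℱ i).le n)) i r g by rw [heq]; exact key
  funext x
  unfold coordNorm
  rw [lintegral_trim]
  have h2 := @measurable_update _ _ (fun i => ℱ i n) x i _
  exact (Measurable.comp hg h2).pow_const _

lemma measurable_iterNorm_prodFiltration [∀ i, IsFiniteMeasure (μ i)]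
    {ℱ : ∀ i, Filtration ℕ (mΩ i)} {n : ℕ} (hg : Measurable[prodFiltration ℱ n] g) :
    Measurable[prodFiltration ℱ n] (iterNorm μ p l g) := by
  induction l generalizing g with
  | nil => exact hg
  | cons i l ih => exact ih (measurable_coordNorm_prodFiltration hg)

lemma iterNorm_append : iterNorm μ p (l ++ l') g = iterNorm μ p l' (iterNorm μ p l g) := by
  induction l generalizing g with
  | nil => rfl
  | cons i l ih => exact ih

lemma iterNorm_congr (h : ∀ i ∈ l, p i = q i) : iterNorm μ p l g = iterNorm μ q l g := by
  induction l generalizing g with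
  | nil => rfl
  | cons i l ih =>
    simp only [iterNorm, h i (by simp)]
    exact ih fun j hj => h j (by simp [hj])

lemma coordNorm_mono (hr : 0 < r) (hfg : ∀ x, f x ≤ g x) (x : ∀ i, Ω i) :
    coordNorm μ i r f x ≤ coordNorm μ i r g x := by
  unfold coordNorm
  gcongr
  exact hfg _

lemma iterNorm_mono (hp : ∀ i ∈ l, 0 < p i) (hfg : ∀ x, f x ≤ g x) (x : ∀ i, Ω i) :
    iterNorm μ p l f x ≤ iterNorm μ p l g x := by
  induction l generalizing f g with
  | nil => exact hfg x
  | cons i l ih =>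
    exact ih (fun j hj => hp j (by simp [hj])) (coordNorm_mono (hp i (by simp)) hfg)

lemma indepOf_coordNorm_self : IndepOf i (coordNorm μ i r g) := by
  intro x y
  simp [coordNorm]

lemma IndepOf.coordNorm {j : Fin d} (hg : IndepOf j g) : IndepOf j (coordNorm μ i r g) := by
  intro x y
  rcases eq_or_ne i j with rfl | hij
  · exact indepOf_coordNorm_self x y
  · unfold MixedHardy.coordNorm
    congr 1
    refine lintegral_congr fun z => ?_
    rw [Function.update_comm hij.symm, hg]

lemma IndepOf.iterNorm {j : Fin d} (hg : IndepOf j g) : IndepOf j (iterNorm μ p l g) := by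
  induction l generalizing g with
  | nil => exact hg
  | cons i l ih => exact ih hg.coordNorm

lemma indepOf_iterNorm_of_mem {j : Fin d} (hj : j ∈ l) : IndepOf j (iterNorm μ p l g) := by
  induction l generalizing g with
  | nil => simp at hj
  | cons i l ih =>
    rcases List.mem_cons.1 hj with rfl | hj
    · exact IndepOf.iterNorm (g := coordNorm μ _ _ g) indepOf_coordNorm_self
    · exact ih hj

lemma coordNorm_mul_left [∀ i, SFinite (μ i)] (hr : 0 < r) (hh : IndepOf i h) (hg : Measurable g) :
    coordNorm μ i r (fun x => h x * g x) = fun x => h x * coordNorm μ i r g x := by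
  funext x
  unfold coordNorm
  simp_rw [hh x, ENNReal.mul_rpow_of_nonneg _ _ hr.le]
  have hm : Measurable fun y => g (Function.update x i y) ^ r :=
    (hg.comp (measurable_update x)).pow_const _
  rw [lintegral_const_mul _ hm,
    ENNReal.mul_rpow_of_nonneg _ _ (by positivity), ← ENNReal.rpow_mul,
    mul_one_div_cancel hr.ne', ENNReal.rpow_one]

lemma iterNorm_mul_left [∀ i, SFinite (μ i)] (hp : ∀ i ∈ l, 0 < p i)
    (hh : ∀ i ∈ l, IndepOf i h) (hg : Measurable g) :
    iterNorm μ p l (fun x => h x * g x) = fun x => h x * iterNorm μ p l g x := by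
  induction l generalizing g with
  | nil => rfl
  | cons i l ih =>
    simp only [iterNorm]
    rw [coordNorm_mul_left (hp i (by simp)) (hh i (by simp)) hg]
    exact ih (fun j hj => hp j (by simp [hj])) (fun j hj => hh j (by simp [hj]))
      (measurable_coordNorm hg)

lemma iterNorm_const_mul [∀ i, SFinite (μ i)] (hp : ∀ i ∈ l, 0 < p i) (c : ℝ≥0∞)
    (hg : Measurable g) (x : ∀ i, Ω i) :
    iterNorm μ p l (fun x => c * g x) x = c * iterNorm μ p l g x :=
  congrFun (iterNorm_mul_left (h := fun _ => c) hp (fun _ _ _ _ => rfl) hg) x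

lemma coordNorm_const [∀ i, IsProbabilityMeasure (μ i)] (hr : 0 < r) (c : ℝ≥0∞) :
    coordNorm μ i r (fun _ => c) = fun _ => c := by
  funext x
  simp only [coordNorm, lintegral_const, measure_univ, mul_one]
  rw [← ENNReal.rpow_mul, mul_one_div_cancel hr.ne', ENNReal.rpow_one]

lemma iterNorm_const [∀ i, IsProbabilityMeasure (μ i)] (hp : ∀ i ∈ l, 0 < p i) (c : ℝ≥0∞) :
    iterNorm μ p l (fun _ => c) = fun _ => c := by
  induction l with
  | nil => rfl
  | cons i l ih =>
    simp only [iterNorm]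
    rw [coordNorm_const (hp i (by simp))]
    exact ih fun j hj => hp j (by simp [hj])

lemma coordNorm_rpow (hr : 0 < r) {a : ℝ} (ha : 0 < a) :
    coordNorm μ i (r / a) (fun x => g x ^ a) = fun x => coordNorm μ i r g x ^ a := by
  funext x
  unfold coordNorm
  simp_rw [← ENNReal.rpow_mul]
  congr 2
  · simp [mul_div_cancel₀ _ ha.ne']
  · field_simp

lemma iterNorm_rpow (hp : ∀ i ∈ l, 0 < p i) {a : ℝ} (ha : 0 < a) :
    iterNorm μ (fun i => p i / a) l (fun x => g x ^ a) = fun x => iterNorm μ p l g x ^ a := by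
  induction l generalizing g with
  | nil => rfl
  | cons i l ih =>
    simp only [iterNorm]
    rw [coordNorm_rpow (hp i (by simp)) ha]
    exact ih fun j hj => hp j (by simp [hj])

lemma coordNorm_mul_le [∀ i, SFinite (μ i)] {s t : ℝ} (hr : 0 < r) (hrs : r < s)
    (hst : 1 / r = 1 / s + 1 / t) (hf : Measurable f) (hg : Measurable g) (x : ∀ i, Ω i) :
    coordNorm μ i r (fun x => f x * g x) x ≤ coordNorm μ i s f x * coordNorm μ i t g x := by
  unfold coordNorm
  exact ENNReal.lintegral_Lp_mul_le_Lq_mul_Lr hr hrs hst (μ i)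
    (hf.comp (measurable_update x)).aemeasurable (hg.comp (measurable_update x)).aemeasurable

/-- Hölder in each variable with `1/p = a/p + (1-a)/p`; the `p/a`-norm of `f^a` is the `a`-th power
of the `p`-norm of `f`, so the shape survives the passage to the next variable. -/
lemma iterNorm_mul_le [∀ i, SFinite (μ i)] {a : ℝ} (ha0 : 0 < a) (ha1 : a < 1)
    (hp : ∀ i ∈ l, 0 < p i) (hf : Measurable f) (hg : Measurable g) (x : ∀ i, Ω i) :
    iterNorm μ p l (fun x => f x ^ a * g x) x ≤
      iterNorm μ p l f x ^ a * iterNorm μ (fun i => p i / (1 - a)) l g x := by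
  induction l generalizing f g with
  | nil => exact le_rfl
  | cons i l ih =>
    have hpi := hp i (by simp)
    have hp' : ∀ j ∈ l, 0 < p j := fun j hj => hp j (by simp [hj])
    simp only [iterNorm]
    refine le_trans (iterNorm_mono hp' (fun z => coordNorm_mul_le (s := p i / a)
      (t := p i / (1 - a)) hpi ?_ ?_ (hf.pow_const _) hg z) x) ?_
    · rw [lt_div_iff₀ ha0]; nlinarith
    · have : 1 - a ≠ 0 := by linarith
      field_simp; ring
    · rw [coordNorm_rpow hpi ha0]
      exact ih hp' (measurable_coordNorm hf) (measurable_coordNorm hg)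

lemma coordNorm_add_le [∀ i, SFinite (μ i)] (hr : 1 ≤ r) (hf : Measurable f) (hg : Measurable g)
    (x : ∀ i, Ω i) :
    coordNorm μ i r (fun x => f x + g x) x ≤ coordNorm μ i r f x + coordNorm μ i r g x := by
  unfold coordNorm
  exact ENNReal.lintegral_Lp_add_le (hf.comp (measurable_update x)).aemeasurable
    (hg.comp (measurable_update x)).aemeasurable hr

lemma iterNorm_add_le [∀ i, SFinite (μ i)] (hp : ∀ i ∈ l, 1 ≤ p i) (hf : Measurable f)
    (hg : Measurable g) (x : ∀ i, Ω i) :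
    iterNorm μ p l (fun x => f x + g x) x ≤ iterNorm μ p l f x + iterNorm μ p l g x := by
  induction l generalizing f g with
  | nil => exact le_rfl
  | cons i l ih =>
    have hp' : ∀ j ∈ l, 1 ≤ p j := fun j hj => hp j (by simp [hj])
    simp only [iterNorm]
    refine le_trans (iterNorm_mono (fun j hj => by linarith [hp' j hj])
      (coordNorm_add_le (hp i (by simp)) hf hg) x) ?_
    exact ih hp' (measurable_coordNorm hf) (measurable_coordNorm hg)

lemma iterNorm_sum_le [∀ i, SFinite (μ i)] {ι : Type*} {F : ι → (∀ i, Ω i) → ℝ≥0∞}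
    (s : Finset ι) (hp : ∀ i ∈ l, 1 ≤ p i) (hF : ∀ k, Measurable (F k)) (x : ∀ i, Ω i) :
    iterNorm μ p l (fun x => ∑ k ∈ s, F k x) x ≤ ∑ k ∈ s, iterNorm μ p l (F k) x := by
  classical
  induction s using Finset.induction_on with
  | empty =>
    have h0 := iterNorm_const_mul (μ := μ) (p := p) (l := l) (g := fun _ => 0)
      (fun i hi => by linarith [hp i hi]) 0 measurable_const x
    simp only [Finset.sum_empty, zero_mul, mul_zero] at h0 ⊢
    exact h0.le
  | insert a s ha ih =>
    simp_rw [Finset.sum_insert ha]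
    refine (iterNorm_add_le hp (hF a) (Finset.measurable_sum _ fun k _ => hF k) x).trans ?_
    gcongr

/-- The constant of the quasi-triangle inequality of the `L_r` quasi-norm. -/
def quasiConst (r : ℝ) : ℝ≥0 := 2 * 2 ^ (1 / r)

lemma coordNorm_add_le_quasi [∀ i, SFinite (μ i)] (hr : 0 < r) (hf : Measurable f)
    (x : ∀ i, Ω i) :
    coordNorm μ i r (fun x => f x + g x) x ≤
      quasiConst r * (coordNorm μ i r f x + coordNorm μ i r g x) := by
  have key : ∀ (s : ℝ), 0 < s → ∀ a b : ℝ≥0∞, (a + b) ^ s ≤ 2 ^ s * (a ^ s + b ^ s) := by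
    intro s hs a b
    wlog hab : a ≤ b generalizing a b
    · rw [add_comm a, add_comm (a ^ s)]
      exact this b a (le_of_not_ge hab)
    calc (a + b) ^ s ≤ (2 * b) ^ s := by rw [two_mul]; gcongr
      _ = 2 ^ s * b ^ s := ENNReal.mul_rpow_of_nonneg _ _ hs.le
      _ ≤ _ := by gcongr; exact le_add_self
  unfold coordNorm quasiConst
  set A := ∫⁻ y, f (Function.update x i y) ^ r ∂μ i
  set B := ∫⁻ y, g (Function.update x i y) ^ r ∂μ i
  calc (∫⁻ y, (f (Function.update x i y) + g (Function.update x i y)) ^ r ∂μ i) ^ (1 / r)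
      ≤ (∫⁻ y, 2 ^ r * (f (Function.update x i y) ^ r + g (Function.update x i y) ^ r) ∂μ i)
          ^ (1 / r) := by
        gcongr
        exact key r hr _ _
    _ = (2 ^ r * (A + B)) ^ (1 / r) := by
        rw [lintegral_const_mul' _ _ (by simp), lintegral_add_left]
        exact (hf.comp (measurable_update x)).pow_const _
    _ = 2 * (A + B) ^ (1 / r) := by
        rw [ENNReal.mul_rpow_of_nonneg _ _ (by positivity), ← ENNReal.rpow_mul,
          mul_one_div_cancel hr.ne', ENNReal.rpow_one]
    _ ≤ 2 * (2 ^ (1 / r) * (A ^ (1 / r) + B ^ (1 / r))) := by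
        gcongr
        exact key _ (by positivity) _ _
    _ = _ := by
        push_cast
        rw [ENNReal.coe_rpow_of_nonneg _ (by positivity)]
        simp [mul_assoc]

lemma iterNorm_add_le_quasi (p : Fin d → ℝ) (l : List (Fin d)) (hp : ∀ i ∈ l, 0 < p i) :
    ∃ C : ℝ≥0, 1 ≤ C ∧ ∀ (Ω : Fin d → Type*) [∀ i, MeasurableSpace (Ω i)] (μ : ∀ i, Measure (Ω i))
      [∀ i, SFinite (μ i)] (f g : (∀ i, Ω i) → ℝ≥0∞), Measurable f → Measurable g →
      ∀ x, iterNorm μ p l (fun x => f x + g x) x ≤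
        C * (iterNorm μ p l f x + iterNorm μ p l g x) := by
  induction l with
  | nil => exact ⟨1, le_rfl, fun _ _ _ _ _ _ _ _ _ => by simp [iterNorm]⟩
  | cons i l ih =>
    have hp' : ∀ j ∈ l, 0 < p j := fun j hj => hp j (by simp [hj])
    have hpi := hp i (by simp)
    obtain ⟨C, hC1, hC⟩ := ih hp'
    refine ⟨quasiConst (p i) * C, ?_, fun Ω _ μ _ f g hf hg x => ?_⟩
    · refine one_le_mul ?_ hC1
      unfold quasiConst
      have : (1 : ℝ≥0) ≤ 2 ^ (1 / p i) := NNReal.one_le_rpow (by norm_num) (by positivity)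
      calc (1 : ℝ≥0) ≤ 2 * 1 := by norm_num
        _ ≤ _ := by gcongr
    · simp only [iterNorm]
      refine (iterNorm_mono hp' (coordNorm_add_le_quasi hpi hf) x).trans ?_
      rw [iterNorm_const_mul (g := fun x => coordNorm μ i (p i) f x + coordNorm μ i (p i) g x) hp' _
        ((measurable_coordNorm hf).add (measurable_coordNorm hg))]
      push_cast
      rw [mul_assoc]
      gcongr
      exact hC Ω μ _ _ (measurable_coordNorm hf) (measurable_coordNorm hg) x

lemma coordNorm_iSup [∀ i, SFinite (μ i)] (hr : 0 < r) {F : ℕ → (∀ i, Ω i) → ℝ≥0∞}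
    (hF : ∀ n, Measurable (F n)) (hmono : Monotone F) :
    coordNorm μ i r (fun x => ⨆ n, F n x) = fun x => ⨆ n, coordNorm μ i r (F n) x := by
  funext x
  unfold coordNorm
  have h1 : ∀ s : ℝ, 0 < s → ∀ u : ℕ → ℝ≥0∞, (⨆ n, u n) ^ s = ⨆ n, u n ^ s := fun s hs u =>
    (ENNReal.orderIsoRpow s hs).map_iSup u
  simp_rw [h1 r hr]
  rw [lintegral_iSup, h1 _ (by positivity)]
  · exact fun n => ((hF n).comp (measurable_update x)).pow_const _
  · intro a b hab y
    exact ENNReal.rpow_le_rpow (hmono hab _) hr.le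

lemma iterNorm_iSup [∀ i, SFinite (μ i)] (hp : ∀ i ∈ l, 0 < p i) {F : ℕ → (∀ i, Ω i) → ℝ≥0∞}
    (hF : ∀ n, Measurable (F n)) (hmono : Monotone F) :
    iterNorm μ p l (fun x => ⨆ n, F n x) = fun x => ⨆ n, iterNorm μ p l (F n) x := by
  induction l generalizing F with
  | nil => rfl
  | cons i l ih =>
    simp only [iterNorm]
    rw [coordNorm_iSup (hp i (by simp)) hF hmono]
    exact ih (fun j hj => hp j (by simp [hj])) (fun n => measurable_coordNorm (hF n))
      fun a b hab x => coordNorm_mono (hp i (by simp)) (hmono hab) x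

/-- With equal exponents the inner roots and powers cancel and Tonelli merges the integrals. This is
how the iterated norm becomes an ordinary `L_Q` norm at the end of the extrapolation. -/
lemma iterNorm_const_exponent [∀ i, SigmaFinite (μ i)] (hr : 0 < r) (hl : l.Nodup)
    (hg : Measurable g) (x : ∀ i, Ω i) :
    iterNorm μ (fun _ => r) l g x = (lmarginal μ l.toFinset (fun z => g z ^ r) x) ^ (1 / r) := by
  induction l generalizing g with
  | nil =>
    simp only [iterNorm, List.toFinset_nil, lmarginal_empty]
    rw [← ENNReal.rpow_mul, mul_one_div_cancel hr.ne', ENNReal.rpow_one]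
  | cons i l ih =>
    rw [List.nodup_cons] at hl
    simp only [iterNorm]
    rw [ih hl.2 (measurable_coordNorm hg), List.toFinset_cons,
      lmarginal_insert' _ (hg.pow_const _) (by simpa using hl.1)]
    congr 2
    funext z
    unfold coordNorm
    rw [← ENNReal.rpow_mul, one_div_mul_cancel hr.ne', ENNReal.rpow_one]

lemma iterNorm_finRange_const_exponent [∀ i, SigmaFinite (μ i)] (hr : 0 < r)
    (hg : Measurable g) (x : ∀ i, Ω i) :
    iterNorm μ (fun _ => r) (List.finRange d) g x = (∫⁻ z, g z ^ r ∂Measure.pi μ) ^ (1 / r) := by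
  rw [iterNorm_const_exponent hr (List.nodup_finRange d) hg, List.toFinset_finRange,
    lmarginal_univ]

end CoordNorm

/-! ### The mixed norm as an iterated norm, and its behaviour under almost sure inequalities. -/

section MixedNorm

lemma mixedNorm_succ {d : ℕ} {Ω : Fin (d + 1) → Type*} [∀ i, MeasurableSpace (Ω i)]
    (μ : ∀ i, Measure (Ω i)) (p : Fin (d + 1) → ℝ≥0∞) (g : (∀ i, Ω i) → ℝ≥0∞) :
    mixedNorm μ p g = mixedNorm (fun i => μ i.succ) (fun i => p i.succ)
        (fun x => eLpNorm (fun y => g (Fin.cons y x)) (p 0) (μ 0)) := rfl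

lemma iterNorm_map_succ {d : ℕ} {Ω : Fin (d + 1) → Type*} [∀ i, MeasurableSpace (Ω i)]
    (μ : ∀ i, Measure (Ω i)) (p : Fin (d + 1) → ℝ) (l : List (Fin d))
    (G : (∀ i : Fin d, Ω i.succ) → ℝ≥0∞) :
    iterNorm μ p (l.map Fin.succ) (fun x => G (Fin.tail x)) =
      fun x => iterNorm (fun i => μ i.succ) (fun i => p i.succ) l G (Fin.tail x) := by
  induction l generalizing G with
  | nil => rfl
  | cons i l ih =>
    simp only [iterNorm, List.map_cons]
    rw [← ih]
    congr 1
    funext x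
    simp only [coordNorm, Fin.tail_update_succ]

lemma mixedNorm_eq_iterNorm {d : ℕ} {Ω : Fin d → Type*} [∀ i, MeasurableSpace (Ω i)]
    (μ : ∀ i, Measure (Ω i)) {p : Fin d → ℝ≥0∞} (hp0 : ∀ i, 0 < p i) (hp : ∀ i, p i < ∞)
    (g : (∀ i, Ω i) → ℝ≥0∞) (x : ∀ i, Ω i) :
    mixedNorm μ p g = iterNorm μ (fun i => (p i).toReal) (List.finRange d) g x := by
  induction d with
  | zero =>
    simp only [List.finRange_zero, iterNorm, mixedNorm]
    congr 1
    exact Subsingleton.elim _ _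
  | succ d ih =>
    rw [mixedNorm_succ, ih _ (fun i => hp0 i.succ) (fun i => hp i.succ) _ (Fin.tail x),
      List.finRange_succ, iterNorm]
    rw [← congrFun (iterNorm_map_succ μ (fun i => (p i).toReal) (List.finRange d)
      (fun z => eLpNorm (fun y => g (Fin.cons y z)) (p 0) (μ 0))) x]
    congr 1
    funext z
    rw [eLpNorm_eq_lintegral_rpow_enorm_toReal (hp0 0).ne' (hp 0).ne]
    unfold coordNorm
    congr 1
    refine lintegral_congr fun y => ?_
    rw [← Fin.cons_self_tail z, Fin.update_cons_zero]
    simp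

variable {d : ℕ} {Ω : Fin d → Type*} [mΩ : ∀ i, MeasurableSpace (Ω i)]

lemma measurable_cons {d : ℕ} {Ω : Fin (d + 1) → Type*} [∀ i, MeasurableSpace (Ω i)] :
    Measurable fun q : (∀ i : Fin d, Ω i.succ) × Ω 0 => (Fin.cons q.2 q.1 : ∀ i, Ω i) := by
  rw [measurable_pi_iff]
  intro i
  refine Fin.cases ?_ (fun j => ?_) i
  · simpa using measurable_snd
  · exact (measurable_pi_apply j).comp measurable_fst

lemma ae_ae_cons {d : ℕ} {Ω : Fin (d + 1) → Type*} [∀ i, MeasurableSpace (Ω i)]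
    (μ : ∀ i, Measure (Ω i)) [∀ i, SigmaFinite (μ i)] {P : (∀ i, Ω i) → Prop}
    (h : ∀ᵐ x ∂Measure.pi μ, P x) :
    ∀ᵐ z ∂Measure.pi (fun i : Fin d => μ i.succ), ∀ᵐ y ∂μ 0, P (Fin.cons y z) := by
  have hmp := (measurePreserving_piFinSuccAbove μ 0).symm
  have h2 := hmp.quasiMeasurePreserving.ae h
  have h3 := (Measure.measurePreserving_swap
    (μ := Measure.pi (fun i : Fin d => μ (Fin.succAbove 0 i)))
    (ν := μ 0)).quasiMeasurePreserving.ae h2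
  have h4 := Measure.ae_ae_of_ae_prod h3
  refine h4.mono fun z hz => hz.mono fun y hy => ?_
  have he : (MeasurableEquiv.piFinSuccAbove Ω 0).symm (z, y).swap = Fin.cons y z :=
    Fin.insertNth_zero y z
  rwa [he] at hy

lemma mixedNorm_mono_ae {d : ℕ} {Ω : Fin d → Type*} [∀ i, MeasurableSpace (Ω i)]
    (μ : ∀ i, Measure (Ω i)) [∀ i, SigmaFinite (μ i)] (p : Fin d → ℝ≥0∞)
    {f g : (∀ i, Ω i) → ℝ≥0∞} (h : ∀ᵐ x ∂Measure.pi μ, f x ≤ g x) :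
    mixedNorm μ p f ≤ mixedNorm μ p g := by
  induction d with
  | zero =>
    simp only [mixedNorm]
    rw [Measure.pi_of_empty μ (fun i => i.elim0)] at h
    simpa [ae_dirac_eq] using h
  | succ d ih =>
    rw [mixedNorm_succ, mixedNorm_succ]
    refine ih _ _ ?_
    filter_upwards [ae_ae_cons μ h] with z hz
    refine eLpNorm_mono_enorm_ae ?_
    simpa using hz

lemma ae_of_ae_ae_cons {d : ℕ} {Ω : Fin (d + 1) → Type*} [∀ i, MeasurableSpace (Ω i)]
    (μ : ∀ i, Measure (Ω i)) [∀ i, SigmaFinite (μ i)] {P : (∀ i, Ω i) → Prop}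
    (hP : MeasurableSet {x | P x})
    (h : ∀ᵐ z ∂Measure.pi (fun i : Fin d => μ i.succ), ∀ᵐ y ∂μ 0, P (Fin.cons y z)) :
    ∀ᵐ x ∂Measure.pi μ, P x := by
  have hmp := measurePreserving_piFinSuccAbove μ 0
  have hcons := measurable_cons (Ω := Ω)
  have h2 := (Measure.ae_prod_iff_ae_ae (μ := Measure.pi (fun i : Fin d => μ i.succ)) (ν := μ 0)
    (p := fun q => P (Fin.cons q.2 q.1)) (hcons hP)).2 h
  have h3 := (Measure.measurePreserving_swap (μ := μ 0)
    (ν := Measure.pi (fun i : Fin d => μ i.succ))).quasiMeasurePreserving.ae h2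
  have h4 := hmp.quasiMeasurePreserving.ae h3
  refine h4.mono fun z hz => ?_
  have : (Fin.cons (z 0) (fun j : Fin d => z j.succ) : ∀ i, Ω i) = z := Fin.cons_self_tail z
  rw [← this]
  exact hz

lemma ae_lt_top_of_mixedNorm_ne_top {d : ℕ} {Ω : Fin d → Type*} [∀ i, MeasurableSpace (Ω i)]
    (μ : ∀ i, Measure (Ω i)) [∀ i, SigmaFinite (μ i)] {p : Fin d → ℝ≥0∞} (hp0 : ∀ i, 0 < p i)
    (hp : ∀ i, p i < ∞) {g : (∀ i, Ω i) → ℝ≥0∞} (hg : Measurable g) (h : mixedNorm μ p g ≠ ∞) :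
    ∀ᵐ x ∂Measure.pi μ, g x < ∞ := by
  induction d with
  | zero =>
    refine Filter.Eventually.of_forall fun x => ?_
    simp only [mixedNorm] at h
    rw [Subsingleton.elim x (fun i => i.elim0)]
    exact h.lt_top
  | succ d ih =>
    have hcons := measurable_cons (Ω := Ω)
    rw [mixedNorm_succ] at h
    have hm : Measurable fun x : (∀ i : Fin d, Ω i.succ) =>
        eLpNorm (fun y => g (Fin.cons y x)) (p 0) (μ 0) := by
      simp_rw [eLpNorm_eq_lintegral_rpow_enorm_toReal (hp0 0).ne' (hp 0).ne]
      refine Measurable.pow_const ?_ _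
      refine Measurable.lintegral_prod_right' (f := fun q : (∀ i : Fin d, Ω i.succ) × Ω 0 =>
        ‖g (Fin.cons q.2 q.1)‖ₑ ^ (p 0).toReal) ?_
      simpa using (hg.comp hcons).pow_const _
    refine ae_of_ae_ae_cons μ (measurableSet_lt hg measurable_const) ?_
    filter_upwards [ih _ (fun i => hp0 i.succ) (fun i => hp i.succ) hm h] with z hz
    rw [eLpNorm_lt_top_iff_lintegral_rpow_enorm_lt_top (hp0 0).ne' (hp 0).ne] at hz
    have hgz : Measurable fun y => g (Fin.cons y z) := by
      have : Measurable fun y : Ω 0 => ((z, y) : (∀ i : Fin d, Ω i.succ) × Ω 0) :=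
        measurable_prodMk_left
      exact hg.comp (hcons.comp this)
    have h5 := ae_lt_top (by simpa using hgz.pow_const _) hz.ne
    filter_upwards [h5] with y hy
    by_contra hcon
    have : g (Fin.cons y z) = ∞ := by simpa using hcon
    simp [this, ENNReal.toReal_pos (hp0 0).ne' (hp 0).ne] at hy

end MixedNorm

/-! ### Weighted sums of increments of an increasing sequence. -/

section ControlTransform

/-- The weighted sum `∑_{k ≤ n} (a_k - a_{k-1}) w_k` of the increments of `a`. -/
def ctrlTransform (a w : ℕ → ℝ≥0) : ℕ → ℝ≥0
  | 0 => a 0 * w 0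
  | n + 1 => ctrlTransform a w n + (a (n + 1) - a n) * w (n + 1)

variable {a w w' : ℕ → ℝ≥0} {n : ℕ}

lemma ctrlTransform_mono : Monotone (ctrlTransform a w) :=
  monotone_nat_of_le_succ fun _ => le_self_add

lemma ctrlTransform_le_mul (ha : Monotone a) {B : ℝ≥0} (hw : ∀ k ≤ n, w k ≤ B) :
    ctrlTransform a w n ≤ a n * B := by
  induction n with
  | zero => exact mul_le_mul_right (hw 0 le_rfl) _
  | succ n ih =>
    calc ctrlTransform a w n + (a (n + 1) - a n) * w (n + 1)
        ≤ a n * B + (a (n + 1) - a n) * B := by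
          gcongr
          · exact ih fun k hk => hw k (hk.trans n.le_succ)
          · exact hw _ le_rfl
      _ = a (n + 1) * B := by rw [← add_mul, add_tsub_cancel_of_le (ha n.le_succ)]

lemma mul_le_ctrlTransform (ha : Monotone a) (hw : Antitone w) :
    a n * w n ≤ ctrlTransform a w n := by
  induction n with
  | zero => exact le_rfl
  | succ n ih =>
    calc a (n + 1) * w (n + 1) = a n * w (n + 1) + (a (n + 1) - a n) * w (n + 1) := by
          rw [← add_mul, add_tsub_cancel_of_le (ha n.le_succ)]
      _ ≤ a n * w n + (a (n + 1) - a n) * w (n + 1) := by gcongr; exact hw n.le_succ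
      _ ≤ _ := add_le_add_left ih _

lemma ctrlTransform_le_ctrlTransform (hw : ∀ k ≤ n, w k ≤ w' k) :
    ctrlTransform a w n ≤ ctrlTransform a w' n := by
  induction n with
  | zero => exact mul_le_mul_right (hw 0 le_rfl) _
  | succ n ih =>
    simp only [ctrlTransform]
    gcongr
    · exact ih fun k hk => hw k (hk.trans n.le_succ)
    · exact hw _ le_rfl

lemma ctrlTransform_mul_const (c : ℝ≥0) :
    ctrlTransform a (fun k => w k * c) n = ctrlTransform a w n * c := by
  induction n with
  | zero => simp [ctrlTransform, mul_assoc]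
  | succ n ih => simp only [ctrlTransform, ih]; ring

/-- Summation by parts. For decreasing weights the right side is a combination of the `a k` with
nonnegative coefficients, to which the triangle inequality of a norm applies; the increments of `a`
on the left would not allow this. -/
lemma ctrlTransform_eq_sum (ha : Monotone a) (hw : Antitone w) :
    ctrlTransform a w n = a n * w n + ∑ k ∈ Finset.range n, a k * (w k - w (k + 1)) := by
  induction n with
  | zero => simp [ctrlTransform]
  | succ n ih =>
    rw [ctrlTransform, ih, Finset.sum_range_succ]
    have h1 : a n * w n = a n * w (n + 1) + a n * (w n - w (n + 1)) := by
      rw [← mul_add, add_tsub_cancel_of_le (hw n.le_succ)]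
    have h2 : a (n + 1) * w (n + 1) = a n * w (n + 1) + (a (n + 1) - a n) * w (n + 1) := by
      rw [← add_mul, add_tsub_cancel_of_le (ha n.le_succ)]
    rw [h1, h2]; ring

/-- Concavity of `t ↦ t^ε`: the slope of the chord from `x` to `y` is at least the derivative at
`y`. It is Bernoulli's inequality for `x / y`. -/
lemma sub_mul_rpow_le {x y ε : ℝ≥0} (hxy : x ≤ y) (hx : 0 < x) (hε1 : ε ≤ 1) :
    x ^ (ε : ℝ) + ε * ((y - x) * y ^ (-(1 - ε) : ℝ)) ≤ y ^ (ε : ℝ) := by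
  have hy : 0 < y := hx.trans_le hxy
  rw [← NNReal.coe_le_coe]
  push_cast [NNReal.coe_sub hxy]
  have hyR : (0 : ℝ) < y := hy
  have hxR : (0 : ℝ) < x := hx
  have hxyR : (x : ℝ) ≤ y := hxy
  have hb := rpow_one_add_le_one_add_mul_self (s := (x : ℝ) / y - 1) (p := ε)
    (by have : (0 : ℝ) ≤ x / y := by positivity
        linarith) ε.2 (by exact_mod_cast hε1)
  have h1 : 1 + ((x : ℝ) / y - 1) = x / y := by ring
  rw [h1, Real.div_rpow hxR.le hyR.le, div_le_iff₀ (by positivity)] at hb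
  have h2 : (y : ℝ) ^ (-(1 - ε) : ℝ) = (y : ℝ) ^ (ε : ℝ) / y := by
    rw [show (-(1 - ε) : ℝ) = (ε : ℝ) - 1 by ring, Real.rpow_sub hyR, Real.rpow_one]
  rw [h2]
  calc (x : ℝ) ^ (ε : ℝ) + ε * ((y - x) * ((y : ℝ) ^ (ε : ℝ) / y))
      ≤ (1 + ε * ((x : ℝ) / y - 1)) * (y : ℝ) ^ (ε : ℝ)
        + ε * ((y - x) * ((y : ℝ) ^ (ε : ℝ) / y)) := by gcongr
    _ = (y : ℝ) ^ (ε : ℝ) := by field_simp; ring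

/-- A discrete form of `∫_0^A t^{ε-1} dt = A^ε / ε`. Each weight sits at the right endpoint of its
increment, where the decreasing integrand is smallest, so the sum lies below the integral. -/
lemma ctrlTransform_rpow_le (ha : Monotone a) (ha0 : ∀ n, 0 < a n) {ε : ℝ} (hε0 : 0 < ε)
    (hε1 : ε ≤ 1) :
    ctrlTransform a (fun k => a k ^ (-(1 - ε))) n ≤ ε.toNNReal⁻¹ * a n ^ ε := by
  lift ε to ℝ≥0 using hε0.le
  have hε0' : 0 < ε := hε0
  rw [Real.toNNReal_coe, ← div_eq_inv_mul, le_div_iff₀ hε0', mul_comm]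
  induction n with
  | zero =>
    simp only [ctrlTransform]
    rw [← NNReal.rpow_one_add' (by simpa using hε0.ne')]
    calc _ ≤ 1 * a 0 ^ (1 + -(1 - ε : ℝ)) := by gcongr; exact_mod_cast hε1
      _ = _ := by rw [one_mul]; congr 1; ring
  | succ n ih =>
    simp only [ctrlTransform, mul_add]
    exact (add_le_add_left ih _).trans
      (sub_mul_rpow_le (ha n.le_succ) (ha0 n) (by exact_mod_cast hε1))

lemma ctrlTransform_truncate_le (ha : Monotone a) (K : ℝ≥0) :
    ctrlTransform a (fun k => if a k ≤ K then 1 else 0) n ≤ min (a n) K := by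
  induction n with
  | zero =>
    by_cases h : a 0 ≤ K <;> simp [ctrlTransform, h]
  | succ n ih =>
    simp only [ctrlTransform]
    by_cases h : a (n + 1) ≤ K
    · have : ctrlTransform a (fun k => if a k ≤ K then 1 else 0) n + (a (n + 1) - a n)
          ≤ a (n + 1) := by
        calc _ ≤ a n + (a (n + 1) - a n) := by gcongr; exact ih.trans (min_le_left _ _)
          _ = _ := add_tsub_cancel_of_le (ha n.le_succ)
      simpa [h] using this
    · simp only [h, if_false, mul_zero, add_zero]
      exact ih.trans (min_le_min_right _ (ha n.le_succ))

lemma measurable_ctrlTransform {X : Type*} {m : MeasurableSpace X} {l v : ℕ → X → ℝ≥0}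
    (hl : ∀ k ≤ n, Measurable (l k)) (hv : ∀ k ≤ n, Measurable (v k)) :
    Measurable fun x => ctrlTransform (fun k => l k x) (fun k => v k x) n := by
  induction n with
  | zero => exact (hl 0 le_rfl).mul (hv 0 le_rfl)
  | succ n ih =>
    simp only [ctrlTransform]
    refine Measurable.add (ih (fun k hk => hl k (hk.trans n.le_succ))
      fun k hk => hv k (hk.trans n.le_succ)) (Measurable.mul ?_ (hv _ le_rfl))
    exact (hl _ le_rfl).sub (hl n n.le_succ)

lemma adapted_ctrlTransform {X : Type*} {m : MeasurableSpace X} {𝒢 : Filtration ℕ m}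
    {l v : ℕ → X → ℝ≥0} (hl : Adapted 𝒢 l) (hv : Adapted 𝒢 v) :
    Adapted 𝒢 fun n x => ctrlTransform (fun k => l k x) (fun k => v k x) n := fun n =>
  measurable_ctrlTransform (m := 𝒢 n) (fun k hk => (hl k).mono (𝒢.mono hk) le_rfl)
    fun k hk => (hv k).mono (𝒢.mono hk) le_rfl

end ControlTransform

/-! ### Extrapolation from one `L_Q` estimate to mixed norms with smaller exponents. -/

section Extrapolation

variable {d : ℕ} {Ω : Fin d → Type*} [mΩ : ∀ i, MeasurableSpace (Ω i)]

/-- A family of pairs of a function `T` and a control sequence `l`, closed under enlarging the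
control and under predictable transforms with decreasing weights, such that an `L_Q`-estimate with
constant `A` holds for controls bounded from above and from below. -/
structure TransformClosed (μ : ∀ i, Measure (Ω i)) (ℱ : ∀ i, Filtration ℕ (mΩ i)) (Q : ℝ) (A : ℝ≥0)
    (R : ((∀ i, Ω i) → ℝ≥0∞) → (ℕ → (∀ i, Ω i) → ℝ≥0) → Prop) : Prop where
  measurable : ∀ {T l}, R T l → Measurable T
  control : ∀ {T l}, R T l → l ∈ controls ℱ
  enlarge : ∀ {T l l'}, R T l → l' ∈ controls ℱ → (∀ n x, l n x ≤ l' n x) → R T l'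
  transform : ∀ {T l w}, R T l → Adapted (prodFiltration ℱ) w → Antitone w →
    (∃ B : ℝ≥0, ∀ n x, w n x ≤ B) →
    ∃ T', R T' (fun n x => ctrlTransform (fun k => l k x) (fun k => w k x) n) ∧
      ∀ᵐ x ∂Measure.pi μ, ∀ W : ℝ≥0, (∀ n, 1 ≤ W * w n x) → T x ≤ 2 * W * T' x
  base : ∀ {T l}, R T l → ∀ η K : ℝ≥0, 0 < η → (∀ n x, η ≤ l n x) → (∀ n x, l n x ≤ K) →
    ∫⁻ x, T x ^ Q ∂Measure.pi μ ≤ A * ∫⁻ x, controlLim l x ^ Q ∂Measure.pi μ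

end Extrapolation

section Extrapolation

variable {d : ℕ} {Ω : Fin d → Type*} [mΩ : ∀ i, MeasurableSpace (Ω i)]
  {μ : ∀ i, Measure (Ω i)} {ℱ : ∀ i, Filtration ℕ (mΩ i)}

lemma measurable_of_adapted {l : ℕ → (∀ i, Ω i) → ℝ≥0} (hl : Adapted (prodFiltration ℱ) l) (n : ℕ) :
    Measurable (l n) := (hl n).mono ((prodFiltration ℱ).le n) le_rfl

lemma IndepOf.ctrlTransform {d : ℕ} {Ω : Fin d → Type*} {i : Fin d} {l w : ℕ → (∀ i, Ω i) → ℝ≥0} (hl : ∀ n, IndepOf i (l n))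
    (hw : ∀ n, IndepOf i (w n)) (n : ℕ) :
    IndepOf i fun x => ctrlTransform (fun k => l k x) (fun k => w k x) n := by
  intro x y
  simp only [hl _ x y, hw _ x y]

lemma coe_le_coordNorm [∀ i, IsProbabilityMeasure (μ i)] {i : Fin d} {P : ℝ} (hP : 0 < P)
    {u : (∀ i, Ω i) → ℝ≥0∞} {η : ℝ≥0∞} (hη : ∀ x, η ≤ u x) (x : ∀ i, Ω i) :
    η ≤ coordNorm μ i P u x := by
  have := coordNorm_mono (μ := μ) (i := i) hP hη x
  rwa [coordNorm_const hP] at this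

lemma coordNorm_le_coe [∀ i, IsProbabilityMeasure (μ i)] {i : Fin d} {P : ℝ} (hP : 0 < P)
    {u : (∀ i, Ω i) → ℝ≥0∞} {K : ℝ≥0∞} (hK : ∀ x, u x ≤ K) (x : ∀ i, Ω i) :
    coordNorm μ i P u x ≤ K := by
  have := coordNorm_mono (μ := μ) (i := i) hP hK x
  rwa [coordNorm_const hP] at this

/-- The predictable weight comparing the increasing processes `u` and `‖u‖_{L_P}` (norm in the
`i`-th variable). -/
lemma exists_comparison_weight [∀ i, IsProbabilityMeasure (μ i)] (i : Fin d) {P ε : ℝ}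
    (hP : 0 < P) (hε0 : 0 < ε) (hε1 : ε ≤ 1) {u : ℕ → (∀ i, Ω i) → ℝ≥0}
    (hu : Adapted (prodFiltration ℱ) u) (hmono : Monotone u) {η K : ℝ≥0} (hη0 : 0 < η)
    (hη : ∀ n x, η ≤ u n x) (hK : ∀ n x, u n x ≤ K) :
    ∃ φ : ℕ → (∀ i, Ω i) → ℝ≥0, Adapted (prodFiltration ℱ) φ ∧ Monotone φ ∧
      (∃ c : ℝ≥0, 0 < c ∧ ∀ n x, c ≤ φ n x) ∧ (∃ B : ℝ≥0, ∀ n x, φ n x ≤ B) ∧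
      (∀ j, (∀ n, IndepOf j (u n)) → ∀ n, IndepOf j (φ n)) ∧
      (∀ n x, u n x ^ P *
        ((coordNorm μ i P (fun z => (u n z : ℝ≥0∞)) x).toNNReal ^ P) ^ (-(1 - ε)) ≤ φ n x) ∧
      ∀ n x, ∫⁻ y, (φ n (Function.update x i y) : ℝ≥0∞) ∂μ i ≤
        ε.toNNReal⁻¹ * coordNorm μ i P (fun z => (u n z : ℝ≥0∞)) x ^ (P * ε) := by
  set v : ℕ → (∀ i, Ω i) → ℝ≥0∞ := fun n => coordNorm μ i P (fun z => (u n z : ℝ≥0∞)) with hv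
  have hvK : ∀ n x, v n x ≤ K := fun n => coordNorm_le_coe hP (by exact_mod_cast hK n)
  have hvη : ∀ n x, (η : ℝ≥0∞) ≤ v n x := fun n => coe_le_coordNorm hP (by exact_mod_cast hη n)
  have hvtop : ∀ n x, v n x ≠ ∞ := fun n x => ((hvK n x).trans_lt ENNReal.coe_lt_top).ne
  have hvmono : Monotone v := fun a b hab =>
    coordNorm_mono hP fun x => by exact_mod_cast hmono hab x
  set V : ℕ → (∀ i, Ω i) → ℝ≥0 := fun n x => (v n x).toNNReal ^ P with hV
  set U : ℕ → (∀ i, Ω i) → ℝ≥0 := fun n x => u n x ^ P with hU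
  have hUmono : Monotone U := fun a b hab x => NNReal.rpow_le_rpow (hmono hab x) hP.le
  have hVmono : Monotone V := fun a b hab x =>
    NNReal.rpow_le_rpow (ENNReal.toNNReal_mono (hvtop b x) (hvmono hab x)) hP.le
  have hVη : ∀ n x, η ^ P ≤ V n x := fun n x =>
    NNReal.rpow_le_rpow (by simpa using ENNReal.toNNReal_mono (hvtop n x) (hvη n x)) hP.le
  have hVK : ∀ n x, V n x ≤ K ^ P := fun n x =>
    NNReal.rpow_le_rpow (by simpa using ENNReal.toNNReal_mono ENNReal.coe_ne_top (hvK n x)) hP.le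
  have hηP : 0 < η ^ P := NNReal.rpow_pos hη0
  have hV0 : ∀ n x, 0 < V n x := fun n x => hηP.trans_le (hVη n x)
  have hUad : Adapted (prodFiltration ℱ) U := fun n => (hu n).pow_const P
  have hVad : Adapted (prodFiltration ℱ) V := fun n => by
    have h1 : Measurable[prodFiltration ℱ n] (v n) :=
      measurable_coordNorm_prodFiltration (hu n).coe_nnreal_ennreal
    exact h1.ennreal_toNNReal.pow_const P
  have hWad : Adapted (prodFiltration ℱ) fun n x => V n x ^ (-(1 - ε)) :=
    fun n => (hVad n).pow_const _
  have hWanti : ∀ x, Antitone fun n => V n x ^ (-(1 - ε)) := fun x a b hab =>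
    NNReal.rpow_le_rpow_of_nonpos (hV0 a x) (hVmono hab x) (by linarith)
  have hint : ∀ n x, ∫⁻ y, (U n (Function.update x i y) : ℝ≥0∞) ∂μ i = V n x := by
    intro n x
    simp only [hV, hU]
    rw [ENNReal.coe_rpow_of_nonneg _ hP.le, ENNReal.coe_toNNReal (hvtop n x)]
    simp only [hv, coordNorm]
    rw [← ENNReal.rpow_mul, one_div_mul_cancel hP.ne', ENNReal.rpow_one]
    simp_rw [ENNReal.coe_rpow_of_nonneg _ hP.le]
  have hVind : ∀ n, IndepOf i (V n) := fun n x y => by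
    simp only [hV, hv]
    rw [indepOf_coordNorm_self x y]
  have hUm : ∀ n x, Measurable fun y => (U n (Function.update x i y) : ℝ≥0∞) := fun n x =>
    ((measurable_of_adapted hUad n).comp (measurable_update x)).coe_nnreal_ennreal
  -- The product `U V^{-(1-ε)}` need not increase in `n`; its increasing substitute is `∑ (U_k -
  -- U_{k-1}) V_k^{-(1-ε)}`, which dominates it. Since `V` is the integral of `U` in the `i`-th
  -- variable and does not depend on that variable, integrating gives `∑ (V_k - V_{k-1})
  -- V_k^{-(1-ε)} ≤ ε⁻¹ V_n^ε`. A positive `ε` is what makes this last sum comparable with a power.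
  refine ⟨fun n x => ctrlTransform (fun k => U k x) (fun k => V k x ^ (-(1 - ε))) n,
    adapted_ctrlTransform hUad hWad, fun a b hab x => ctrlTransform_mono hab,
    ⟨η ^ P * (K ^ P) ^ (-(1 - ε)), ?_, fun n x => ?_⟩,
    ⟨K ^ P * (η ^ P) ^ (-(1 - ε)), fun n x => ?_⟩, fun j hj n => ?_, fun n x => ?_, fun n x => ?_⟩
  · have hK0 : 0 < K := by
      have x : ∀ i, Ω i := fun i => (nonempty_of_isProbabilityMeasure (μ i)).some
      exact hη0.trans_le ((hη 0 x).trans (hK 0 x))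
    exact mul_pos hηP (NNReal.rpow_pos (NNReal.rpow_pos hK0))
  · refine le_trans ?_ (mul_le_ctrlTransform (fun a b hab => hUmono hab x) (hWanti x))
    refine mul_le_mul' (NNReal.rpow_le_rpow (hη n x) hP.le) ?_
    exact NNReal.rpow_le_rpow_of_nonpos (hV0 n x) (hVK n x) (by linarith)
  · refine (ctrlTransform_le_mul (B := (η ^ P) ^ (-(1 - ε)))
      (fun a b hab => hUmono hab x) fun k _ => ?_).trans ?_
    · exact NNReal.rpow_le_rpow_of_nonpos hηP (hVη k x) (by linarith)
    · gcongr
      exact NNReal.rpow_le_rpow (hK n x) hP.le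
  · refine IndepOf.ctrlTransform (l := U) (w := fun n x => V n x ^ (-(1 - ε))) ?_ ?_ n
    · intro k x y
      simp only [hU, hj k x y]
    · intro k x y
      simp only [hV, hv]
      rw [IndepOf.coordNorm (j := j) (fun x y => by rw [hj k x y]) x y]
  · exact mul_le_ctrlTransform (fun a b hab => hUmono hab x) (hWanti x)
  · have hct : ∀ n, ∫⁻ y, (ctrlTransform (fun k => U k (Function.update x i y))
        (fun k => V k (Function.update x i y) ^ (-(1 - ε))) n : ℝ≥0∞) ∂μ i =
        ctrlTransform (fun k => V k x) (fun k => V k x ^ (-(1 - ε))) n := by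
      intro n
      simp only [hVind _ x _]
      induction n with
      | zero =>
        simp only [ctrlTransform, ENNReal.coe_mul]
        rw [lintegral_mul_const _ (hUm 0 x), hint]
      | succ n ih =>
        simp only [ctrlTransform, ENNReal.coe_add, ENNReal.coe_mul, ENNReal.coe_sub]
        have hsub : Measurable fun y => (U (n + 1) (Function.update x i y) : ℝ≥0∞) -
            U n (Function.update x i y) := (hUm _ x).sub (hUm n x)
        rw [lintegral_add_right _ (hsub.mul_const _), ih, lintegral_mul_const _ hsub,
          lintegral_sub (hUm n x), hint, hint]
        · rw [hint]; exact ENNReal.coe_ne_top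
        · exact Filter.Eventually.of_forall fun y =>
            ENNReal.coe_le_coe.2 (hUmono n.le_succ _)
    rw [hct n]
    have := ctrlTransform_rpow_le (n := n) (fun a b hab => hVmono hab x) (fun n => hV0 n x) hε0 hε1
    refine (ENNReal.coe_le_coe.2 this).trans (le_of_eq ?_)
    simp only [hV]
    rw [ENNReal.coe_mul, ← NNReal.rpow_mul, ENNReal.coe_rpow_of_nonneg _ (by positivity),
      ENNReal.coe_toNNReal (hvtop n x)]

end Extrapolation

section Extrapolation

variable {d : ℕ} {Ω : Fin d → Type*} [mΩ : ∀ i, MeasurableSpace (Ω i)]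
  {μ : ∀ i, Measure (Ω i)} {ℱ : ∀ i, Filtration ℕ (mΩ i)}

lemma iterNorm_finRange_mono_ae [∀ i, SigmaFinite (μ i)] {p : Fin d → ℝ} (hp : ∀ i, 0 < p i)
    {f g : (∀ i, Ω i) → ℝ≥0∞} (h : ∀ᵐ x ∂Measure.pi μ, f x ≤ g x) (x : ∀ i, Ω i) :
    iterNorm μ p (List.finRange d) f x ≤ iterNorm μ p (List.finRange d) g x := by
  have h1 : ∀ f : (∀ i, Ω i) → ℝ≥0∞, mixedNorm μ (fun i => ENNReal.ofReal (p i)) f =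
      iterNorm μ p (List.finRange d) f x := fun f => by
    rw [mixedNorm_eq_iterNorm μ (fun i => ENNReal.ofReal_pos.2 (hp i))
      (fun i => ENNReal.ofReal_lt_top) f x]
    simp only [ENNReal.toReal_ofReal (hp _).le]
  rw [← h1, ← h1]
  exact mixedNorm_mono_ae μ _ h

/-- For a decreasing weight independent of the variables of `l₁`, the norm in these variables of the
transformed control is dominated by the transform of the norms. -/
lemma iterNorm_ctrlTransform_le [∀ i, SFinite (μ i)] {l₁ : List (Fin d)} {p : Fin d → ℝ}
    (hp : ∀ i ∈ l₁, 1 ≤ p i) {l w u : ℕ → (∀ i, Ω i) → ℝ≥0} (hlm : ∀ n, Measurable (l n))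
    (hwm : ∀ n, Measurable (w n)) (hl : Monotone l) (hu : Monotone u) (hw : Antitone w)
    (hlu : ∀ n x, iterNorm μ p l₁ (fun z => (l n z : ℝ≥0∞)) x = u n x)
    (hwi : ∀ n, ∀ j ∈ l₁, IndepOf j (w n)) (n : ℕ) (x : ∀ i, Ω i) :
    iterNorm μ p l₁
      (fun x => (ctrlTransform (fun k => l k x) (fun k => w k x) n : ℝ≥0∞)) x ≤
      ctrlTransform (fun k => u k x) (fun k => w k x) n := by
  have hp0 : ∀ i ∈ l₁, 0 < p i := fun i hi => by linarith [hp i hi]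
  -- After summation by parts on both sides, Minkowski's inequality (exponents at least `1`) applies
  -- term by term, and the coefficients `w k - w (k + 1)` leave the norm because they do not depend
  -- on the variables of `l₁`.
  simp_rw [ctrlTransform_eq_sum (fun a b hab => hl hab _) (fun a b hab => hw hab _)]
  rw [ctrlTransform_eq_sum (fun a b hab => hu hab _) (fun a b hab => hw hab _)]
  push_cast
  have hlm' : ∀ k, Measurable fun x => (l k x : ℝ≥0∞) := fun k => (hlm k).coe_nnreal_ennreal
  have hwm' : ∀ k, Measurable fun x => (w k x : ℝ≥0∞) := fun k => (hwm k).coe_nnreal_ennreal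
  have hdm : ∀ k, Measurable fun x => (w k x : ℝ≥0∞) - w (k + 1) x := fun k =>
    (hwm' k).sub (hwm' _)
  refine (iterNorm_add_le hp ((hlm' n).mul (hwm' n))
    (Finset.measurable_sum _ fun k _ => (hlm' k).mul (hdm k)) x).trans ?_
  refine add_le_add ?_ ((iterNorm_sum_le _ hp (fun k => (hlm' k).mul (hdm k)) x).trans
    (Finset.sum_le_sum fun k _ => ?_))
  · have e : ((fun x => (l n x : ℝ≥0∞)) * fun x => (w n x : ℝ≥0∞)) = fun x => (w n x : ℝ≥0∞) * l n x :=
      mul_comm _ _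
    rw [e, iterNorm_mul_left hp0 (fun j hj x y => by rw [hwi n j hj x y]) (hlm' n)]
    dsimp only
    rw [hlu, mul_comm]
  · have e : ((fun x => (l k x : ℝ≥0∞)) * fun x => (w k x : ℝ≥0∞) - w (k + 1) x) =
        fun x => ((w k x : ℝ≥0∞) - w (k + 1) x) * l k x := mul_comm _ _
    rw [e, iterNorm_mul_left (h := fun x => (w k x : ℝ≥0∞) - w (k + 1) x) hp0
      (fun j hj x y => by simp only [hwi _ j hj x y]) (hlm' k)]
    dsimp only
    rw [hlu, mul_comm]

/-- The variables of `l₁` already carry the exponent `Q`. The estimate with `p i` replaced by `Q`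
and the outer exponents enlarged to `p j / (1 - δ)` is applied to a transformed pair `(T', Λ)`; two
uses of Hölder, one in variable `i` and one in the outer variables, bring it back to `(T, l)`. The
constant does not involve the bounds `η` and `K`, which only keep the weights finite and positive.
-/
lemma extrapolation_step [∀ i, IsProbabilityMeasure (μ i)] {Q δ : ℝ} {A C : ℝ≥0}
    {p p' : Fin d → ℝ} {l₁ l₂ : List (Fin d)} {i : Fin d} (hl : l₁ ++ i :: l₂ = List.finRange d)
    (hQ : 1 ≤ Q) (h1 : ∀ j ∈ l₁, p j = Q) (hp : ∀ j, 0 < p j) (hiQ : p i < Q)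
    (hδ0 : 0 < δ) (hδ1 : δ < 1) (hδ : δ ≤ 1 - p i / Q) (hp'1 : ∀ j ∈ l₁, p' j = Q) (hp'i : p' i = Q)
    (hp'2 : ∀ j ∈ l₂, p' j = p j / (1 - δ))
    {R : ((∀ i, Ω i) → ℝ≥0∞) → (ℕ → (∀ i, Ω i) → ℝ≥0) → Prop} (hR : TransformClosed μ ℱ Q A R)
    (ih : ∀ T l, R T l → ∀ η K : ℝ≥0, 0 < η → (∀ n x, η ≤ l n x) → (∀ n x, l n x ≤ K) → ∀ x,
      iterNorm μ p' (List.finRange d) T x ≤ C * iterNorm μ p' (List.finRange d) (controlLim l) x)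
    {T : (∀ i, Ω i) → ℝ≥0∞} {l : ℕ → (∀ i, Ω i) → ℝ≥0} (hT : R T l) {η K : ℝ≥0} (hη0 : 0 < η)
    (hη : ∀ n x, η ≤ l n x) (hK : ∀ n x, l n x ≤ K) (x : ∀ i, Ω i) :
    iterNorm μ p (List.finRange d) T x ≤
      (2 * ((δ / (1 - p i / Q)).toNNReal⁻¹ ^ (1 / p i - 1 / Q) *
        (C * (p i / Q).toNNReal⁻¹)) : ℝ≥0) *
        iterNorm μ p (List.finRange d) (controlLim l) x := by
  have hQ0 : 0 < Q := by linarith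
  set P := p i with hPdef
  have hP : 0 < P := hp i
  set θ := P / Q with hθdef
  have hθ0 : 0 < θ := by positivity
  have hθ1 : θ < 1 := by rw [hθdef, div_lt_one hQ0]; exact hiQ
  -- Chosen so that `P ε b = δ`: the norm of `Φ^b` in variable `i` then costs exactly `v^δ`. The
  -- condition `ε ≤ 1` is the assumption `δ ≤ 1 - p i / Q`.
  set ε := δ / (1 - θ) with hεdef
  have h1θ : 0 < 1 - θ := by linarith
  have hε0 : 0 < ε := by positivity
  have hε1 : ε ≤ 1 := by rw [hεdef, div_le_one h1θ]; exact hδ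
  set b := 1 / P - 1 / Q with hbdef
  have hbP : P * b = 1 - θ := by rw [hbdef, hθdef]; field_simp
  have hb0 : 0 < b := by
    by_contra hcon
    nlinarith [not_lt.1 hcon]
  have hPεb : P * ε * b = δ := by
    rw [mul_right_comm, hbP, hεdef]; field_simp
  have hp1 : ∀ j ∈ l₁, 0 < p j := fun j _ => hp j
  have hp1' : ∀ j ∈ l₁, 1 ≤ p j := fun j hj => by rw [h1 j hj]; exact hQ
  have hp2 : ∀ j ∈ l₂, 0 < p j := fun j _ => hp j
  have h1δ : 0 < 1 - δ := by linarith
  have hp2' : ∀ j ∈ l₂, 0 < p j / (1 - δ) := fun j hj => div_pos (hp j) h1δ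
  have hsplit : ∀ g, iterNorm μ p (List.finRange d) g =
      iterNorm μ p l₂ (coordNorm μ i P (iterNorm μ p l₁ g)) := fun g => by
    rw [← hl, iterNorm_append]; rfl
  have hsplit' : ∀ g, iterNorm μ p' (List.finRange d) g =
      iterNorm μ (fun j => p j / (1 - δ)) l₂ (coordNorm μ i Q (iterNorm μ p l₁ g)) := fun g => by
    rw [← hl, iterNorm_append, iterNorm, hp'i, iterNorm_congr (q := fun j => p j / (1 - δ)) hp'2,
      iterNorm_congr (p := p') (q := p) (l := l₁) fun j hj => by rw [hp'1 j hj, h1 j hj]]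
  obtain ⟨hlad, hlmono⟩ := hR.control hT
  have hlm : ∀ n, Measurable (l n) := measurable_of_adapted hlad
  -- the norms of the control in the first variables
  set u : ℕ → (∀ i, Ω i) → ℝ≥0 :=
    fun n x => (iterNorm μ p l₁ (fun z => (l n z : ℝ≥0∞)) x).toNNReal with hu
  have hIK : ∀ n x, iterNorm μ p l₁ (fun z => (l n z : ℝ≥0∞)) x ≤ K := fun n x => by
    have := iterNorm_mono (μ := μ) (f := fun z => (l n z : ℝ≥0∞)) (g := fun _ => (K : ℝ≥0∞)) hp1
      (fun z => by exact_mod_cast hK n z) x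
    rwa [iterNorm_const hp1] at this
  have hIη : ∀ n x, (η : ℝ≥0∞) ≤ iterNorm μ p l₁ (fun z => (l n z : ℝ≥0∞)) x := fun n x => by
    have := iterNorm_mono (μ := μ) (g := fun z => (l n z : ℝ≥0∞)) (f := fun _ => (η : ℝ≥0∞)) hp1
      (fun z => by exact_mod_cast hη n z) x
    rwa [iterNorm_const hp1] at this
  have hlu : ∀ n x, iterNorm μ p l₁ (fun z => (l n z : ℝ≥0∞)) x = u n x := fun n x =>
    (ENNReal.coe_toNNReal ((hIK n x).trans_lt ENNReal.coe_lt_top).ne).symm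
  have huK : ∀ n x, u n x ≤ K := fun n x => by
    have := hIK n x; rw [hlu] at this; exact_mod_cast this
  have huη : ∀ n x, η ≤ u n x := fun n x => by
    have := hIη n x; rw [hlu] at this; exact_mod_cast this
  have humono : Monotone u := fun a c hac x => by
    have := iterNorm_mono (μ := μ) (f := fun z => (l a z : ℝ≥0∞)) (g := fun z => (l c z : ℝ≥0∞))
      hp1 (fun z => by exact_mod_cast hlmono hac z) x
    rw [hlu, hlu] at this; exact_mod_cast this
  have huad : Adapted (prodFiltration ℱ) u := fun n => by
    have : Measurable[prodFiltration ℱ n] (iterNorm μ p l₁ (fun z => (l n z : ℝ≥0∞))) :=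
      measurable_iterNorm_prodFiltration (hlad n).coe_nnreal_ennreal
    exact this.ennreal_toNNReal
  have huind : ∀ n, ∀ j ∈ l₁, IndepOf j (u n) := fun n j hj x y => by
    simp only [hu]
    rw [indepOf_iterNorm_of_mem hj x y]
  obtain ⟨φ, hφad, hφmono, ⟨c, hc0, hc⟩, ⟨B, hB⟩, hφind, hφlow, hφint⟩ :=
    exists_comparison_weight (μ := μ) i hP hε0 hε1 huad humono hη0 huη huK
  replace hφind : ∀ j ∈ l₁, ∀ n, IndepOf j (φ n) := fun j hj => hφind j fun n => huind n j hj
  have hφ0 : ∀ n x, 0 < φ n x := fun n x => hc0.trans_le (hc n x)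
  set v : ℕ → (∀ i, Ω i) → ℝ≥0∞ := fun n => coordNorm μ i P (fun z => (u n z : ℝ≥0∞)) with hv
  have hvK : ∀ n x, v n x ≤ K := fun n => coordNorm_le_coe hP (by exact_mod_cast huK n)
  have hvη : ∀ n x, (η : ℝ≥0∞) ≤ v n x := fun n => coe_le_coordNorm hP (by exact_mod_cast huη n)
  have hvtop : ∀ n x, v n x ≠ ∞ := fun n x => ((hvK n x).trans_lt ENNReal.coe_lt_top).ne
  have hvpos : ∀ n x, 0 < (v n x).toNNReal := fun n x =>
    hη0.trans_le (by simpa using ENNReal.toNNReal_mono (hvtop n x) (hvη n x))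
  -- The ideal weight would be `u^{-(1-θ)} v^{1-θ-δ}`, which is the `-b`-th power of `u^P
  -- v^{-P(1-ε)}` but need not be monotone. The increasing majorant `φ` of the latter makes `w`
  -- decreasing and still bounded by the ideal weight.
  set w : ℕ → (∀ i, Ω i) → ℝ≥0 := fun n x => φ n x ^ (-b) with hw
  have hwad : Adapted (prodFiltration ℱ) w := fun n => (hφad n).pow_const _
  have hwanti : Antitone w := fun a e hae x =>
    NNReal.rpow_le_rpow_of_nonpos (hφ0 a x) (hφmono hae x) (by linarith)
  have hwB : ∀ n x, w n x ≤ c ^ (-b) := fun n x =>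
    NNReal.rpow_le_rpow_of_nonpos hc0 (hc n x) (by linarith)
  have hwlow : ∀ n x, B ^ (-b) ≤ w n x := fun n x =>
    NNReal.rpow_le_rpow_of_nonpos (hφ0 n x) (hB n x) (by linarith)
  obtain ⟨T', hT', hTT'⟩ := hR.transform hT hwad hwanti ⟨_, hwB⟩
  set Λ : ℕ → (∀ i, Ω i) → ℝ≥0 :=
    fun n x => ctrlTransform (fun k => l k x) (fun k => w k x) n with hΛ
  have hB0 : 0 < B := hc0.trans_le ((hc 0 x).trans (hB 0 x))
  have hIH := ih T' Λ hT' (η * B ^ (-b)) (K * c ^ (-b)) (mul_pos hη0 (NNReal.rpow_pos hB0))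
    (fun n x => (mul_le_mul' (hη n x) (hwlow n x)).trans
      (mul_le_ctrlTransform (fun a e hae => hlmono hae x) (fun a e hae => hwanti hae x)))
    (fun n x => (ctrlTransform_le_mul (fun a e hae => hlmono hae x) fun k _ => hwB k x).trans
      (mul_le_mul' (hK n x) le_rfl)) x
  have hTm := hR.measurable hT
  have hT'm := hR.measurable hT'
  set G : (∀ i, Ω i) → ℝ≥0∞ := controlLim l with hG
  have hGm : Measurable G := Measurable.iSup fun n => (hlm n).coe_nnreal_ennreal
  set uu : (∀ i, Ω i) → ℝ≥0∞ := iterNorm μ p l₁ G with huu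
  have huum : Measurable uu := measurable_iterNorm hGm
  set vv : (∀ i, Ω i) → ℝ≥0∞ := coordNorm μ i P uu with hvv
  have hvvm : Measurable vv := measurable_coordNorm huum
  have hu_le : ∀ n x, (u n x : ℝ≥0∞) ≤ uu x := fun n x => by
    rw [← hlu]
    exact iterNorm_mono hp1 (fun z => le_iSup (fun n => (l n z : ℝ≥0∞)) n) x
  have hv_le : ∀ n x, v n x ≤ vv x := fun n => coordNorm_mono hP (hu_le n)
  -- the supremum of the weights
  set Φ : (∀ i, Ω i) → ℝ≥0∞ := fun x => ⨆ n, (φ n x : ℝ≥0∞) with hΦ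
  have hφm : ∀ n, Measurable fun x => (φ n x : ℝ≥0∞) := fun n =>
    (measurable_of_adapted hφad n).coe_nnreal_ennreal
  have hφm' : Monotone fun n x => (φ n x : ℝ≥0∞) := fun a e hae x =>
    ENNReal.coe_le_coe.2 (hφmono hae x)
  have hΦm : Measurable Φ := Measurable.iSup hφm
  have hΦB : ∀ x, Φ x ≤ B := fun x => iSup_le fun n => by exact_mod_cast hB n x
  have hΦtop : ∀ x, Φ x ≠ ∞ := fun x => ((hΦB x).trans_lt ENNReal.coe_lt_top).ne
  have hΦind : ∀ j ∈ l₁, IndepOf j (fun x => 2 * Φ x ^ b) := fun j hj x y => by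
    simp only [hΦ, hφind j hj _ x y]
  have hΦnorm : ∀ x, coordNorm μ i (1 / b) (fun z => Φ z ^ b) x ≤
      (ε.toNNReal⁻¹ ^ b : ℝ≥0) * vv x ^ δ := fun x => by
    rw [coordNorm_rpow one_pos hb0]
    simp only [hΦ]
    rw [coordNorm_iSup one_pos hφm hφm']
    have h2 : ⨆ n, coordNorm μ i 1 (fun z => (φ n z : ℝ≥0∞)) x ≤
        (ε.toNNReal⁻¹ : ℝ≥0) * vv x ^ (P * ε) := by
      refine iSup_le fun n => ?_
      simp only [coordNorm, ENNReal.rpow_one, div_one]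
      refine (hφint n x).trans ?_
      gcongr
      exact hv_le n x
    calc _ ≤ ((ε.toNNReal⁻¹ : ℝ≥0) * vv x ^ (P * ε)) ^ b := by gcongr
      _ = _ := by
        rw [ENNReal.mul_rpow_of_nonneg _ _ hb0.le, ← ENNReal.rpow_mul, hPεb,
          ENNReal.coe_rpow_of_nonneg _ hb0.le]
  -- The constant `W` is chosen separately at each point, as `Φ x ^ b`; this is why `transform` has
  -- its quantifier over `W` inside the almost sure statement.
  have hTae : ∀ᵐ x ∂Measure.pi μ, T x ≤ (2 * Φ x ^ b) * T' x := by
    filter_upwards [hTT'] with x hx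
    have h3 : Φ x ^ b ≠ ∞ := ENNReal.rpow_ne_top_of_nonneg hb0.le (hΦtop x)
    have h4 := hx (Φ x ^ b).toNNReal fun n => ?_
    · rwa [ENNReal.coe_toNNReal h3] at h4
    · have h5 : φ n x ^ b ≤ (Φ x ^ b).toNNReal := by
        rw [← ENNReal.coe_le_coe, ENNReal.coe_toNNReal h3, ENNReal.coe_rpow_of_nonneg _ hb0.le]
        gcongr
        exact le_iSup (fun n => (φ n x : ℝ≥0∞)) n
      calc 1 = φ n x ^ b * φ n x ^ (-b) := by
            rw [← NNReal.rpow_add (hφ0 n x).ne', add_neg_cancel, NNReal.rpow_zero]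
        _ ≤ _ := by gcongr
  -- the norm of the transformed control in the first variables
  have hΛm : ∀ n, Measurable fun x => (Λ n x : ℝ≥0∞) := fun n =>
    (measurable_of_adapted (hR.control hT').1 n).coe_nnreal_ennreal
  have hΛbound : ∀ n x, iterNorm μ p l₁ (fun z => (Λ n z : ℝ≥0∞)) x ≤
      (θ.toNNReal⁻¹ * vv x ^ (1 - θ - δ)) * uu x ^ θ := fun n x => by
    refine (iterNorm_ctrlTransform_le hp1' hlm (measurable_of_adapted hwad) hlmono humono hwanti hlu
      (fun n j hj x y => by simp only [hw, hφind j hj n x y]) n x).trans ?_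
    -- The factor in `v` has a nonnegative exponent, so it can be frozen at the last index and taken
    -- out of the sum. What remains is `∑ (u_k - u_{k-1}) u_k^{-(1-θ)} ≤ θ⁻¹ u_n^θ`.
    have h6 : ∀ k ≤ n, w k x ≤ u k x ^ (-(1 - θ)) * (v n x).toNNReal ^ (1 - θ - δ) := by
      intro k hk
      have h7 := NNReal.rpow_le_rpow_of_nonpos (z := -b)
        (mul_pos (NNReal.rpow_pos (hη0.trans_le (huη k x)))
          (NNReal.rpow_pos (NNReal.rpow_pos (hvpos k x)))) (hφlow k x) (by linarith)
      refine h7.trans ?_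
      rw [NNReal.mul_rpow, ← NNReal.rpow_mul, ← NNReal.rpow_mul, ← NNReal.rpow_mul]
      have e1 : P * -b = -(1 - θ) := by linarith
      have e2 : P * (-(1 - ε) * -b) = 1 - θ - δ := by
        rw [← hPεb, ← hbP]; ring
      rw [e1, e2]
      have h12 : (v k x).toNNReal ≤ (v n x).toNNReal := ENNReal.toNNReal_mono (hvtop n x)
        (coordNorm_mono hP (fun z => ENNReal.coe_le_coe.2 (humono hk z)) x)
      exact mul_le_mul_right (NNReal.rpow_le_rpow h12 (by linarith)) _
    refine (ENNReal.coe_le_coe.2 (ctrlTransform_le_ctrlTransform h6)).trans ?_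
    rw [ctrlTransform_mul_const]
    have h8 := ctrlTransform_rpow_le (n := n) (fun a e hae => humono hae x)
      (fun n => hη0.trans_le (huη n x)) hθ0 hθ1.le
    refine (ENNReal.coe_le_coe.2 (mul_le_mul_left h8 _)).trans ?_
    push_cast
    rw [ENNReal.coe_rpow_of_nonneg _ hθ0.le, ENNReal.coe_rpow_of_nonneg _ (by linarith),
      ENNReal.coe_toNNReal (hvtop n x), mul_right_comm]
    have h9 : v n x ^ (1 - θ - δ) ≤ vv x ^ (1 - θ - δ) :=
      ENNReal.rpow_le_rpow (hv_le n x) (by linarith)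
    gcongr
    exact hu_le n x
  -- Here `vv` is independent of variable `i` and leaves the norm, and the `Q`-norm of `uu^θ` is
  -- `vv^θ` because `Q θ = P`; the exponents add up to `1 - δ`.
  have hΛnorm : ∀ x, coordNorm μ i Q (iterNorm μ p l₁ (controlLim Λ)) x ≤
      θ.toNNReal⁻¹ * vv x ^ (1 - δ) := fun x => by
    have h9 : iterNorm μ p l₁ (controlLim Λ) = fun x => ⨆ n, iterNorm μ p l₁
        (fun z => (Λ n z : ℝ≥0∞)) x :=
      iterNorm_iSup (F := fun n x => (Λ n x : ℝ≥0∞)) hp1 hΛm fun a e hae x =>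
        ENNReal.coe_le_coe.2 ((hR.control hT').2 hae x)
    rw [h9]
    refine (coordNorm_mono hQ0 (fun x => iSup_le fun n => hΛbound n x) x).trans ?_
    rw [coordNorm_mul_left (h := fun x => θ.toNNReal⁻¹ * vv x ^ (1 - θ - δ)) hQ0 ?_
      (huum.pow_const _)]
    · have h10 : Q = P / θ := by rw [hθdef]; field_simp
      have h11 : coordNorm μ i Q (fun x => uu x ^ θ) = fun x => vv x ^ θ := by
        rw [h10, coordNorm_rpow hP hθ0]
      rw [h11]
      dsimp only
      rw [mul_assoc, ← ENNReal.rpow_add_of_nonneg _ _ (by linarith) hθ0.le]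
      ring_nf
      exact le_rfl
    · intro x y
      simp only [hvv, indepOf_coordNorm_self x y]
  -- conclusion
  have hYm : Measurable (iterNorm μ p l₁ T') := measurable_iterNorm hT'm
  set Y : (∀ i, Ω i) → ℝ≥0∞ := coordNorm μ i Q (iterNorm μ p l₁ T') with hY
  have hstep : ∀ x, coordNorm μ i P (iterNorm μ p l₁ fun x => (2 * Φ x ^ b) * T' x) x ≤
      (2 * (ε.toNNReal⁻¹ ^ b : ℝ≥0) : ℝ≥0∞) * (vv x ^ δ * Y x) := fun x => by
    rw [iterNorm_mul_left hp1 hΦind hT'm]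
    simp_rw [mul_assoc (2 : ℝ≥0∞)]
    rw [coordNorm_mul_left (h := fun _ => 2) (g := fun x => Φ x ^ b * iterNorm μ p l₁ T' x) hP
      (fun _ _ => rfl) ((hΦm.pow_const _).mul hYm)]
    -- Hölder in variable `i` with exponents `1/b` for `Φ^b` and `Q` for the norm of `T'`, since
    -- `1/P = b + 1/Q`.
    have hbs : P < 1 / b := by
      rw [lt_div_iff₀ hb0, hbP]; linarith
    have hbe : 1 / P = 1 / (1 / b) + 1 / Q := by rw [one_div_one_div, hbdef]; ring
    have := coordNorm_mul_le (μ := μ) (i := i) hP hbs hbe (hΦm.pow_const b) hYm x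
    refine (mul_le_mul_right this 2).trans (mul_le_mul_right ?_ 2)
    rw [← mul_assoc]
    exact mul_le_mul_left (hΦnorm x) _
  calc iterNorm μ p (List.finRange d) T x
      ≤ iterNorm μ p (List.finRange d) (fun x => (2 * Φ x ^ b) * T' x) x :=
        iterNorm_finRange_mono_ae hp hTae x
    _ ≤ iterNorm μ p l₂ (fun x => (2 * (ε.toNNReal⁻¹ ^ b : ℝ≥0) : ℝ≥0∞) * (vv x ^ δ * Y x)) x := by
        rw [hsplit]
        exact iterNorm_mono hp2 hstep x
    _ = (2 * (ε.toNNReal⁻¹ ^ b : ℝ≥0) : ℝ≥0∞) * iterNorm μ p l₂ (fun x => vv x ^ δ * Y x) x :=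
        iterNorm_const_mul hp2 _ ((hvvm.pow_const _).mul (measurable_coordNorm hYm)) x
    _ ≤ (2 * (ε.toNNReal⁻¹ ^ b : ℝ≥0) : ℝ≥0∞) * (iterNorm μ p l₂ vv x ^ δ *
          iterNorm μ (fun j => p j / (1 - δ)) l₂ Y x) := by
        gcongr
        exact iterNorm_mul_le hδ0 hδ1 hp2 hvvm (measurable_coordNorm hYm) x
    -- The inductive estimate bounds the norm of `Y` by that of `vv^{1-δ}` with exponents `p j / (1
    -- - δ)`, that is, by the `(1-δ)`-th power of the `p`-norm of `vv`. The powers `δ` and `1 - δ`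
    -- recombine to the full norm.
    _ ≤ (2 * (ε.toNNReal⁻¹ ^ b : ℝ≥0) : ℝ≥0∞) * (iterNorm μ p l₂ vv x ^ δ *
          (C * (θ.toNNReal⁻¹ * iterNorm μ p l₂ vv x ^ (1 - δ)))) := by
        gcongr
        rw [hsplit', hsplit'] at hIH
        refine hIH.trans ?_
        gcongr
        refine (iterNorm_mono hp2' hΛnorm x).trans ?_
        rw [iterNorm_const_mul hp2' _ (hvvm.pow_const _), iterNorm_rpow hp2 h1δ]
    _ = _ := by
        have h12 : iterNorm μ p l₂ vv x ^ δ * iterNorm μ p l₂ vv x ^ (1 - δ) =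
            iterNorm μ p l₂ vv x := by
          rw [← ENNReal.rpow_add_of_nonneg _ _ hδ0.le h1δ.le]
          simp
        rw [hsplit]
        push_cast
        calc _ = 2 * (((ε.toNNReal⁻¹ ^ b : ℝ≥0) : ℝ≥0∞) * (C * ((θ.toNNReal⁻¹ : ℝ≥0) : ℝ≥0∞))) *
              (iterNorm μ p l₂ vv x ^ δ * iterNorm μ p l₂ vv x ^ (1 - δ)) := by ring
          _ = _ := by rw [h12]

end Extrapolation

section Extrapolation

lemma exists_exponent_gap {d : ℕ} {p : Fin d → ℝ} {Q : ℝ} (hQ : 0 < Q) (l : List (Fin d))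
    (h : ∀ j ∈ l, p j < Q) : ∃ δ : ℝ, 0 < δ ∧ δ < 1 ∧ ∀ j ∈ l, p j < Q * (1 - δ) := by
  induction l with
  | nil => exact ⟨1 / 2, by norm_num, by norm_num, by simp⟩
  | cons i l ih =>
    obtain ⟨δ, hδ0, hδ1, hδ⟩ := ih fun j hj => h j (by simp [hj])
    have hi := h i (by simp)
    have hg : 0 < (1 - p i / Q) / 2 := by
      have : p i / Q < 1 := by rwa [div_lt_one hQ]
      linarith
    have hgQ : p i < Q * (1 - (1 - p i / Q) / 2) := by
      field_simp
      linarith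
    refine ⟨min δ ((1 - p i / Q) / 2), lt_min hδ0 hg, (min_le_left _ _).trans_lt hδ1, ?_⟩
    intro j hj
    rcases List.mem_cons.1 hj with rfl | hj
    · refine hgQ.trans_le (mul_le_mul_of_nonneg_left ?_ hQ.le)
      linarith [min_le_right δ ((1 - p j / Q) / 2)]
    · refine (hδ j hj).trans_le (mul_le_mul_of_nonneg_left ?_ hQ.le)
      linarith [min_le_left δ ((1 - p i / Q) / 2)]

/-- Induction on the variables whose exponent is not yet `Q`. The exponents and the treated list
`l₁` are quantified inside, because each step moves one variable to `l₁` and enlarges the remaining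
exponents. When `l₂` is empty all exponents equal `Q` and the `base` estimate applies. -/
lemma extrapolation_of_bounded {d : ℕ} {Q : ℝ} (hQ : 1 ≤ Q) (A : ℝ≥0) (l₂ : List (Fin d)) :
    ∀ (l₁ : List (Fin d)) (_ : l₁ ++ l₂ = List.finRange d) (p : Fin d → ℝ)
      (_ : ∀ j ∈ l₁, p j = Q) (_ : ∀ j, 0 < p j) (_ : ∀ j ∈ l₂, p j < Q),
    ∃ C : ℝ≥0, ∀ (Ω : Fin d → Type*) [mΩ : ∀ i, MeasurableSpace (Ω i)] (μ : ∀ i, Measure (Ω i))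
      [∀ i, IsProbabilityMeasure (μ i)] (ℱ : ∀ i, Filtration ℕ (mΩ i))
      (R : ((∀ i, Ω i) → ℝ≥0∞) → (ℕ → (∀ i, Ω i) → ℝ≥0) → Prop) (_ : TransformClosed μ ℱ Q A R)
      (T : (∀ i, Ω i) → ℝ≥0∞) (l : ℕ → (∀ i, Ω i) → ℝ≥0), R T l →
      ∀ η K : ℝ≥0, 0 < η → (∀ n x, η ≤ l n x) → (∀ n x, l n x ≤ K) → ∀ x,
      iterNorm μ p (List.finRange d) T x ≤
        C * iterNorm μ p (List.finRange d) (controlLim l) x := by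
  have hQ0 : 0 < Q := by linarith
  induction l₂ with
  | nil =>
    intro l₁ hl p h1 _ _
    refine ⟨A ^ (1 / Q), fun Ω mΩ μ _ ℱ R hR T l hT η K hη0 hη hK x => ?_⟩
    rw [List.append_nil] at hl
    have hpQ : ∀ j ∈ List.finRange d, p j = (fun _ => Q) j := fun j hj => h1 j (hl ▸ hj)
    rw [iterNorm_congr hpQ, iterNorm_congr hpQ,
      iterNorm_finRange_const_exponent hQ0 (hR.measurable hT),
      iterNorm_finRange_const_exponent hQ0]
    · calc _ ≤ (A * ∫⁻ x, controlLim l x ^ Q ∂Measure.pi μ) ^ (1 / Q) := by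
            gcongr
            exact hR.base hT η K hη0 hη hK
        _ = _ := by
            rw [ENNReal.mul_rpow_of_nonneg _ _ (by positivity),
              ENNReal.coe_rpow_of_nonneg _ (by positivity)]
    · exact Measurable.iSup fun n =>
        (measurable_of_adapted (hR.control hT).1 n).coe_nnreal_ennreal
  | cons i l₂ ih =>
    intro l₁ hl p h1 hp h2
    obtain ⟨δ, hδ0, hδ1, hδ⟩ := exists_exponent_gap hQ0 (i :: l₂) h2
    have hnd : (l₁ ++ i :: l₂).Nodup := hl ▸ List.nodup_finRange d
    rw [List.nodup_append] at hnd
    have hil : i ∉ l₂ := (List.nodup_cons.1 hnd.2.1).1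
    have hdisj : ∀ j ∈ l₂, j ∉ l₁ := fun j hj hj1 => hnd.2.2 j hj1 j (by simp [hj]) rfl
    classical
    set p' : Fin d → ℝ := fun j => if j ∈ l₁ ∨ j = i then Q else p j / (1 - δ) with hp'
    have hp'2 : ∀ j ∈ l₂, p' j = p j / (1 - δ) := fun j hj => by
      have : ¬ (j ∈ l₁ ∨ j = i) := by
        rintro (h | rfl)
        · exact hdisj j hj h
        · exact hil hj
      simp [hp', this]
    have h1δ : 0 < 1 - δ := by linarith
    obtain ⟨C, hC⟩ := ih (l₁ ++ [i]) (by simp [hl]) p' (fun j hj => by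
        have : j ∈ l₁ ∨ j = i := by simpa using hj
        simp [hp', this]) (fun j => by
        by_cases h : j ∈ l₁ ∨ j = i
        · simpa [hp', h] using hQ0
        · simp only [hp', h, if_false]; exact div_pos (hp j) h1δ)
      (fun j hj => by
        rw [hp'2 j hj, div_lt_iff₀ h1δ]
        exact hδ j (by simp [hj]))
    refine ⟨_, fun Ω mΩ μ _ ℱ R hR T l hT η K hη0 hη hK x =>
      extrapolation_step hl hQ h1 hp (h2 i (by simp)) hδ0 hδ1 ?_ (fun j hj => by simp [hp', hj])
        (by simp [hp']) hp'2 hR (hC Ω μ ℱ R hR) hT hη0 hη hK x⟩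
    have := hδ i (by simp)
    have h3 : p i / Q < 1 - δ := by rw [div_lt_iff₀ hQ0]; linarith
    linarith

/-- Extrapolation to mixed norms with exponents below `Q` of an `L_Q`-estimate for a family closed
under predictable transforms. -/
theorem mixedNorm_extrapolation {d : ℕ} {p : Fin d → ℝ≥0∞} (hp0 : ∀ i, 0 < p i)
    (hp : ∀ i, p i < ∞) {Q : ℝ} (hQ : 1 ≤ Q) (hpQ : ∀ i, (p i).toReal < Q) (A : ℝ≥0) :
    ∃ C : ℝ≥0, 0 < C ∧ ∀ (Ω : Fin d → Type*) [mΩ : ∀ i, MeasurableSpace (Ω i)]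
      (μ : ∀ i, Measure (Ω i)) [∀ i, IsProbabilityMeasure (μ i)] (ℱ : ∀ i, Filtration ℕ (mΩ i))
      (R : ((∀ i, Ω i) → ℝ≥0∞) → (ℕ → (∀ i, Ω i) → ℝ≥0) → Prop) (_ : TransformClosed μ ℱ Q A R)
      (T : (∀ i, Ω i) → ℝ≥0∞) (l : ℕ → (∀ i, Ω i) → ℝ≥0), R T l →
      mixedNorm μ p T ≤ C * mixedNorm μ p (controlLim l) := by
  have hp' : ∀ i, 0 < (p i).toReal := fun i => ENNReal.toReal_pos (hp0 i).ne' (hp i).ne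
  obtain ⟨C, hC⟩ := extrapolation_of_bounded hQ A (List.finRange d) [] rfl
    (fun i => (p i).toReal) (by simp) hp' (fun j _ => hpQ j)
  obtain ⟨D, -, hD⟩ := iterNorm_add_le_quasi (fun i => (p i).toReal) (List.finRange d)
    fun i _ => hp' i
  refine ⟨2 * C * D + 1, by positivity, fun Ω mΩ μ _ ℱ R hR T l hT => ?_⟩
  obtain ⟨hlad, hlmono⟩ := hR.control hT
  have hlm := measurable_of_adapted hlad
  have hTm := hR.measurable hT
  have hGm : Measurable (controlLim l) := Measurable.iSup fun n => (hlm n).coe_nnreal_ennreal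
  by_cases htop : mixedNorm μ p (controlLim l) = ∞
  · rw [htop, ENNReal.mul_top (by simp)]
    exact le_top
  have hfin := ae_lt_top_of_mixedNorm_ne_top μ hp0 hp hGm htop
  have x : ∀ i, Ω i := fun i => (nonempty_of_isProbabilityMeasure (μ i)).some
  have hle : ∀ i ∈ List.finRange d, 0 < (p i).toReal := fun i _ => hp' i
  -- The bounds on the control are removed here. The weights `1_{l_n ≤ K}` stop the control below
  -- `K` and leave `T` essentially unchanged where `λ_∞ ≤ K`; adding `η` gives the lower bound.
  -- Afterwards `η → 0` and `K → ∞`.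
  have key : ∀ K : ℕ, ∀ η : ℝ≥0, 0 < η →
      mixedNorm μ p ({x | controlLim l x ≤ K}.indicator T) ≤
        (2 * C * D : ℝ≥0) * (mixedNorm μ p (controlLim l) + η) := by
    intro K η hη
    set w : ℕ → (∀ i, Ω i) → ℝ≥0 := fun n x => if l n x ≤ K then 1 else 0 with hw
    have hwad : Adapted (prodFiltration ℱ) w := fun n =>
      Measurable.ite (measurableSet_le (hlad n) measurable_const) measurable_const measurable_const
    have hwanti : Antitone w := fun a b hab x => by
      simp only [hw]
      by_cases h : l b x ≤ K
      · simp [h, (hlmono hab x).trans h]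
      · simp [h]
    obtain ⟨T', hT', hTT'⟩ := hR.transform hT hwad hwanti
      ⟨1, fun n x => by simp only [hw]; split_ifs <;> simp⟩
    set Λ : ℕ → (∀ i, Ω i) → ℝ≥0 :=
      fun n x => ctrlTransform (fun k => l k x) (fun k => w k x) n with hΛ
    have hΛle : ∀ n x, Λ n x ≤ min (l n x) K := fun n x =>
      ctrlTransform_truncate_le (fun a b hab => hlmono hab x) _
    have hΛ' : (fun n x => Λ n x + η) ∈ controls ℱ :=
      ⟨fun n => ((hR.control hT').1 n).add_const η,
        fun a b hab x => add_le_add_left ((hR.control hT').2 hab x) η⟩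
    have h1 := hC Ω μ ℱ R hR T' _ (hR.enlarge hT' hΛ' fun n x => le_self_add) η (K + η) hη
      (fun n x => le_add_self) (fun n x => add_le_add_left ((hΛle n x).trans (min_le_right _ _)) η) x
    have h2 : ∀ᵐ x ∂Measure.pi μ, {x | controlLim l x ≤ K}.indicator T x ≤ 2 * T' x := by
      filter_upwards [hTT'] with x hx
      by_cases h : controlLim l x ≤ K
      · rw [Set.indicator_of_mem (by exact h)]
        have h3 := hx 1 fun n => by
          have : l n x ≤ K := by
            exact_mod_cast (le_iSup (fun n => (l n x : ℝ≥0∞)) n).trans h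
          simp [hw, this]
        simpa using h3
      · rw [Set.indicator_of_notMem (by exact h)]
        exact zero_le
    have h4 : ∀ x, controlLim (fun n x => Λ n x + η) x ≤ controlLim l x + (η : ℝ≥0∞) := fun x => by
      refine iSup_le fun n => ?_
      push_cast
      gcongr
      exact (ENNReal.coe_le_coe.2 ((hΛle n x).trans (min_le_left _ _))).trans
        (le_iSup (fun n => (l n x : ℝ≥0∞)) n)
    refine (mixedNorm_mono_ae μ p h2).trans ?_
    rw [mixedNorm_eq_iterNorm μ hp0 hp _ x, mixedNorm_eq_iterNorm μ hp0 hp _ x,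
      iterNorm_const_mul hle 2 (hR.measurable hT')]
    calc _ ≤ 2 * (C * (D * (iterNorm μ (fun i => (p i).toReal) (List.finRange d) (controlLim l) x
            + η))) := by
          gcongr
          refine h1.trans ?_
          gcongr
          refine (iterNorm_mono hle h4 x).trans ((hD Ω μ _ _ hGm measurable_const x).trans ?_)
          rw [iterNorm_const hle]
      _ = _ := by push_cast; ring
  have key2 : ∀ K : ℕ, mixedNorm μ p ({x | controlLim l x ≤ K}.indicator T) ≤
      (2 * C * D : ℝ≥0) * mixedNorm μ p (controlLim l) := by
    intro K
    refine ENNReal.le_of_forall_pos_le_add fun ε hε _ => ?_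
    refine (key K (ε / (2 * C * D + 1)) (by positivity)).trans ?_
    rw [mul_add]
    gcongr
    norm_cast
    rw [mul_div_assoc']
    refine div_le_of_le_mul₀ (by positivity) (by positivity) ?_
    rw [mul_comm]
    gcongr
    simp
  have h5 : ∀ᵐ x ∂Measure.pi μ, T x ≤ ⨆ K : ℕ, {x | controlLim l x ≤ K}.indicator T x := by
    filter_upwards [hfin] with x hx
    obtain ⟨K, hK⟩ := ENNReal.exists_nat_gt hx.ne
    refine le_iSup_of_le K ?_
    rw [Set.indicator_of_mem (by exact hK.le)]
  refine (mixedNorm_mono_ae μ p h5).trans ?_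
  rw [mixedNorm_eq_iterNorm μ hp0 hp _ x, iterNorm_iSup hle]
  · refine iSup_le fun K => ?_
    rw [← mixedNorm_eq_iterNorm μ hp0 hp]
    refine (key2 K).trans ?_
    gcongr
    simp
  · exact fun K => hTm.indicator (measurableSet_le hGm measurable_const)
  · intro a b hab x
    refine Set.indicator_le_indicator_of_subset (fun y hy => ?_) (fun _ => zero_le) x
    exact le_trans (show controlLim l y ≤ a from hy) (by exact_mod_cast hab)

end Extrapolation

/-! ### Pathwise inequalities for transforms with decreasing weights. -/

section Pathwise

variable {w l : ℕ → ℝ≥0} {n : ℕ}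

/-- Summation by parts writes the sum as a combination of the values of `f` with coefficients `w k -
w (k + 1)` and `w n`, all nonnegative; replacing each value by its bound gives the same summation by
parts for `l`. The induction keeps the boundary term `w n * f (n + 1)` apart. -/
lemma abs_sum_mul_sub_le_ctrlTransform (hl : Monotone l) (hw : Antitone w) {f : ℕ → ℝ}
    (h0 : f 0 = 0) (hf : ∀ n, |f (n + 1)| ≤ l n) (n : ℕ) :
    |∑ k ∈ Finset.range (n + 1), (w k : ℝ) * (f (k + 1) - f k)| ≤ ctrlTransform l w n := by
  have key : |∑ k ∈ Finset.range (n + 1), (w k : ℝ) * (f (k + 1) - f k) - w n * f (n + 1)| ≤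
      ctrlTransform l w n - w n * l n := by
    induction n with
    | zero => simp [ctrlTransform, h0, mul_comm]
    | succ n ih =>
      rw [Finset.sum_range_succ]
      set s := ∑ k ∈ Finset.range (n + 1), (w k : ℝ) * (f (k + 1) - f k)
      have hd : (0 : ℝ) ≤ w n - w (n + 1) := by
        have : (w (n + 1) : ℝ) ≤ w n := by exact_mod_cast hw n.le_succ
        linarith
      have e : s + w (n + 1) * (f (n + 1 + 1) - f (n + 1)) - w (n + 1) * f (n + 1 + 1) =
          (s - w n * f (n + 1)) + (w n - w (n + 1)) * f (n + 1) := by ring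
      rw [e]
      refine (abs_add_le _ _).trans ?_
      rw [abs_mul, abs_of_nonneg hd]
      have h1 := mul_le_mul_of_nonneg_left (hf n) hd
      simp only [ctrlTransform]
      push_cast [NNReal.coe_sub (hl n.le_succ)]
      nlinarith
  have h2 : |(w n : ℝ) * f (n + 1)| ≤ w n * l n := by
    rw [abs_mul, NNReal.abs_eq]
    exact mul_le_mul_of_nonneg_left (hf n) (w n).2
  have := abs_sub_abs_le_abs_sub
    (∑ k ∈ Finset.range (n + 1), (w k : ℝ) * (f (k + 1) - f k)) (w n * f (n + 1))
  linarith

/-- With `A` the transform and `δ` the next increment of `l`, the right side grows by `δ w (2A + δ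
w)` and the left by `δ w² (2 l + δ)`, with `w` taken at the new index. The former is larger since `A
≥ l_n w_n ≥ l_n w_{n+1}`. -/
lemma ctrlTransform_sq_le (hl : Monotone l) (hw : Antitone w) (n : ℕ) :
    ctrlTransform (fun k => l k ^ 2) (fun k => w k ^ 2) n ≤ ctrlTransform l w n ^ 2 := by
  induction n with
  | zero => simp [ctrlTransform, mul_pow]
  | succ n ih =>
    have h1 := mul_le_ctrlTransform (n := n) hl hw
    have h2 : w (n + 1) ≤ w n := hw n.le_succ
    have h3 := hl n.le_succ
    have h4 : l n ^ 2 ≤ l (n + 1) ^ 2 := pow_le_pow_left₀ zero_le h3 2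
    simp only [ctrlTransform]
    rw [← NNReal.coe_le_coe] at ih h1 h2 ⊢
    have h3' : (l n : ℝ) ≤ l (n + 1) := h3
    push_cast [NNReal.coe_sub h3, NNReal.coe_sub h4] at *
    have h5 : (w (n + 1) : ℝ) * l n ≤ ctrlTransform l w n := by
      have := mul_le_mul_of_nonneg_right h2 (l n).2
      simp only [NNReal.val_eq_coe] at this
      linarith
    have h6 : (0 : ℝ) ≤ (l (n + 1) - l n) * w (n + 1) := mul_nonneg (by linarith) (w (n + 1)).2
    nlinarith [mul_nonneg h6 (sub_nonneg.2 h5)]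

lemma sum_sq_mul_le_ctrlTransform (hl : Monotone l) (hw : Antitone w) {D : ℕ → ℝ≥0∞}
    (hD : ∀ n, ∑ k ∈ Finset.range (n + 1), D k ≤ (l n : ℝ≥0∞) ^ 2) (n : ℕ) :
    ∑ k ∈ Finset.range (n + 1), (w k : ℝ≥0∞) ^ 2 * D k ≤ (ctrlTransform l w n : ℝ≥0∞) ^ 2 := by
  have hfin : ∀ k, D k ≠ ∞ := fun k => by
    refine ne_top_of_le_ne_top (b := (l k : ℝ≥0∞) ^ 2) (by simp) (le_trans ?_ (hD k))
    exact Finset.single_le_sum (f := D) (fun _ _ => zero_le) (by simp)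
  lift D to ℕ → ℝ≥0 using hfin
  dsimp only at hD ⊢
  norm_cast at hD ⊢
  refine le_trans ?_ (ctrlTransform_sq_le hl hw n)
  have h1 := abs_sum_mul_sub_le_ctrlTransform (l := fun k => l k ^ 2) (w := fun k => w k ^ 2)
    (f := fun n => ∑ k ∈ Finset.range n, (D k : ℝ))
    (fun a b hab => pow_le_pow_left₀ zero_le (hl hab) 2)
    (fun a b hab => pow_le_pow_left₀ zero_le (hw hab) 2) (by simp) (fun n => by
      rw [abs_of_nonneg (Finset.sum_nonneg fun k _ => NNReal.coe_nonneg _)]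
      exact_mod_cast hD n) n
  simp only [Finset.sum_range_succ_sub_sum] at h1
  rw [← NNReal.coe_le_coe]
  push_cast at h1 ⊢
  exact (le_abs_self _).trans h1

/-- Recovers `f` from its transform `G` by summing the increments of `G` with the increasing weights
`1 / w`. One `W B` bounds the boundary term, the other the total variation of `1 / w`. -/
lemma abs_sub_le_two_mul_of_weighted {f : ℕ → ℝ} (hw : Antitone w) {W : ℝ≥0}
    (hW : ∀ n, 1 ≤ W * w n) {B : ℝ}
    (hB : ∀ n, |∑ k ∈ Finset.range n, (w k : ℝ) * (f (k + 1) - f k)| ≤ B) (n : ℕ) :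
    |f n - f 0| ≤ 2 * W * B := by
  set G : ℕ → ℝ := fun n => ∑ k ∈ Finset.range n, (w k : ℝ) * (f (k + 1) - f k) with hG
  have hw0 : ∀ n, (0 : ℝ) < w n := fun n => by
    rcases eq_or_ne (w n) 0 with h | h
    · have := hW n
      simp [h] at this
    · exact_mod_cast pos_iff_ne_zero.2 h
  have hB0 : 0 ≤ B := (abs_nonneg _).trans (hB 0)
  have hWinv : ∀ n, (w n : ℝ)⁻¹ ≤ W := fun n => by
    rw [inv_le_iff_one_le_mul₀ (hw0 n)]
    exact_mod_cast hW n
  have key : |(w n : ℝ)⁻¹ * G n - (f n - f 0)| ≤ ((w n : ℝ)⁻¹ - (w 0 : ℝ)⁻¹) * B := by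
    induction n with
    | zero => simp [hG]
    | succ n ih =>
      have hGs : G (n + 1) = G n + w n * (f (n + 1) - f n) := Finset.sum_range_succ _ _
      have hd : 0 ≤ (w (n + 1) : ℝ)⁻¹ - (w n : ℝ)⁻¹ := by
        have : (w n : ℝ)⁻¹ ≤ (w (n + 1) : ℝ)⁻¹ :=
          inv_anti₀ (hw0 _) (by exact_mod_cast hw n.le_succ)
        linarith
      have e : (w (n + 1) : ℝ)⁻¹ * G (n + 1) - (f (n + 1) - f 0) =
          ((w n : ℝ)⁻¹ * G n - (f n - f 0)) + ((w (n + 1) : ℝ)⁻¹ - (w n : ℝ)⁻¹) * G (n + 1) := by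
        have : (w n : ℝ)⁻¹ * G (n + 1) = (w n : ℝ)⁻¹ * G n + (f (n + 1) - f n) := by
          rw [hGs, mul_add, inv_mul_cancel_left₀ (hw0 n).ne']
        linear_combination this
      rw [e]
      refine (abs_add_le _ _).trans ?_
      rw [abs_mul, abs_of_nonneg hd]
      have := mul_le_mul_of_nonneg_left (hB (n + 1)) hd
      linarith
  have h1 : |(w n : ℝ)⁻¹ * G n| ≤ W * B := by
    rw [abs_mul, abs_of_pos (inv_pos.2 (hw0 n))]
    exact mul_le_mul (hWinv n) (hB n) (abs_nonneg _) W.2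
  have h2 : ((w n : ℝ)⁻¹ - (w 0 : ℝ)⁻¹) * B ≤ W * B := by
    refine mul_le_mul_of_nonneg_right ?_ hB0
    linarith [hWinv n, inv_pos.2 (hw0 0)]
  have h3 := abs_sub_abs_le_abs_sub (f n - f 0) ((w n : ℝ)⁻¹ * G n)
  rw [abs_sub_comm (f n - f 0)] at h3
  linarith

end Pathwise

/-! ### Martingale transforms and conditional expectations of nonnegative functions. -/

section Transform

variable {X : Type*} {m0 : MeasurableSpace X} {ν : Measure X} {𝒢 : Filtration ℕ m0}

/-- The martingale transform `∑_{k < n} w_k (f_{k+1} - f_k)`. -/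
def mtransform (w f : ℕ → X → ℝ) (n : ℕ) (x : X) : ℝ :=
  ∑ k ∈ Finset.range n, w k x * (f (k + 1) x - f k x)

lemma mdiff_mtransform_succ (w f : ℕ → X → ℝ) (n : ℕ) (x : X) :
    mdiff (mtransform w f) (n + 1) x = w n x * mdiff f (n + 1) x := by
  simp [mdiff, mtransform, Finset.sum_range_succ]

lemma condExp_mul_sub_eq_zero {f : ℕ → X → ℝ} (hf : Martingale f 𝒢 ν) {k : ℕ} {φ : X → ℝ}
    (hφ : StronglyMeasurable[𝒢 k] φ)
    (hint : Integrable (fun x => φ x * (f (k + 1) x - f k x)) ν) :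
    ν[fun x => φ x * (f (k + 1) x - f k x) | 𝒢 k] =ᵐ[ν] 0 := by
  have hd : Integrable (f (k + 1) - f k) ν := (hf.integrable _).sub (hf.integrable _)
  have h1 := condExp_mul_of_stronglyMeasurable_left (μ := ν) hφ (g := f (k + 1) - f k) hint hd
  have h2 := condExp_sub (hf.integrable (k + 1)) (hf.integrable k) (𝒢 k)
  have h3 := hf.condExp_ae_eq k.le_succ
  have h4 := hf.condExp_ae_eq (le_refl k)
  refine h1.trans ?_
  filter_upwards [h2, h3, h4] with x h2 h3 h4
  simp [h2, h3, h4]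

lemma integral_mul_sub_eq_zero [IsFiniteMeasure ν] {f : ℕ → X → ℝ} (hf : Martingale f 𝒢 ν) {k : ℕ}
    {φ : X → ℝ} (hφ : StronglyMeasurable[𝒢 k] φ)
    (hint : Integrable (fun x => φ x * (f (k + 1) x - f k x)) ν) :
    ∫ x, φ x * (f (k + 1) x - f k x) ∂ν = 0 := by
  rw [← integral_condExp (𝒢.le k), integral_congr_ae (condExp_mul_sub_eq_zero hf hφ hint)]
  simp

lemma martingale_mtransform [IsFiniteMeasure ν] {w f : ℕ → X → ℝ} (hf : Martingale f 𝒢 ν)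
    (hw : StronglyAdapted 𝒢 w)
    (hint : ∀ k, Integrable (fun x => w k x * (f (k + 1) x - f k x)) ν) :
    Martingale (mtransform w f) 𝒢 ν := by
  refine martingale_of_condExp_sub_eq_zero_nat (fun n => ?_) (fun n => ?_) fun n => ?_
  · refine Finset.stronglyMeasurable_fun_sum (m := 𝒢 n) _ fun k hk => ?_
    have hk' := Finset.mem_range.1 hk
    exact (hw.stronglyMeasurable_le hk'.le).mul
      ((hf.stronglyAdapted.stronglyMeasurable_le hk').sub
        (hf.stronglyAdapted.stronglyMeasurable_le hk'.le))
  · exact integrable_finsetSum _ fun k _ => hint k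
  · have : mtransform w f (n + 1) - mtransform w f n =
        fun x => w n x * (f (n + 1) x - f n x) := by
      funext x
      simp [mtransform, Finset.sum_range_succ]
    rw [this]
    exact condExp_mul_sub_eq_zero hf (hw n) (hint n)

lemma integrable_mul_sub_of_bound {f : ℕ → X → ℝ} (hf : Martingale f 𝒢 ν) {w : ℕ → X → ℝ}
    (hw : StronglyAdapted 𝒢 w) {B : ℝ} (hB : ∀ k x, |w k x| ≤ B) (k : ℕ) :
    Integrable (fun x => w k x * (f (k + 1) x - f k x)) ν :=
  ((hf.integrable _).sub (hf.integrable _)).bdd_mul hw.stronglyMeasurable.aestronglyMeasurable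
    (Filter.Eventually.of_forall fun x => hB k x)

/-- Both sides are integrals of `φ` against a measure on `m`: the trimmed measures with densities
`condLExp m ν Y` and `Y` agree on `m`-measurable sets. No integrability is needed. -/
lemma lintegral_mul_condLExp {X : Type*} {m m0 : MeasurableSpace X} {ν : Measure X} (hm : m ≤ m0) [SigmaFinite (ν.trim hm)]
    {φ Y : X → ℝ≥0∞} (hφ : Measurable[m] φ) (hY : Measurable Y) :
    ∫⁻ x, φ x * condLExp m ν Y x ∂ν = ∫⁻ x, φ x * Y x ∂ν := by
  have h1 : ∀ Z : X → ℝ≥0∞, Measurable Z →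
      ∫⁻ x, φ x * Z x ∂ν = ∫⁻ x, φ x ∂((ν.withDensity Z).trim hm) := fun Z hZ => by
    rw [lintegral_trim hm hφ, lintegral_withDensity_eq_lintegral_mul _ hZ (hφ.mono hm le_rfl)]
    simp [mul_comm]
  rw [h1 _ (measurable_condLExp' _ _ _), h1 _ hY]
  congr 1
  refine @Measure.ext _ m _ _ fun s hs => ?_
  rw [trim_measurableSet_eq hm hs, trim_measurableSet_eq hm hs, withDensity_apply _ (hm s hs),
    withDensity_apply _ (hm s hs), setLIntegral_condLExp hm _ _ hs]

lemma condLExp_mul_left {X : Type*} {m m0 : MeasurableSpace X} {ν : Measure X} (hm : m ≤ m0) [SigmaFinite (ν.trim hm)]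
    {φ Y : X → ℝ≥0∞} (hφ : Measurable[m] φ) (hY : Measurable Y) :
    condLExp m ν (fun x => φ x * Y x) =ᵐ[ν] fun x => φ x * condLExp m ν Y x := by
  symm
  refine ae_eq_condLExp hm ν _ (Measurable.mul hφ (measurable_condLExp _ _ _)) fun s hs => ?_
  have h2 : ∀ Z : X → ℝ≥0∞, ∫⁻ x in s, φ x * Z x ∂ν = ∫⁻ x, s.indicator φ x * Z x ∂ν := fun Z => by
    rw [← lintegral_indicator (hm s hs)]
    refine lintegral_congr fun x => ?_
    by_cases hx : x ∈ s <;> simp [hx]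
  rw [h2, h2]
  exact lintegral_mul_condLExp hm (Measurable.indicator hφ hs) hY

end Transform

/-! ### The running maximum, Doob's inequality in `L_2` and orthogonality of increments. -/

/-- The running maximum `max_{k ≤ n} |f_k|`. -/
def runMax {X : Type*} (f : ℕ → X → ℝ) (n : ℕ) (x : X) : ℝ≥0 :=
  (Finset.range (n + 1)).sup fun k => ‖f k x‖₊

section RunMax

variable {X : Type*} {f : ℕ → X → ℝ} {n : ℕ} {x : X}

lemma runMax_mono : Monotone (runMax f) := fun a b hab x =>
  Finset.sup_mono (Finset.range_mono (by omega))

lemma nnnorm_le_runMax {k : ℕ} (hk : k ≤ n) : ‖f k x‖₊ ≤ runMax f n x :=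
  Finset.le_sup (f := fun k => ‖f k x‖₊) (Finset.mem_range.2 (by omega))

lemma runMax_zero : runMax f 0 x = ‖f 0 x‖₊ := by simp [runMax]

lemma runMax_succ : runMax f (n + 1) x = max (runMax f n x) ‖f (n + 1) x‖₊ := by
  unfold runMax
  rw [Finset.range_add_one, Finset.sup_insert, sup_comm]

lemma maximal_eq_iSup_runMax : maximal f x = ⨆ n, (runMax f n x : ℝ≥0∞) := by
  refine le_antisymm (iSup_le fun n => ?_) (iSup_le fun n => ?_)
  · exact (ENNReal.coe_le_coe.2 (nnnorm_le_runMax le_rfl)).trans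
      (le_iSup (fun n => (runMax f n x : ℝ≥0∞)) n)
  · have : runMax f n x ≤ (maximal f x) := by
      unfold runMax
      rw [ENNReal.coe_finset_sup]
      exact Finset.sup_le fun k _ => le_iSup (fun n => ‖f n x‖ₑ) k
    exact this

/-- A pathwise form of Doob's inequality: the sum is a martingale transform with mean zero, so
integration leaves the constant `4`. The proof bounds half the square by `M_n |f_n|` minus the sum,
and then uses `M |f| ≤ M²/4 + f²`. -/
lemma sq_runMax_le (f : ℕ → X → ℝ) (n : ℕ) (x : X) :
    (runMax f n x : ℝ) ^ 2 ≤ 4 * f n x ^ 2 -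
      4 * ∑ k ∈ Finset.range n,
        ((runMax f k x : ℝ) * SignType.sign (f k x)) * (f (k + 1) x - f k x) := by
  have key : (runMax f n x : ℝ) ^ 2 / 2 ≤ runMax f n x * |f n x| -
      ∑ k ∈ Finset.range n,
        ((runMax f k x : ℝ) * SignType.sign (f k x)) * (f (k + 1) x - f k x) := by
    induction n with
    | zero =>
      simp only [runMax_zero, coe_nnnorm, Real.norm_eq_abs, Finset.range_zero, Finset.sum_empty]
      nlinarith [sq_nonneg |f 0 x|]
    | succ n ih =>
      rw [Finset.sum_range_succ]
      have hM0 : (0 : ℝ) ≤ runMax f n x := NNReal.coe_nonneg _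
      have h1 : (SignType.sign (f n x) : ℝ) * f (n + 1) x ≤ |f (n + 1) x| := by
        rcases lt_trichotomy (f n x) 0 with h | h | h
        · simp [h, neg_le_abs]
        · simp [h]
        · simp [h, le_abs_self]
      have h2 : (SignType.sign (f n x) : ℝ) * f n x = |f n x| := by
        rcases lt_trichotomy (f n x) 0 with h | h | h
        · simp [h, abs_of_neg h]
        · simp [h]
        · simp [h, abs_of_pos h]
      have h3 : (runMax f n x * (SignType.sign (f n x) : ℝ)) * (f (n + 1) x - f n x) ≤
          runMax f n x * (|f (n + 1) x| - |f n x|) := by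
        rw [mul_assoc]
        refine mul_le_mul_of_nonneg_left ?_ hM0
        rw [mul_sub, h2]
        linarith
      have h4 : (runMax f (n + 1) x : ℝ) = max (runMax f n x : ℝ) |f (n + 1) x| := by
        rw [runMax_succ]; simp
      rcases le_total |f (n + 1) x| (runMax f n x : ℝ) with h | h
      · rw [h4, max_eq_left h]
        linarith
      · rw [h4, max_eq_right h]
        nlinarith [mul_nonneg (sub_nonneg.2 h) (sub_nonneg.2 h)]
  have h5 : (runMax f n x : ℝ) * |f n x| ≤ (runMax f n x : ℝ) ^ 2 / 4 + f n x ^ 2 := by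
    have := sq_nonneg ((runMax f n x : ℝ) / 2 - |f n x|)
    rw [← sq_abs (f n x)]
    nlinarith
  linarith

end RunMax

section SquareIntegrable

variable {X : Type*} {m0 : MeasurableSpace X} {ν : Measure X} {𝒢 : Filtration ℕ m0}
  {f : ℕ → X → ℝ}

lemma adapted_runMax (hf : StronglyAdapted 𝒢 f) : Adapted 𝒢 (runMax f) := fun n => by
  induction n with
  | zero =>
    have : runMax f 0 = fun x => ‖f 0 x‖₊ := funext fun x => runMax_zero
    rw [this]
    exact (hf 0).nnnorm.measurable
  | succ n ih =>
    have : runMax f (n + 1) = fun x => max (runMax f n x) ‖f (n + 1) x‖₊ :=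
      funext fun x => runMax_succ
    rw [this]
    exact Measurable.max (ih.mono (𝒢.mono n.le_succ) le_rfl) (hf _).nnnorm.measurable

lemma memLp_two_of_sub [IsFiniteMeasure ν] (h0 : f 0 =ᵐ[ν] 0)
    (hd : ∀ k, MemLp (fun x => f (k + 1) x - f k x) 2 ν) (n : ℕ) : MemLp (f n) 2 ν := by
  induction n with
  | zero => exact (memLp_congr_ae h0).2 MemLp.zero
  | succ n ih =>
    convert ih.add (hd n) using 1
    funext x
    simp

lemma integral_sq_eq_sum [IsFiniteMeasure ν] (hf : Martingale f 𝒢 ν) (h0 : f 0 =ᵐ[ν] 0)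
    (hd : ∀ k, MemLp (fun x => f (k + 1) x - f k x) 2 ν) (n : ℕ) :
    ∫ x, f n x ^ 2 ∂ν = ∑ k ∈ Finset.range n, ∫ x, (f (k + 1) x - f k x) ^ 2 ∂ν := by
  have hL := memLp_two_of_sub h0 hd
  induction n with
  | zero =>
    rw [integral_congr_ae (g := fun _ => 0) (h0.mono fun x hx => by simp [hx])]
    simp
  | succ n ih =>
    have hint : Integrable (fun x => f n x * (f (n + 1) x - f n x)) ν :=
      (hL n).integrable_mul (hd n)
    rw [Finset.sum_range_succ, ← ih, ← integral_add (hL n).integrable_sq (hd n).integrable_sq]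
    have h1 : ∀ x, f (n + 1) x ^ 2 = (f n x ^ 2 + (f (n + 1) x - f n x) ^ 2) +
        2 * (f n x * (f (n + 1) x - f n x)) := fun x => by ring
    simp_rw [h1]
    have hadd : Integrable (fun x => f n x ^ 2 + (f (n + 1) x - f n x) ^ 2) ν :=
      (hL n).integrable_sq.add (hd n).integrable_sq
    rw [integral_add hadd (hint.const_mul 2), integral_const_mul, integral_mul_sub_eq_zero hf (hf.stronglyAdapted n) hint]
    simp

lemma lintegral_enorm_sq_eq_ofReal {g : X → ℝ} (hg : MemLp g 2 ν) :
    ∫⁻ x, ‖g x‖ₑ ^ 2 ∂ν = ENNReal.ofReal (∫ x, g x ^ 2 ∂ν) := by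
  rw [ofReal_integral_eq_lintegral_ofReal hg.integrable_sq
    (Filter.Eventually.of_forall fun x => sq_nonneg _)]
  refine lintegral_congr fun x => ?_
  rw [← sq_abs, ENNReal.ofReal_pow (abs_nonneg _), Real.enorm_eq_ofReal_abs]

/-- Orthogonality of the increments of a square integrable martingale. -/
lemma lintegral_enorm_sq_eq_sum [IsFiniteMeasure ν] (hf : Martingale f 𝒢 ν) (h0 : f 0 =ᵐ[ν] 0)
    (hd : ∀ k, MemLp (fun x => f (k + 1) x - f k x) 2 ν) (n : ℕ) :
    ∫⁻ x, ‖f n x‖ₑ ^ 2 ∂ν =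
      ∑ k ∈ Finset.range n, ∫⁻ x, ‖f (k + 1) x - f k x‖ₑ ^ 2 ∂ν := by
  rw [lintegral_enorm_sq_eq_ofReal (memLp_two_of_sub h0 hd n), integral_sq_eq_sum hf h0 hd,
    ENNReal.ofReal_sum_of_nonneg fun k _ => integral_nonneg fun x => sq_nonneg _]
  exact Finset.sum_congr rfl fun k _ => (lintegral_enorm_sq_eq_ofReal (hd k)).symm

lemma memLp_runMax [IsFiniteMeasure ν] (hf : StronglyAdapted 𝒢 f) (hL : ∀ n, MemLp (f n) 2 ν)
    (n : ℕ) : MemLp (fun x => (runMax f n x : ℝ)) 2 ν := by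
  have hm : ∀ n, AEStronglyMeasurable (fun x => (runMax f n x : ℝ)) ν := fun n =>
    ((adapted_runMax hf).measurable (i := n)).coe_nnreal_real.aestronglyMeasurable
  induction n with
  | zero => simpa [runMax_zero] using (hL 0).norm
  | succ n ih =>
    refine MemLp.mono (ih.add (hL (n + 1)).norm) (hm _) (Filter.Eventually.of_forall fun x => ?_)
    rw [Real.norm_of_nonneg (NNReal.coe_nonneg _), runMax_succ]
    refine le_trans ?_ (le_abs_self _)
    simp only [NNReal.coe_max, coe_nnnorm, Pi.add_apply]
    exact max_le (le_add_of_nonneg_right (norm_nonneg _))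
      (le_add_of_nonneg_left (NNReal.coe_nonneg _))

/-- Doob's maximal inequality in `L_2`. -/
lemma lintegral_runMax_sq_le [IsFiniteMeasure ν] (hf : Martingale f 𝒢 ν)
    (hL : ∀ n, MemLp (f n) 2 ν) (n : ℕ) :
    ∫⁻ x, (runMax f n x : ℝ≥0∞) ^ 2 ∂ν ≤ 4 * ∫⁻ x, ‖f n x‖ₑ ^ 2 ∂ν := by
  have hM := memLp_runMax hf.stronglyAdapted hL
  have hsm : ∀ k, StronglyMeasurable[𝒢 k] fun x => (runMax f k x : ℝ) * SignType.sign (f k x) := by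
    intro k
    refine StronglyMeasurable.mul
      (adapted_runMax hf.stronglyAdapted k).coe_nnreal_real.stronglyMeasurable ?_
    have h1 : Measurable[𝒢 k] (f k) := (hf.stronglyAdapted k).measurable
    have h2 : Measurable fun t : ℝ => ((SignType.sign t : SignType) : ℝ) := by
      have : (fun t : ℝ => ((SignType.sign t : SignType) : ℝ)) =
          fun t => if 0 < t then 1 else if t < 0 then -1 else 0 := by
        funext t
        simp only [sign_apply]
        split_ifs <;> simp
      rw [this]
      exact Measurable.ite measurableSet_Ioi measurable_const
        (Measurable.ite measurableSet_Iio measurable_const measurable_const)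
    exact (h2.comp h1).stronglyMeasurable
  have hSL : ∀ k, MemLp (fun x => (runMax f k x : ℝ) * SignType.sign (f k x)) 2 ν := fun k => by
    refine (hM k).mono ((hsm k).mono (𝒢.le k)).aestronglyMeasurable
      (Filter.Eventually.of_forall fun x => ?_)
    rw [norm_mul]
    refine mul_le_of_le_one_right (norm_nonneg _) ?_
    rcases lt_trichotomy (f k x) 0 with h | h | h <;> simp [h]
  have hint : ∀ k, Integrable
      (fun x => ((runMax f k x : ℝ) * SignType.sign (f k x)) * (f (k + 1) x - f k x)) ν := fun k =>
    (hSL k).integrable_mul ((hL (k + 1)).sub (hL k))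
  have h1 : ∫ x, (runMax f n x : ℝ) ^ 2 ∂ν ≤ 4 * ∫ x, f n x ^ 2 ∂ν := by
    have h2 := integral_mono (hM n).integrable_sq
      (((hL n).integrable_sq.const_mul 4).sub
        ((integrable_finsetSum (Finset.range n) fun k _ => hint k).const_mul 4))
      (fun x => sq_runMax_le f n x)
    refine h2.trans (le_of_eq ?_)
    simp only [Pi.sub_apply]
    rw [integral_sub ((hL n).integrable_sq.const_mul 4)
      ((integrable_finsetSum (Finset.range n) fun k _ => hint k).const_mul 4),
      integral_const_mul, integral_const_mul, integral_finsetSum _ fun k _ => hint k,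
      Finset.sum_eq_zero fun k _ => integral_mul_sub_eq_zero hf (hsm k) (hint k)]
    simp
  have h3 := lintegral_enorm_sq_eq_ofReal (hM n)
  rw [lintegral_enorm_sq_eq_ofReal (hL n)]
  simp only [Real.enorm_eq_ofReal (NNReal.coe_nonneg _),
    ENNReal.ofReal_coe_nnreal] at h3
  rw [h3]
  calc _ ≤ ENNReal.ofReal (4 * ∫ x, f n x ^ 2 ∂ν) := ENNReal.ofReal_le_ofReal h1
    _ = _ := by rw [ENNReal.ofReal_mul (by norm_num)]; simp

end SquareIntegrable

/-! ### Elementary inequalities for absorption arguments. -/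

section Algebra

lemma ENNReal.le_two_mul_of_le_add_half {a b : ℝ≥0∞} (ha : a ≠ ∞) (h : a ≤ b + a / 2) :
    a ≤ 2 * b := by
  rcases eq_or_ne b ∞ with rfl | hb
  · simp
  lift a to ℝ≥0 using ha
  lift b to ℝ≥0 using hb
  have h' : a ≤ b + a / 2 := by
    rw [← ENNReal.coe_le_coe]
    rwa [ENNReal.coe_add, ENNReal.coe_div (by norm_num)]
  norm_cast
  rw [← NNReal.coe_le_coe] at h' ⊢
  push_cast at h' ⊢
  linarith

lemma ENNReal.add_pow_le_two_pow_mul (a b : ℝ≥0∞) (q : ℕ) :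
    (a + b) ^ q ≤ 2 ^ q * (a ^ q + b ^ q) := by
  wlog hab : a ≤ b generalizing a b
  · rw [add_comm a, add_comm (a ^ q)]
    exact this b a (le_of_not_ge hab)
  calc (a + b) ^ q ≤ (2 * b) ^ q := by rw [two_mul]; gcongr
    _ = 2 ^ q * b ^ q := mul_pow _ _ _
    _ ≤ _ := by gcongr; exact le_add_self

/-- Young's inequality with a small parameter, by comparing `y` with `t x`; the first term is the
one to be absorbed. -/
lemma ENNReal.pow_mul_le_add (x y : ℝ≥0∞) {t : ℝ≥0} (ht : 0 < t) (r : ℕ) :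
    x ^ r * y ≤ t * x ^ (r + 1) + (t⁻¹ : ℝ≥0) ^ r * y ^ (r + 1) := by
  have ht' : (t : ℝ≥0∞) ≠ 0 := by simpa using ht.ne'
  have htt : ((t⁻¹ : ℝ≥0) : ℝ≥0∞) * t = 1 := by
    norm_cast
    exact inv_mul_cancel₀ ht.ne'
  rcases le_total y (t * x) with h | h
  · refine le_trans ?_ le_self_add
    calc x ^ r * y ≤ x ^ r * (t * x) := by gcongr
      _ = _ := by ring
  · refine le_trans ?_ le_add_self
    have : x ≤ (t⁻¹ : ℝ≥0) * y := by
      calc x = ((t⁻¹ : ℝ≥0) * t) * x := by rw [htt, one_mul]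
        _ ≤ _ := by rw [mul_assoc]; gcongr
    calc x ^ r * y ≤ ((t⁻¹ : ℝ≥0) * y) ^ r * y := by gcongr
      _ = _ := by ring

lemma ENNReal.add_pow_succ_le (a b : ℝ≥0∞) (r : ℕ) :
    (a + b) ^ (r + 1) ≤ a ^ (r + 1) + (r + 1) * ((a + b) ^ r * b) := by
  induction r with
  | zero => simp
  | succ r ih =>
    calc (a + b) ^ (r + 2) = a * (a + b) ^ (r + 1) + b * (a + b) ^ (r + 1) := by ring
      _ ≤ a * (a ^ (r + 1) + (r + 1) * ((a + b) ^ r * b)) + b * (a + b) ^ (r + 1) := by gcongr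
      _ = a ^ (r + 2) + (r + 1) * ((a * (a + b) ^ r) * b) + b * (a + b) ^ (r + 1) := by ring
      _ ≤ a ^ (r + 2) + (r + 1) * (((a + b) * (a + b) ^ r) * b) + b * (a + b) ^ (r + 1) := by
          gcongr
          exact le_self_add
      _ = _ := by push_cast; ring

/-- The discrete form of `V^{r+1} = (r+1) ∫ V^r dV`; it is an upper bound because the increasing
integrand is evaluated at right endpoints. -/
lemma ENNReal.sum_pow_succ_le (D : ℕ → ℝ≥0∞) (r n : ℕ) :
    (∑ k ∈ Finset.range n, D k) ^ (r + 1) ≤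
      (r + 1) * ∑ k ∈ Finset.range n, (∑ i ∈ Finset.range (k + 1), D i) ^ r * D k := by
  induction n with
  | zero => simp
  | succ n ih =>
    rw [Finset.sum_range_succ D n]
    refine (ENNReal.add_pow_succ_le _ _ r).trans ?_
    rw [Finset.sum_range_succ _ n, mul_add, ← Finset.sum_range_succ D n]
    gcongr

/-- Summation by parts for increasing weights: the boundary term and the total variation of `b`
contribute at most `b n * l n` each. -/
lemma abs_sum_mul_sub_le_of_monotone {b l : ℕ → ℝ≥0} (hb : Monotone b) (hl : Monotone l)
    {f : ℕ → ℝ} (h0 : f 0 = 0) (hf : ∀ n, |f (n + 1)| ≤ l n) (n : ℕ) :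
    |∑ k ∈ Finset.range (n + 1), (b k : ℝ) * (f (k + 1) - f k)| ≤ 2 * (b n * l n) := by
  have key : |∑ k ∈ Finset.range (n + 1), (b k : ℝ) * (f (k + 1) - f k) - b n * f (n + 1)| ≤
      (b n - b 0) * l n := by
    induction n with
    | zero => simp [h0]
    | succ n ih =>
      rw [Finset.sum_range_succ]
      set s := ∑ k ∈ Finset.range (n + 1), (b k : ℝ) * (f (k + 1) - f k)
      have hbn : (b n : ℝ) ≤ b (n + 1) := by exact_mod_cast hb n.le_succ
      have hb0 : (b 0 : ℝ) ≤ b n := by exact_mod_cast hb (zero_le (a := n))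
      have hln : (l n : ℝ) ≤ l (n + 1) := by exact_mod_cast hl n.le_succ
      have e : s + b (n + 1) * (f (n + 1 + 1) - f (n + 1)) - b (n + 1) * f (n + 1 + 1) =
          (s - b n * f (n + 1)) - (b (n + 1) - b n) * f (n + 1) := by ring
      rw [e]
      refine (abs_sub _ _).trans ?_
      rw [abs_mul, abs_of_nonneg (sub_nonneg.2 hbn)]
      have h1 := mul_le_mul_of_nonneg_left ((hf n).trans hln) (sub_nonneg.2 hbn)
      have h2 := mul_le_mul_of_nonneg_left hln (sub_nonneg.2 hb0)
      nlinarith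
  have h2 : |(b n : ℝ) * f (n + 1)| ≤ b n * l n := by
    rw [abs_mul, NNReal.abs_eq]
    exact mul_le_mul_of_nonneg_left (hf n) (b n).2
  have h3 := abs_sub_abs_le_abs_sub
    (∑ k ∈ Finset.range (n + 1), (b k : ℝ) * (f (k + 1) - f k)) (b n * f (n + 1))
  have h4 : (0 : ℝ) ≤ b 0 * l n := mul_nonneg (b 0).2 (l n).2
  nlinarith

end Algebra

/-! ### The maximal function in `L_q`, `q` a power of two, under a control of the quadratic
variation. -/

section Base

/-- Doob's inequality for the maximal function of a martingale in `L_2`. -/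
lemma lintegral_maximal_sq_le {X : Type*} {m0 : MeasurableSpace X} {ν : Measure X}
    [IsFiniteMeasure ν] {𝒢 : Filtration ℕ m0} {f : ℕ → X → ℝ} (hf : Martingale f 𝒢 ν)
    (h0 : f 0 =ᵐ[ν] 0) :
    ∫⁻ x, maximal f x ^ 2 ∂ν ≤ 4 * ∑' k, ∫⁻ x, ‖f (k + 1) x - f k x‖ₑ ^ 2 ∂ν := by
  by_cases htop : ∑' k, ∫⁻ x, ‖f (k + 1) x - f k x‖ₑ ^ 2 ∂ν = ∞
  · rw [htop]; simp
  have hd : ∀ k, MemLp (fun x => f (k + 1) x - f k x) 2 ν := fun k => by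
    refine ⟨((hf.integrable _).sub (hf.integrable _)).aestronglyMeasurable, ?_⟩
    rw [eLpNorm_lt_top_iff_lintegral_rpow_enorm_lt_top (by norm_num) (by norm_num)]
    simpa using (ENNReal.ne_top_of_tsum_ne_top htop k).lt_top
  have hL := memLp_two_of_sub h0 hd
  have h1 : ∀ x, maximal f x ^ 2 = ⨆ n, (runMax f n x : ℝ≥0∞) ^ 2 := fun x => by
    rw [maximal_eq_iSup_runMax]
    have := (ENNReal.orderIsoRpow 2 two_pos).map_iSup fun n => (runMax f n x : ℝ≥0∞)
    simp only [ENNReal.orderIsoRpow_apply, ENNReal.rpow_two] at this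
    exact this
  simp_rw [h1]
  rw [lintegral_iSup]
  · refine iSup_le fun n => (lintegral_runMax_sq_le hf hL n).trans ?_
    gcongr
    rw [lintegral_enorm_sq_eq_sum hf h0 hd]
    exact ENNReal.sum_le_tsum _
  · exact fun n => ((adapted_runMax hf.stronglyAdapted).measurable
      (i := n)).coe_nnreal_ennreal.pow_const 2
  · intro a b hab x
    exact pow_le_pow_left₀ zero_le (ENNReal.coe_le_coe.2 (runMax_mono hab x)) 2

lemma ae_bdd_of_sub {X : Type*} {m0 : MeasurableSpace X} {ν : Measure X} {f : ℕ → X → ℝ}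
    (h0 : f 0 =ᵐ[ν] 0) (hd : ∀ n, ∃ B : ℝ≥0, ∀ᵐ x ∂ν, ‖f (n + 1) x - f n x‖₊ ≤ B) (n : ℕ) :
    ∃ B : ℝ≥0, ∀ᵐ x ∂ν, runMax f n x ≤ B := by
  induction n with
  | zero => exact ⟨0, h0.mono fun x hx => by simp [runMax_zero, hx]⟩
  | succ n ih =>
    obtain ⟨B, hB⟩ := ih
    obtain ⟨C, hC⟩ := hd n
    refine ⟨B + C, ?_⟩
    filter_upwards [hB, hC] with x hx hy
    rw [runMax_succ]
    refine max_le (hx.trans le_self_add) ?_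
    calc ‖f (n + 1) x‖₊ = ‖f n x + (f (n + 1) x - f n x)‖₊ := by congr 1; ring
      _ ≤ ‖f n x‖₊ + ‖f (n + 1) x - f n x‖₊ := nnnorm_add_le _ _
      _ ≤ B + C := add_le_add ((nnnorm_le_runMax le_rfl).trans hx) hy

/-- From `f_k² = ∑ d_{i+1}² + 2 ∑ f_i d_{i+1}` at an index `k ≤ n` where the maximum is attained.
The second sum is a martingale transform of `f` by itself, so moments of `f` reduce to moments of
half the order of another martingale. -/
lemma sq_runMax_le_of_sum_sq {X : Type*} {f : ℕ → X → ℝ} {l : ℕ → X → ℝ≥0} {x : X} (h0 : f 0 x = 0)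
    (h : ∀ n, ∑ k ∈ Finset.range (n + 1), ‖f (k + 1) x - f k x‖₊ ^ 2 ≤ l n x ^ 2) (n : ℕ) :
    runMax f n x ^ 2 ≤ l n x ^ 2 + 2 * runMax (mtransform f f) n x := by
  obtain ⟨k, hk, hkn⟩ : ∃ k ≤ n, runMax f n x = ‖f k x‖₊ := by
    obtain ⟨k, hk, h⟩ := Finset.exists_mem_eq_sup (Finset.range (n + 1)) ⟨0, by simp⟩
      fun k => ‖f k x‖₊
    exact ⟨k, Nat.lt_succ_iff.1 (Finset.mem_range.1 hk), h⟩
  have h1 : ∀ k, f k x ^ 2 = ∑ i ∈ Finset.range k, (f (i + 1) x - f i x) ^ 2 +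
      2 * mtransform f f k x := fun k => by
    induction k with
    | zero => simp [h0, mtransform]
    | succ k ih =>
      have : mtransform f f (k + 1) x = mtransform f f k x + f k x * (f (k + 1) x - f k x) :=
        Finset.sum_range_succ _ _
      rw [this, Finset.sum_range_succ]
      linear_combination ih
  rw [hkn]
  have h2 : ∑ i ∈ Finset.range k, ‖f (i + 1) x - f i x‖₊ ^ 2 ≤ l n x ^ 2 :=
    (Finset.sum_le_sum_of_subset (Finset.range_mono (by omega))).trans (h n)
  have h3 : |mtransform f f k x| ≤ runMax (mtransform f f) n x := by
    exact_mod_cast (nnnorm_le_runMax (f := mtransform f f) (x := x) hk)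
  rw [← NNReal.coe_le_coe] at h2 ⊢
  push_cast at h2 ⊢
  simp only [Real.norm_eq_abs, sq_abs] at h2 ⊢
  rw [h1 k]
  linarith [le_abs_self (mtransform f f k x)]

/-- Powers of the maximal function of a martingale whose quadratic variation has a bounded
predictable majorant. -/
theorem lintegral_runMax_pow_le (j : ℕ) : ∃ A : ℝ≥0, ∀ (X : Type*) (m0 : MeasurableSpace X)
    (ν : Measure X) [IsProbabilityMeasure ν] (𝒢 : Filtration ℕ m0) (f : ℕ → X → ℝ)
    (l : ℕ → X → ℝ≥0), Martingale f 𝒢 ν → f 0 =ᵐ[ν] 0 → Adapted 𝒢 l → Monotone l →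
    (∀ n, ∃ B : ℝ≥0, ∀ᵐ x ∂ν, l n x ≤ B) →
    (∀ n, ∀ᵐ x ∂ν, ∑ k ∈ Finset.range (n + 1), ‖f (k + 1) x - f k x‖₊ ^ 2 ≤ l n x ^ 2) →
    ∀ n, ∫⁻ x, (runMax f n x : ℝ≥0∞) ^ 2 ^ (j + 1) ∂ν ≤
      A * ∫⁻ x, (l n x : ℝ≥0∞) ^ 2 ^ (j + 1) ∂ν := by
  have hdiff : ∀ {X : Type _} {m0 : MeasurableSpace X} {ν : Measure X} {f : ℕ → X → ℝ}
      {l : ℕ → X → ℝ≥0}, (∀ n, ∃ B : ℝ≥0, ∀ᵐ x ∂ν, l n x ≤ B) →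
      (∀ n, ∀ᵐ x ∂ν, ∑ k ∈ Finset.range (n + 1), ‖f (k + 1) x - f k x‖₊ ^ 2 ≤ l n x ^ 2) →
      ∀ n, ∃ B : ℝ≥0, ∀ᵐ x ∂ν, ‖f (n + 1) x - f n x‖₊ ≤ B := by
    intro X m0 ν f l hB h n
    obtain ⟨B, hB⟩ := hB n
    refine ⟨B, ?_⟩
    filter_upwards [hB, h n] with x hx hs
    refine le_trans ?_ hx
    refine (pow_le_pow_iff_left₀ zero_le zero_le two_ne_zero).1 ?_
    exact (Finset.single_le_sum (f := fun k => ‖f (k + 1) x - f k x‖₊ ^ 2)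
      (fun _ _ => zero_le) (by simp)).trans hs
  induction j with
  | zero =>
    refine ⟨4, fun X m0 ν _ 𝒢 f l hf h0 hlad hl hB h n => ?_⟩
    have hd : ∀ k, MemLp (fun x => f (k + 1) x - f k x) 2 ν := fun k => by
      obtain ⟨B, hB⟩ := hdiff hB h k
      exact MemLp.of_bound ((hf.integrable _).sub (hf.integrable _)).aestronglyMeasurable B
        (hB.mono fun x hx => by exact_mod_cast hx)
    have h1 := lintegral_runMax_sq_le hf (memLp_two_of_sub h0 hd) n
    rw [lintegral_enorm_sq_eq_sum hf h0 hd, ← lintegral_finsetSum'] at h1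
    · simp only [zero_add, pow_one]
      refine h1.trans ?_
      push_cast
      gcongr 4 * ?_
      refine lintegral_mono_ae ?_
      filter_upwards [h n] with x hx
      refine le_trans (Finset.sum_le_sum_of_subset (Finset.range_mono n.le_succ)) ?_
      simp only [enorm_eq_nnnorm]
      exact_mod_cast hx
    · exact fun k _ => ((hd k).aestronglyMeasurable.enorm).pow_const 2
  | succ j ih =>
    obtain ⟨A, hA⟩ := ih
    set q := 2 ^ (j + 1) with hq
    -- Makes `4^q A t ≤ 1/2`, so that the term in `I` can be absorbed; `A + 1` replaces `A` to stay
    -- invertible.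
    set t : ℝ≥0 := (2 * (4 ^ q * (A + 1)))⁻¹ with ht
    have ht0 : 0 < t := by positivity
    refine ⟨2 * (2 ^ q + 4 ^ q * A * t⁻¹), fun X m0 ν _ 𝒢 f l hf h0 hlad hl hB h n => ?_⟩
    have hpow : 2 ^ (j + 1 + 1) = 2 * q := by rw [hq, pow_succ' 2 (j + 1)]
    rw [hpow]
    have hMB := ae_bdd_of_sub h0 (hdiff hB h)
    have hMad := adapted_runMax hf.stronglyAdapted
    set H := mtransform f f with hH
    have hHmart : Martingale H 𝒢 ν := by
      refine martingale_mtransform hf hf.stronglyAdapted fun k => ?_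
      obtain ⟨B, hB⟩ := hMB k
      refine ((hf.integrable (k + 1)).sub (hf.integrable k)).bdd_mul (c := B)
        (hf.integrable k).aestronglyMeasurable (hB.mono fun x hx => ?_)
      exact_mod_cast (nnnorm_le_runMax le_rfl).trans hx
    -- The square function of `H` at time `n + 1` is at most `M_n(f) λ_n`, which is known at time
    -- `n`. This control is bounded for each `n` but perhaps not uniformly in `n`, hence the form of
    -- the boundedness hypothesis.
    have hHA := hA X m0 ν 𝒢 H (fun n x => runMax f n x * l n x) hHmart
      (Filter.Eventually.of_forall fun x => by simp [hH, mtransform]) (fun n => (hMad n).mul (hlad n))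
      (fun a b hab x => mul_le_mul' (runMax_mono hab x) (hl hab x))
      (fun n => by
        obtain ⟨B, hB⟩ := hB n
        obtain ⟨C, hC⟩ := hMB n
        refine ⟨C * B, ?_⟩
        filter_upwards [hB, hC] with x hx hy using mul_le_mul' hy hx)
      (fun n => by
        filter_upwards [h n] with x hx
        rw [mul_pow]
        refine le_trans ?_ (mul_le_mul' le_rfl hx)
        rw [Finset.mul_sum]
        refine Finset.sum_le_sum fun k hk => ?_
        have : H (k + 1) x - H k x = f k x * (f (k + 1) x - f k x) := by
          simp [hH, mtransform, Finset.sum_range_succ]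
        rw [this, nnnorm_mul, mul_pow]
        gcongr
        exact nnnorm_le_runMax (Nat.lt_succ_iff.1 (Finset.mem_range.1 hk))) n
    set I := ∫⁻ x, (runMax f n x : ℝ≥0∞) ^ (2 * q) ∂ν with hI
    set Lq := ∫⁻ x, (l n x : ℝ≥0∞) ^ (2 * q) ∂ν with hLq
    have hMm : Measurable fun x => (runMax f n x : ℝ≥0∞) :=
      (hMad.measurable (i := n)).coe_nnreal_ennreal
    have hlm : Measurable fun x => (l n x : ℝ≥0∞) := (hlad.measurable (i := n)).coe_nnreal_ennreal
    -- Finiteness is needed to subtract `I / 2` at the end, and follows from the almost sure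
    -- boundedness of the increments.
    have hIfin : I ≠ ∞ := by
      obtain ⟨B, hB⟩ := hMB n
      refine ne_top_of_le_ne_top (b := ∫⁻ _, (B : ℝ≥0∞) ^ (2 * q) ∂ν) (by simp) ?_
      refine lintegral_mono_ae ?_
      filter_upwards [hB] with x hx
      gcongr
    have hprod : ∫⁻ x, ((runMax f n x * l n x : ℝ≥0) : ℝ≥0∞) ^ q ∂ν ≤
        t * I + (t⁻¹ : ℝ≥0) * Lq := by
      rw [hI, hLq, ← lintegral_const_mul _ (hMm.pow_const _),
        ← lintegral_const_mul _ (hlm.pow_const _),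
        ← lintegral_add_left ((hMm.pow_const _).const_mul _)]
      refine lintegral_mono fun x => ?_
      have := ENNReal.pow_mul_le_add ((runMax f n x : ℝ≥0∞) ^ q) ((l n x : ℝ≥0∞) ^ q) ht0 1
      push_cast
      rw [mul_pow]
      simpa [← pow_mul, mul_comm q] using this
    have hae : ∀ᵐ x ∂ν, ∀ n, ∑ k ∈ Finset.range (n + 1), ‖f (k + 1) x - f k x‖₊ ^ 2 ≤ l n x ^ 2 :=
      ae_all_iff.2 h
    have hmain : I ≤ 2 ^ q * Lq + 4 ^ q * ∫⁻ x, (runMax H n x : ℝ≥0∞) ^ q ∂ν := by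
      have hHm : Measurable fun x => (runMax H n x : ℝ≥0∞) :=
        ((adapted_runMax hHmart.stronglyAdapted).measurable (i := n)).coe_nnreal_ennreal
      rw [hI, hLq, ← lintegral_const_mul _ (hlm.pow_const _),
        ← lintegral_const_mul _ (hHm.pow_const _),
        ← lintegral_add_left ((hlm.pow_const _).const_mul _)]
      refine lintegral_mono_ae ?_
      filter_upwards [h0, hae] with x hx0 hx
      have h5 := sq_runMax_le_of_sum_sq hx0 hx n
      have h6 : (runMax f n x : ℝ≥0∞) ^ 2 ≤ (l n x : ℝ≥0∞) ^ 2 + 2 * runMax H n x := by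
        exact_mod_cast h5
      calc (runMax f n x : ℝ≥0∞) ^ (2 * q) = ((runMax f n x : ℝ≥0∞) ^ 2) ^ q := pow_mul _ _ _
        _ ≤ ((l n x : ℝ≥0∞) ^ 2 + 2 * runMax H n x) ^ q := by gcongr
        _ ≤ 2 ^ q * (((l n x : ℝ≥0∞) ^ 2) ^ q + (2 * runMax H n x) ^ q) :=
            ENNReal.add_pow_le_two_pow_mul _ _ _
        _ = _ := by
            rw [mul_add, ← pow_mul, mul_pow, ← mul_assoc, ← mul_pow]
            norm_num
    have hfinal : I ≤ ((2 ^ q + 4 ^ q * A * t⁻¹ : ℝ≥0) : ℝ≥0∞) * Lq + I / 2 := by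
      refine hmain.trans ?_
      have h7 : (4 : ℝ≥0∞) ^ q * (A * (t * I)) ≤ I / 2 := by
        have h8 : (4 ^ q * (A * t) : ℝ≥0) ≤ 2⁻¹ := by
          rw [ht, mul_inv, mul_inv]
          calc (4 ^ q * (A * (2⁻¹ * ((4 ^ q)⁻¹ * (A + 1)⁻¹))) : ℝ≥0)
              = 2⁻¹ * (4 ^ q * (4 ^ q)⁻¹) * (A * (A + 1)⁻¹) := by ring
            _ ≤ 2⁻¹ * 1 * 1 := by
                gcongr
                · rw [mul_inv_cancel₀ (by positivity)]
                · rw [← div_eq_mul_inv]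
                  exact div_le_one_of_le₀ le_self_add zero_le
            _ = 2⁻¹ := by norm_num
        calc (4 : ℝ≥0∞) ^ q * (A * (t * I)) = ((4 ^ q * (A * t) : ℝ≥0) : ℝ≥0∞) * I := by
              push_cast; ring
          _ ≤ ((2⁻¹ : ℝ≥0) : ℝ≥0∞) * I := by gcongr
          _ = I / 2 := by
              rw [ENNReal.coe_inv (by norm_num), div_eq_mul_inv, mul_comm]; rfl
      calc 2 ^ q * Lq + 4 ^ q * ∫⁻ x, (runMax H n x : ℝ≥0∞) ^ q ∂ν
          ≤ 2 ^ q * Lq + 4 ^ q * (A * (t * I + (t⁻¹ : ℝ≥0) * Lq)) := by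
            gcongr
            exact hHA.trans (by gcongr)
        _ = ((2 ^ q + 4 ^ q * A * t⁻¹ : ℝ≥0) : ℝ≥0∞) * Lq + 4 ^ q * (A * (t * I)) := by
            push_cast; ring
        _ ≤ _ := by gcongr
    refine (ENNReal.le_two_mul_of_le_add_half hIfin hfinal).trans (le_of_eq ?_)
    push_cast
    ring

end Base

/-! ### Quadratic and conditional quadratic variation in `L_{2(r+1)}` under a control of the
martingale. -/

/-- Moments of a bracket `∑ D_k` that is the compensator or the quadratic variation of a martingale
with a bounded predictable majorant. -/
theorem lintegral_bracket_pow_le (r : ℕ) : ∃ A : ℝ≥0, ∀ (X : Type*) (m0 : MeasurableSpace X)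
    (ν : Measure X) [IsProbabilityMeasure ν] (𝒢 : Filtration ℕ m0) (f : ℕ → X → ℝ)
    (l c : ℕ → X → ℝ≥0) (D : ℕ → X → ℝ≥0∞), Martingale f 𝒢 ν → f 0 =ᵐ[ν] 0 →
    Adapted 𝒢 l → Monotone l → (∀ n, ∀ᵐ x ∂ν, ‖f (n + 1) x‖₊ ≤ l n x) →
    (∀ k, Measurable (D k)) → Adapted 𝒢 c → Monotone c → (∀ n, ∃ B : ℝ≥0, ∀ᵐ x ∂ν, c n x ≤ B) →
    (∀ n, ∀ᵐ x ∂ν, ∑ k ∈ Finset.range (n + 1), D k x ≤ (c n x : ℝ≥0∞) ^ 2) →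
    (∀ n, ∀ᵐ x ∂ν, (c n x : ℝ≥0∞) ^ 2 ≤
      ∑ k ∈ Finset.range (n + 1), D k x + 4 * (l n x : ℝ≥0∞) ^ 2) →
    (∀ k, ∀ φ : X → ℝ≥0∞, Measurable[𝒢 k] φ →
      ∫⁻ x, φ x * D k x ∂ν = ∫⁻ x, φ x * ‖f (k + 1) x - f k x‖ₑ ^ 2 ∂ν) →
    (∀ k, MemLp (fun x => f (k + 1) x - f k x) 2 ν) →
    ∀ n, ∫⁻ x, (∑ k ∈ Finset.range (n + 1), D k x) ^ (r + 1) ∂ν ≤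
      A * ∫⁻ x, (l n x : ℝ≥0∞) ^ (2 * (r + 1)) ∂ν := by
  -- Makes the total coefficient of `I` in the final estimate equal to `1/2`.
  set t : ℝ≥0 := (2 * ((r + 1) * 4 * 2 ^ (r + 1)))⁻¹ with ht
  have ht0 : 0 < t := by positivity
  refine ⟨2 * ((r + 1) * 4 * (t * 2 ^ (r + 1) * 4 ^ (r + 1) + t⁻¹ ^ r)),
    fun X m0 ν _ 𝒢 f l c D hf h0 hlad hl hfl hDm hcad hc hcB hDc hcD hφ hd n => ?_⟩
  set V : X → ℝ≥0∞ := fun x => ∑ k ∈ Finset.range (n + 1), D k x with hV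
  set I := ∫⁻ x, V x ^ (r + 1) ∂ν with hI
  set L := ∫⁻ x, (l n x : ℝ≥0∞) ^ (2 * (r + 1)) ∂ν with hL
  have hcm : ∀ n, Measurable (c n) := fun n => hcad.measurable (i := n)
  have hlm : ∀ n, Measurable (l n) := fun n => hlad.measurable (i := n)
  have hVm : Measurable V := Finset.measurable_fun_sum _ fun k _ => hDm k
  have hIfin : I ≠ ∞ := by
    obtain ⟨B, hB⟩ := hcB n
    refine ne_top_of_le_ne_top (b := ∫⁻ _, ((B : ℝ≥0∞) ^ 2) ^ (r + 1) ∂ν) (by simp) ?_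
    refine lintegral_mono_ae ?_
    filter_upwards [hB, hDc n] with x hx hy
    gcongr
    exact hy.trans (by gcongr)
  -- Since `V^{r+1} ≤ (r+1) ∑ V_k^r D_k` and `V_k ≤ c_k²` with `c_k` known at time `k`, the moment
  -- is bounded by `∑ ∫ c_k^{2r} D_k`, which is the second moment of the transform by `c^r`.
  -- Pathwise this transform is at most `2 c_n^r λ_n`, so Young's inequality closes the estimate.
  set h := mtransform (fun k x => ((c k x ^ r : ℝ≥0) : ℝ)) f with hh
  have hcsm : StronglyAdapted 𝒢 fun k x => ((c k x ^ r : ℝ≥0) : ℝ) := fun k =>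
    ((hcad k).pow_const r).coe_nnreal_real.stronglyMeasurable
  have hdiff : ∀ k x, h (k + 1) x - h k x = ((c k x ^ r : ℝ≥0) : ℝ) * (f (k + 1) x - f k x) :=
    fun k x => by simp [hh, mtransform, Finset.sum_range_succ]
  have hcr : ∀ k, ∃ B : ℝ≥0, ∀ᵐ x ∂ν, ‖((c k x ^ r : ℝ≥0) : ℝ)‖ ≤ B := fun k => by
    obtain ⟨B, hB⟩ := hcB k
    refine ⟨B ^ r, hB.mono fun x hx => ?_⟩
    rw [Real.norm_of_nonneg (NNReal.coe_nonneg _), NNReal.coe_le_coe]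
    gcongr
  have hmart : Martingale h 𝒢 ν := by
    refine martingale_mtransform hf hcsm fun k => ?_
    obtain ⟨B, hB⟩ := hcr k
    exact ((hf.integrable (k + 1)).sub (hf.integrable k)).bdd_mul (c := B)
      hcsm.stronglyMeasurable.aestronglyMeasurable hB
  have hh0 : h 0 =ᵐ[ν] 0 := Filter.Eventually.of_forall fun x => by simp [hh, mtransform]
  have hhd : ∀ k, MemLp (fun x => h (k + 1) x - h k x) 2 ν := fun k => by
    obtain ⟨B, hB⟩ := hcr k
    simp_rw [hdiff]
    refine (hd k).of_le_mul (c := B) (hcsm.stronglyMeasurable.aestronglyMeasurable.mul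
      (hd k).aestronglyMeasurable) ?_
    filter_upwards [hB] with x hx
    rw [norm_mul]
    gcongr
  have hiso : ∑ k ∈ Finset.range (n + 1), ∫⁻ x, (c k x : ℝ≥0∞) ^ (2 * r) * D k x ∂ν =
      ∫⁻ x, ‖h (n + 1) x‖ₑ ^ 2 ∂ν := by
    rw [lintegral_enorm_sq_eq_sum hmart hh0 hhd]
    refine Finset.sum_congr rfl fun k _ => ?_
    rw [hφ k _ ((hcad k).coe_nnreal_ennreal.pow_const _)]
    refine lintegral_congr fun x => ?_
    rw [hdiff, enorm_mul, mul_pow, NNReal.enorm_eq]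
    push_cast
    ring
  have h1 : I ≤ (r + 1) * ∫⁻ x, ‖h (n + 1) x‖ₑ ^ 2 ∂ν := by
    have hm : ∀ k, Measurable fun x => (c k x : ℝ≥0∞) ^ (2 * r) * D k x := fun k =>
      ((hcm k).coe_nnreal_ennreal.pow_const _).mul (hDm k)
    rw [← hiso, ← lintegral_finsetSum _ fun k _ => hm k, ← lintegral_const_mul _
      (Finset.measurable_fun_sum _ fun k _ => hm k)]
    refine lintegral_mono_ae ?_
    filter_upwards [ae_all_iff.2 hDc] with x hx
    refine (ENNReal.sum_pow_succ_le (fun k => D k x) r (n + 1)).trans ?_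
    refine mul_le_mul' le_rfl (Finset.sum_le_sum fun k _ => mul_le_mul' ?_ le_rfl)
    rw [pow_mul]
    gcongr
    exact hx k
  have h2 : ∀ᵐ x ∂ν, ‖h (n + 1) x‖ₑ ^ 2 ≤
      4 * ((t * 2 ^ (r + 1)) * V x ^ (r + 1) +
        (t * 2 ^ (r + 1) * 4 ^ (r + 1) + (t⁻¹ : ℝ≥0) ^ r) * (l n x : ℝ≥0∞) ^ (2 * (r + 1))) := by
    filter_upwards [h0, ae_all_iff.2 hfl, hcD n] with x hx0 hx hy
    have h3 := abs_sum_mul_sub_le_of_monotone (b := fun k => c k x ^ r) (l := fun k => l k x)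
      (fun a b hab => pow_le_pow_left₀ zero_le (hc hab x) r) (fun a b hab => hl hab x)
      (f := fun k => f k x) hx0 (fun n => by exact_mod_cast hx n) n
    have h4 : ‖h (n + 1) x‖ₑ ≤ 2 * ((c n x : ℝ≥0∞) ^ r * l n x) := by
      have : ‖h (n + 1) x‖₊ ≤ 2 * (c n x ^ r * l n x) := by
        rw [← NNReal.coe_le_coe]
        exact_mod_cast h3
      rw [enorm_eq_nnnorm]
      exact_mod_cast this
    have h5 : ((c n x : ℝ≥0∞) ^ 2) ^ (r + 1) ≤
        2 ^ (r + 1) * (V x ^ (r + 1) + 4 ^ (r + 1) * (l n x : ℝ≥0∞) ^ (2 * (r + 1))) := by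
      calc ((c n x : ℝ≥0∞) ^ 2) ^ (r + 1) ≤ (V x + 4 * (l n x : ℝ≥0∞) ^ 2) ^ (r + 1) := by gcongr
        _ ≤ _ := ENNReal.add_pow_le_two_pow_mul _ _ _
        _ = _ := by rw [mul_pow, ← pow_mul]
    calc ‖h (n + 1) x‖ₑ ^ 2 ≤ (2 * ((c n x : ℝ≥0∞) ^ r * l n x)) ^ 2 := by gcongr
      _ = 4 * (((c n x : ℝ≥0∞) ^ 2) ^ r * (l n x : ℝ≥0∞) ^ 2) := by ring
      _ ≤ 4 * (t * ((c n x : ℝ≥0∞) ^ 2) ^ (r + 1) +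
          (t⁻¹ : ℝ≥0) ^ r * ((l n x : ℝ≥0∞) ^ 2) ^ (r + 1)) := by
          gcongr
          exact ENNReal.pow_mul_le_add _ _ ht0 r
      _ ≤ 4 * (t * (2 ^ (r + 1) * (V x ^ (r + 1) + 4 ^ (r + 1) *
          (l n x : ℝ≥0∞) ^ (2 * (r + 1)))) +
          (t⁻¹ : ℝ≥0) ^ r * ((l n x : ℝ≥0∞) ^ 2) ^ (r + 1)) := by gcongr
      _ = _ := by rw [← pow_mul]; ring
  have h3 : ∫⁻ x, ‖h (n + 1) x‖ₑ ^ 2 ∂ν ≤ 4 * ((t * 2 ^ (r + 1)) * I +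
        (t * 2 ^ (r + 1) * 4 ^ (r + 1) + (t⁻¹ : ℝ≥0) ^ r) * L) := by
    have hlq : Measurable fun x => (l n x : ℝ≥0∞) ^ (2 * (r + 1)) :=
      (hlm n).coe_nnreal_ennreal.pow_const _
    rw [hI, hL, ← lintegral_const_mul _ (hVm.pow_const _), ← lintegral_const_mul _ hlq,
      ← lintegral_add_left ((hVm.pow_const _).const_mul _),
      ← lintegral_const_mul _ (by fun_prop)]
    exact lintegral_mono_ae h2
  have h4 : I ≤ (((r + 1) * 4 * (t * 2 ^ (r + 1) * 4 ^ (r + 1) + t⁻¹ ^ r) : ℝ≥0) : ℝ≥0∞) * L +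
      I / 2 := by
    have h8 : ((r + 1) * 4 * 2 ^ (r + 1) * t : ℝ≥0) = 2⁻¹ := by
      rw [ht, mul_inv, mul_comm (2⁻¹ : ℝ≥0), ← mul_assoc, mul_inv_cancel₀ (by positivity), one_mul]
    have h9 : ((r : ℝ≥0∞) + 1) * 4 * 2 ^ (r + 1) * t * I = I / 2 := by
      calc ((r : ℝ≥0∞) + 1) * 4 * 2 ^ (r + 1) * t * I
          = (((r + 1) * 4 * 2 ^ (r + 1) * t : ℝ≥0) : ℝ≥0∞) * I := by push_cast; ring
        _ = I / 2 := by
          rw [h8, ENNReal.coe_inv (by norm_num), div_eq_mul_inv, mul_comm]; rfl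
    calc I ≤ (r + 1) * (4 * ((t * 2 ^ (r + 1)) * I +
          (t * 2 ^ (r + 1) * 4 ^ (r + 1) + (t⁻¹ : ℝ≥0) ^ r) * L)) := h1.trans (by gcongr)
      _ = (r + 1) * 4 * (t * 2 ^ (r + 1) * 4 ^ (r + 1) + (t⁻¹ : ℝ≥0) ^ r) * L +
          (r + 1) * 4 * 2 ^ (r + 1) * t * I := by ring
      _ = _ := by rw [h9]; push_cast; ring
  refine (ENNReal.le_two_mul_of_le_add_half hIfin h4).trans (le_of_eq ?_)
  push_cast
  ring

section Differences

variable {X : Type*} {m0 : MeasurableSpace X} {ν : Measure X} {𝒢 : Filtration ℕ m0}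
  {f : ℕ → X → ℝ} {l : ℕ → X → ℝ≥0}

lemma nnnorm_sub_le_two_mul (hl : Monotone l) {x : X} (h0 : f 0 x = 0)
    (h : ∀ n, ‖f (n + 1) x‖₊ ≤ l n x) (n : ℕ) : ‖f (n + 1) x - f n x‖₊ ≤ 2 * l n x := by
  refine (nnnorm_sub_le _ _).trans ?_
  rw [two_mul]
  refine add_le_add (h n) ?_
  cases n with
  | zero => simp [h0]
  | succ n => exact (h n).trans (hl n.le_succ x)

lemma ae_sub_le (h0 : f 0 =ᵐ[ν] 0) (hl : Monotone l) (hB : ∀ n, ∃ B : ℝ≥0, ∀ᵐ x ∂ν, l n x ≤ B)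
    (h : ∀ n, ∀ᵐ x ∂ν, ‖f (n + 1) x‖₊ ≤ l n x) (n : ℕ) :
    ∃ B : ℝ≥0, ∀ᵐ x ∂ν, ‖f (n + 1) x - f n x‖₊ ≤ B := by
  obtain ⟨B, hB⟩ := hB n
  refine ⟨2 * B, ?_⟩
  filter_upwards [hB, h0, ae_all_iff.2 h] with x hx hx0 hx1
  exact (nnnorm_sub_le_two_mul hl hx0 hx1 n).trans (by gcongr)

lemma memLp_sub_of_ae_le [IsFiniteMeasure ν] (hf : Martingale f 𝒢 ν) {k : ℕ}
    (h : ∃ B : ℝ≥0, ∀ᵐ x ∂ν, ‖f (k + 1) x - f k x‖₊ ≤ B) :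
    MemLp (fun x => f (k + 1) x - f k x) 2 ν := by
  obtain ⟨B, hB⟩ := h
  exact MemLp.of_bound ((hf.integrable _).sub (hf.integrable _)).aestronglyMeasurable B
    (hB.mono fun x hx => by exact_mod_cast hx)

lemma measurable_sub (hf : Martingale f 𝒢 ν) (k : ℕ) :
    Measurable[𝒢 (k + 1)] fun x => f (k + 1) x - f k x :=
  ((hf.stronglyAdapted (k + 1)).sub
    (hf.stronglyAdapted.stronglyMeasurable_le k.le_succ)).measurable

end Differences

/-- Moments of the quadratic variation of a martingale with a bounded predictable majorant. -/
theorem lintegral_sum_sq_pow_le (r : ℕ) : ∃ A : ℝ≥0, ∀ (X : Type*) (m0 : MeasurableSpace X)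
    (ν : Measure X) [IsProbabilityMeasure ν] (𝒢 : Filtration ℕ m0) (f : ℕ → X → ℝ)
    (l : ℕ → X → ℝ≥0), Martingale f 𝒢 ν → f 0 =ᵐ[ν] 0 → Adapted 𝒢 l → Monotone l →
    (∀ n, ∃ B : ℝ≥0, ∀ᵐ x ∂ν, l n x ≤ B) → (∀ n, ∀ᵐ x ∂ν, ‖f (n + 1) x‖₊ ≤ l n x) →
    ∀ n, ∫⁻ x, (∑ k ∈ Finset.range (n + 1), ‖f (k + 1) x - f k x‖ₑ ^ 2) ^ (r + 1) ∂ν ≤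
      A * ∫⁻ x, (l n x : ℝ≥0∞) ^ (2 * (r + 1)) ∂ν := by
  obtain ⟨A, hA⟩ := lintegral_bracket_pow_le r
  refine ⟨A, fun X m0 ν _ 𝒢 f l hf h0 hlad hl hB h n => ?_⟩
  have hdB := ae_sub_le h0 hl hB h
  have hc2 : ∀ n x, (NNReal.sqrt (∑ k ∈ Finset.range n, ‖f (k + 1) x - f k x‖₊ ^ 2 +
      4 * l n x ^ 2) : ℝ≥0∞) ^ 2 = ∑ k ∈ Finset.range n, ‖f (k + 1) x - f k x‖ₑ ^ 2 +
      4 * (l n x : ℝ≥0∞) ^ 2 := fun n x => by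
    rw [← ENNReal.coe_pow, NNReal.sq_sqrt]
    push_cast
    rfl
  -- The last square `|d_{n+1}|²` is not known at time `n`, so it is replaced by its bound `4 λ_n²`,
  -- from `|d_{n+1}| ≤ 2 λ_n`.
  refine hA X m0 ν 𝒢 f l (fun n x => NNReal.sqrt (∑ k ∈ Finset.range n,
    ‖f (k + 1) x - f k x‖₊ ^ 2 + 4 * l n x ^ 2)) (fun k x => ‖f (k + 1) x - f k x‖ₑ ^ 2)
    hf h0 hlad hl h (fun k => ?_) (fun n => ?_) (fun a b hab x => ?_) (fun n => ?_) (fun n => ?_)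
    (fun n => ?_) (fun _ _ _ => rfl) (fun k => memLp_sub_of_ae_le hf (hdB k)) n
  · exact (((measurable_sub hf k).mono (𝒢.le _) le_rfl).enorm).pow_const 2
  · have hl2 : Measurable[𝒢 n] fun x => 4 * l n x ^ 2 := ((hlad n).pow_const 2).const_mul 4
    refine NNReal.continuous_sqrt.measurable.comp (Measurable.add (m := 𝒢 n) ?_ hl2)
    exact Finset.measurable_fun_sum _ fun k hk => (measurable_nnnorm.comp
      ((measurable_sub hf k).mono (𝒢.mono (Finset.mem_range.1 hk)) le_rfl)).pow_const 2
  · have := hl hab x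
    dsimp only
    rw [NNReal.sqrt_le_sqrt]
    gcongr
  · choose B hB using hB
    choose C hC using hdB
    refine ⟨NNReal.sqrt (∑ k ∈ Finset.range n, C k ^ 2 + 4 * B n ^ 2), ?_⟩
    filter_upwards [hB n, ae_all_iff.2 hC] with x hx hy
    rw [NNReal.sqrt_le_sqrt]
    gcongr with k _
    exact hy k
  · filter_upwards [h0, ae_all_iff.2 h] with x hx0 hx
    rw [hc2, Finset.sum_range_succ]
    have h1 := nnnorm_sub_le_two_mul hl hx0 hx n
    gcongr
    calc ‖f (n + 1) x - f n x‖ₑ ^ 2 ≤ (2 * (l n x : ℝ≥0∞)) ^ 2 := by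
          gcongr
          rw [enorm_eq_nnnorm]
          exact_mod_cast h1
      _ = _ := by ring
  · refine Filter.Eventually.of_forall fun x => ?_
    rw [hc2]
    gcongr
    omega

/-- Moments of the conditional quadratic variation of a martingale with a bounded predictable
majorant. -/
theorem lintegral_sum_condLExp_pow_le (r : ℕ) : ∃ A : ℝ≥0, ∀ (X : Type*) (m0 : MeasurableSpace X)
    (ν : Measure X) [IsProbabilityMeasure ν] (𝒢 : Filtration ℕ m0) (f : ℕ → X → ℝ)
    (l : ℕ → X → ℝ≥0), Martingale f 𝒢 ν → f 0 =ᵐ[ν] 0 → Adapted 𝒢 l → Monotone l →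
    (∀ n, ∃ B : ℝ≥0, ∀ᵐ x ∂ν, l n x ≤ B) → (∀ n, ∀ᵐ x ∂ν, ‖f (n + 1) x‖₊ ≤ l n x) →
    ∀ n, ∫⁻ x, (∑ k ∈ Finset.range (n + 1),
        condLExp (𝒢 k) ν (fun y => ‖f (k + 1) y - f k y‖ₑ ^ 2) x) ^ (r + 1) ∂ν ≤
      A * ∫⁻ x, (l n x : ℝ≥0∞) ^ (2 * (r + 1)) ∂ν := by
  obtain ⟨A, hA⟩ := lintegral_bracket_pow_le r
  refine ⟨A, fun X m0 ν _ 𝒢 f l hf h0 hlad hl hB h n => ?_⟩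
  have hdB := ae_sub_le h0 hl hB h
  set D : ℕ → X → ℝ≥0∞ := fun k => condLExp (𝒢 k) ν (fun y => ‖f (k + 1) y - f k y‖ₑ ^ 2) with hD
  have hDB : ∀ k, ∃ B : ℝ≥0, ∀ᵐ x ∂ν, D k x ≤ B := fun k => by
    obtain ⟨B, hB⟩ := hdB k
    refine ⟨B ^ 2, ?_⟩
    have h1 : D k ≤ᵐ[ν] condLExp (𝒢 k) ν (fun _ => ((B ^ 2 : ℝ≥0) : ℝ≥0∞)) := by
      refine condLExp_mono ?_
      filter_upwards [hB] with x hx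
      push_cast
      gcongr
      exact ENNReal.coe_le_coe.2 hx
    filter_upwards [h1] with x hx
    rwa [condLExp_const (𝒢.le k)] at hx
  have hc2 : ∀ n, ∀ᵐ x ∂ν, (NNReal.sqrt (∑ k ∈ Finset.range (n + 1), (D k x).toNNReal) :
      ℝ≥0∞) ^ 2 = ∑ k ∈ Finset.range (n + 1), D k x := fun n => by
    choose B hB using hDB
    filter_upwards [ae_all_iff.2 hB] with x hx
    rw [← ENNReal.coe_pow, NNReal.sq_sqrt]
    push_cast
    exact Finset.sum_congr rfl fun k _ =>
      ENNReal.coe_toNNReal (ne_top_of_le_ne_top ENNReal.coe_ne_top (hx k))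
  have hDm : ∀ k, Measurable[𝒢 k] (D k) := fun k => measurable_condLExp _ _ _
  -- Here the bracket is predictable, so its own square root serves as the control `c`; `toNNReal`
  -- changes nothing almost surely because each `D k` is almost surely bounded.
  refine hA X m0 ν 𝒢 f l (fun n x => NNReal.sqrt (∑ k ∈ Finset.range (n + 1), (D k x).toNNReal)) D
    hf h0 hlad hl h (fun k => (hDm k).mono (𝒢.le k) le_rfl) (fun n => ?_) (fun a b hab x => ?_)
    (fun n => ?_) (fun n => (hc2 n).mono fun x hx => hx.ge)
    (fun n => (hc2 n).mono fun x hx => hx.le.trans le_self_add) (fun k φ hφ => ?_)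
    (fun k => memLp_sub_of_ae_le hf (hdB k)) n
  · refine NNReal.continuous_sqrt.measurable.comp (Finset.measurable_fun_sum _ fun k hk => ?_)
    exact ((hDm k).mono (𝒢.mono (Nat.lt_succ_iff.1 (Finset.mem_range.1 hk))) le_rfl).ennreal_toNNReal
  · dsimp only
    rw [NNReal.sqrt_le_sqrt]
    exact Finset.sum_le_sum_of_subset (Finset.range_mono (by omega))
  · choose B hB using hDB
    refine ⟨NNReal.sqrt (∑ k ∈ Finset.range (n + 1), B k), ?_⟩
    filter_upwards [ae_all_iff.2 hB] with x hx
    rw [NNReal.sqrt_le_sqrt]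
    exact Finset.sum_le_sum fun k _ => by
      simpa using ENNReal.toNNReal_mono ENNReal.coe_ne_top (hx k)
  · exact lintegral_mul_condLExp (𝒢.le k) hφ
      ((((measurable_sub hf k).mono (𝒢.le _) le_rfl).enorm).pow_const 2)

section Roots

lemma ENNReal.rpow_half_le_iff {a b : ℝ≥0∞} : a ^ (1 / 2 : ℝ) ≤ b ↔ a ≤ b ^ 2 := by
  rw [one_div, ENNReal.rpow_inv_le_iff two_pos, ENNReal.rpow_two]

lemma ENNReal.le_rpow_half_iff {a b : ℝ≥0∞} : b ≤ a ^ (1 / 2 : ℝ) ↔ b ^ 2 ≤ a := by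
  rw [one_div, ENNReal.le_rpow_inv_iff two_pos, ENNReal.rpow_two]

lemma ENNReal.rpow_half_sq (a : ℝ≥0∞) : (a ^ (1 / 2 : ℝ)) ^ 2 = a :=
  le_antisymm (ENNReal.le_rpow_half_iff.1 le_rfl) (ENNReal.rpow_half_le_iff.1 le_rfl)

lemma ENNReal.iSup_pow_succ (u : ℕ → ℝ≥0∞) (r : ℕ) :
    (⨆ n, u n) ^ (r + 1) = ⨆ n, u n ^ (r + 1) := by
  have := (ENNReal.orderIsoRpow ((r + 1 : ℕ) : ℝ) (by positivity)).map_iSup u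
  simpa only [ENNReal.orderIsoRpow_apply, ENNReal.rpow_natCast] using this

lemma ENNReal.tsum_eq_iSup_sum_succ (D : ℕ → ℝ≥0∞) :
    ∑' k, D k = ⨆ n, ∑ k ∈ Finset.range (n + 1), D k :=
  ENNReal.tsum_eq_iSup_nat' (Filter.tendsto_add_atTop_nat 1)

end Roots

/-! ### Maximal and square functions compared with those of a transform. -/

section Operators

variable {X : Type*} {f : ℕ → X → ℝ} {w : ℕ → X → ℝ≥0}

lemma tsum_mdiff (x : X) : ∑' n, ‖mdiff f n x‖ₑ ^ 2 = ∑' n, ‖mdiff f (n + 1) x‖ₑ ^ 2 := by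
  rw [tsum_eq_zero_add' ENNReal.summable]
  simp [mdiff]

lemma quadVar_eq (x : X) : quadVar f x = (∑' n, ‖mdiff f (n + 1) x‖ₑ ^ 2) ^ (1 / 2 : ℝ) := by
  rw [quadVar, tsum_mdiff]

lemma quadVarUpTo_succ_le_iff {n : ℕ} {x : X} {a : ℝ≥0∞} : quadVarUpTo f (n + 1) x ≤ a ↔
    ∑ k ∈ Finset.range (n + 1), ‖mdiff f (k + 1) x‖ₑ ^ 2 ≤ a ^ 2 := by
  rw [quadVarUpTo, ENNReal.rpow_half_le_iff, Finset.sum_range_succ']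
  simp [mdiff]

lemma quadVar_eq_iSup (x : X) : quadVar f x = ⨆ n, quadVarUpTo f (n + 1) x := by
  refine le_antisymm ?_ (iSup_le fun n => ?_)
  · rw [quadVar_eq, ENNReal.rpow_half_le_iff, ENNReal.tsum_eq_iSup_sum_succ]
    refine iSup_le fun n => quadVarUpTo_succ_le_iff.1 ?_
    exact le_iSup (fun n => quadVarUpTo f (n + 1) x) n
  · rw [quadVarUpTo, quadVar]
    gcongr
    exact ENNReal.sum_le_tsum _

lemma enorm_sq_mdiff_mtransform (n : ℕ) (x : X) :
    ‖mdiff (mtransform (fun n x => (w n x : ℝ)) f) (n + 1) x‖ₑ ^ 2 =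
      (w n x : ℝ≥0∞) ^ 2 * ‖mdiff f (n + 1) x‖ₑ ^ 2 := by
  rw [mdiff_mtransform_succ, enorm_mul, mul_pow, NNReal.enorm_eq]

/-- Termwise comparison; the factor `2` is superfluous here and only matches the form required by
`TransformClosed`, where the maximal function uses it. -/
lemma tsum_rpow_half_le_of_weighted {D : ℕ → ℝ≥0∞} {v : ℕ → ℝ≥0} {W : ℝ≥0}
    (hW : ∀ n, 1 ≤ W * v n) :
    (∑' n, D n) ^ (1 / 2 : ℝ) ≤ 2 * W * (∑' n, (v n : ℝ≥0∞) ^ 2 * D n) ^ (1 / 2 : ℝ) := by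
  rw [ENNReal.rpow_half_le_iff, mul_pow, ENNReal.rpow_half_sq, ← ENNReal.tsum_mul_left]
  refine ENNReal.tsum_le_tsum fun n => ?_
  have h1 : (1 : ℝ≥0∞) ≤ W * v n := by exact_mod_cast hW n
  calc D n ≤ 1 ^ 2 * 1 ^ 2 * D n := by simp
    _ ≤ 2 ^ 2 * (W * v n) ^ 2 * D n := by gcongr; norm_num
    _ = _ := by ring

lemma quadVar_le_mtransform (x : X) {W : ℝ≥0}
    (h : ∀ n, 1 ≤ W * w n x) :
    quadVar f x ≤ 2 * W * quadVar (mtransform (fun n x => (w n x : ℝ)) f) x := by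
  rw [quadVar_eq, quadVar_eq]
  simp_rw [enorm_sq_mdiff_mtransform]
  exact tsum_rpow_half_le_of_weighted h

lemma maximal_le_mtransform (hwa : Antitone w) {x : X} (h0 : f 0 x = 0) {W : ℝ≥0}
    (h : ∀ n, 1 ≤ W * w n x) :
    maximal f x ≤ 2 * W * maximal (mtransform (fun n x => (w n x : ℝ)) f) x := by
  rcases eq_or_ne (maximal (mtransform (fun n x => (w n x : ℝ)) f) x) ∞ with ht | ht
  · have hW : W ≠ 0 := by
      rintro rfl
      simpa using h 0
    rw [ht, ENNReal.mul_top (by simpa using hW)]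
    exact le_top
  · lift maximal (mtransform (fun n x => (w n x : ℝ)) f) x to ℝ≥0 using ht with B hB
    refine iSup_le fun n => ?_
    have h1 := abs_sub_le_two_mul_of_weighted (f := fun n => f n x) (w := fun n => w n x)
      (fun a b hab => hwa hab x) h (B := B) (fun n => by
        have : ‖mtransform (fun n x => (w n x : ℝ)) f n x‖ₑ ≤ B := by
          rw [hB]
          exact le_iSup (fun n => ‖mtransform (fun n x => (w n x : ℝ)) f n x‖ₑ) n
        rw [enorm_eq_nnnorm] at this
        exact_mod_cast this) n
    simp only [h0, sub_zero] at h1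
    rw [enorm_eq_nnnorm]
    exact_mod_cast h1

end Operators

/-! ### Controls of a transform: closure of the three families under decreasing weights. -/

section Closure

variable {d : ℕ} {Ω : Fin d → Type*} [mΩ : ∀ i, MeasurableSpace (Ω i)]
  {μ : ∀ i, Measure (Ω i)} {ℱ : ∀ i, Filtration ℕ (mΩ i)}
  {f : ℕ → (∀ i, Ω i) → ℝ} {l w : ℕ → (∀ i, Ω i) → ℝ≥0}

/-- The sequences in `Λ` controlling the partial sums of the conditional quadratic variation. -/
def controlsCond (μ : ∀ i, Measure (Ω i)) (ℱ : ∀ i, Filtration ℕ (mΩ i))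
    (f : ℕ → (∀ i, Ω i) → ℝ) : Set (ℕ → (∀ i, Ω i) → ℝ≥0) :=
  {l | l ∈ controls ℱ ∧ ∀ n, ∀ᵐ x ∂(Measure.pi μ), ∑ k ∈ Finset.range (n + 1),
    condLExp (prodFiltration ℱ k) (Measure.pi μ) (fun y => ‖mdiff f (k + 1) y‖ₑ ^ 2) x ≤
      (l n x : ℝ≥0∞) ^ 2}

lemma measurable_mdiff_succ (hf : f ∈ martingales μ ℱ) (n : ℕ) : Measurable (mdiff f (n + 1)) :=
  (measurable_sub hf.1 n).mono ((prodFiltration ℱ).le _) le_rfl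

lemma measurable_maximal (hf : f ∈ martingales μ ℱ) : Measurable (maximal f) := by
  unfold maximal
  exact Measurable.iSup fun n => (((hf.1.stronglyAdapted n).mono ((prodFiltration ℱ).le n)).measurable).enorm

lemma measurable_quadVar (hf : f ∈ martingales μ ℱ) : Measurable (quadVar f) := by
  have : quadVar f = fun x => (∑' n, ‖mdiff f (n + 1) x‖ₑ ^ 2) ^ (1 / 2 : ℝ) :=
    funext fun x => quadVar_eq x
  rw [this]
  exact (Measurable.tsum fun n =>
    ((measurable_mdiff_succ hf n).enorm).pow_const 2).pow_const _

lemma measurable_condQuadVar (f : ℕ → (∀ i, Ω i) → ℝ) : Measurable (condQuadVar μ ℱ f) := by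
  unfold condQuadVar
  exact (Measurable.tsum fun n => measurable_condLExp' _ _ _).pow_const _

lemma ctrlTransform_mem_controls (hl : l ∈ controls ℱ) (hw : Adapted (prodFiltration ℱ) w) :
    (fun n x => ctrlTransform (fun k => l k x) (fun k => w k x) n) ∈ controls ℱ :=
  ⟨adapted_ctrlTransform hl.1 hw, fun _ _ hab _ => ctrlTransform_mono hab⟩

lemma ctrlTransform_mem_controlsP (hf : f ∈ martingales μ ℱ) (hl : l ∈ controlsP μ ℱ f)
    (hw : Adapted (prodFiltration ℱ) w) (hwa : Antitone w) :
    (fun n x => ctrlTransform (fun k => l k x) (fun k => w k x) n) ∈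
      controlsP μ ℱ (mtransform (fun n x => (w n x : ℝ)) f) := by
  refine ⟨ctrlTransform_mem_controls hl.1 hw, fun n => ?_⟩
  filter_upwards [hf.2, ae_all_iff.2 hl.2] with x h0 h
  have h1 := abs_sum_mul_sub_le_ctrlTransform (l := fun k => l k x) (w := fun k => w k x)
    (f := fun k => f k x) (fun a b hab => hl.1.2 hab x) (fun a b hab => hwa hab x) h0
    (fun n => by
      have := h n
      rw [enorm_eq_nnnorm] at this
      exact_mod_cast this) n
  rw [enorm_eq_nnnorm]
  exact_mod_cast h1

lemma ctrlTransform_mem_controlsQ (hl : l ∈ controlsQ μ ℱ f)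
    (hw : Adapted (prodFiltration ℱ) w) (hwa : Antitone w) :
    (fun n x => ctrlTransform (fun k => l k x) (fun k => w k x) n) ∈
      controlsQ μ ℱ (mtransform (fun n x => (w n x : ℝ)) f) := by
  refine ⟨ctrlTransform_mem_controls hl.1 hw, fun n => ?_⟩
  filter_upwards [ae_all_iff.2 hl.2] with x h
  rw [quadVarUpTo_succ_le_iff]
  simp_rw [enorm_sq_mdiff_mtransform]
  exact sum_sq_mul_le_ctrlTransform (fun a b hab => hl.1.2 hab x) (fun a b hab => hwa hab x)
    (fun n => quadVarUpTo_succ_le_iff.1 (h n)) n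

variable [∀ i, IsProbabilityMeasure (μ i)]

lemma mtransform_mem_martingales (hf : f ∈ martingales μ ℱ) (hw : Adapted (prodFiltration ℱ) w)
    {B : ℝ≥0} (hB : ∀ n x, w n x ≤ B) :
    mtransform (fun n x => (w n x : ℝ)) f ∈ martingales μ ℱ := by
  have hws : StronglyAdapted (prodFiltration ℱ) fun n x => (w n x : ℝ) := fun n =>
    (hw n).coe_nnreal_real.stronglyMeasurable
  refine ⟨martingale_mtransform hf.1 hws (integrable_mul_sub_of_bound hf.1 hws (B := B) ?_),
    Filter.Eventually.of_forall fun x => by simp [mtransform]⟩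
  intro n x
  rw [NNReal.abs_eq]
  exact hB n x

lemma condLExp_mdiff_mtransform (hf : f ∈ martingales μ ℱ) (hw : Adapted (prodFiltration ℱ) w)
    (n : ℕ) :
    condLExp (prodFiltration ℱ n) (Measure.pi μ)
      (fun y => ‖mdiff (mtransform (fun n x => (w n x : ℝ)) f) (n + 1) y‖ₑ ^ 2)
      =ᵐ[Measure.pi μ] fun x => (w n x : ℝ≥0∞) ^ 2 *
        condLExp (prodFiltration ℱ n) (Measure.pi μ) (fun y => ‖mdiff f (n + 1) y‖ₑ ^ 2) x := by
  simp_rw [enorm_sq_mdiff_mtransform]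
  exact condLExp_mul_left ((prodFiltration ℱ).le n) ((hw n).coe_nnreal_ennreal.pow_const 2)
    (((measurable_mdiff_succ hf n).enorm).pow_const 2)

lemma ctrlTransform_mem_controlsCond (hf : f ∈ martingales μ ℱ) (hl : l ∈ controlsCond μ ℱ f)
    (hw : Adapted (prodFiltration ℱ) w) (hwa : Antitone w) :
    (fun n x => ctrlTransform (fun k => l k x) (fun k => w k x) n) ∈
      controlsCond μ ℱ (mtransform (fun n x => (w n x : ℝ)) f) := by
  refine ⟨ctrlTransform_mem_controls hl.1 hw, fun n => ?_⟩
  filter_upwards [ae_all_iff.2 hl.2, ae_all_iff.2 (condLExp_mdiff_mtransform hf hw)] with x h h'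
  simp_rw [h']
  exact sum_sq_mul_le_ctrlTransform (fun a b hab => hl.1.2 hab x) (fun a b hab => hwa hab x) h n

lemma condQuadVar_le_mtransform (hf : f ∈ martingales μ ℱ) (hw : Adapted (prodFiltration ℱ) w) :
    ∀ᵐ x ∂Measure.pi μ, ∀ W : ℝ≥0, (∀ n, 1 ≤ W * w n x) →
      condQuadVar μ ℱ f x ≤
        2 * W * condQuadVar μ ℱ (mtransform (fun n x => (w n x : ℝ)) f) x := by
  filter_upwards [ae_all_iff.2 (condLExp_mdiff_mtransform hf hw)] with x h' W hW
  rw [condQuadVar, condQuadVar]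
  simp_rw [h']
  exact tsum_rpow_half_le_of_weighted hW

end Closure

/-! ### Verification of `TransformClosed` for the pairs of an operator and a control. -/

section BaseEstimates

variable {d : ℕ} {Ω : Fin d → Type*} [mΩ : ∀ i, MeasurableSpace (Ω i)]
  {μ : ∀ i, Measure (Ω i)} {ℱ : ∀ i, Filtration ℕ (mΩ i)}
  {f : ℕ → (∀ i, Ω i) → ℝ} {l l' : ℕ → (∀ i, Ω i) → ℝ≥0}

lemma lintegral_rpow_le_of_iSup {X : Type*} {m0 : MeasurableSpace X} {ν : Measure X} {Q : ℝ}
    (hQ : 0 ≤ Q) {T : X → ℝ≥0∞} {V : ℕ → X → ℝ≥0∞} (hVm : ∀ n, Measurable (V n)) (hV : Monotone V)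
    (hT : ∀ x, T x ^ Q = ⨆ n, V n x) {A : ℝ≥0} {l : ℕ → X → ℝ≥0}
    (h : ∀ n, ∫⁻ x, V n x ∂ν ≤ A * ∫⁻ x, (l n x : ℝ≥0∞) ^ Q ∂ν) :
    ∫⁻ x, T x ^ Q ∂ν ≤ A * ∫⁻ x, controlLim l x ^ Q ∂ν := by
  simp_rw [hT]
  rw [lintegral_iSup hVm hV]
  refine iSup_le fun n => (h n).trans ?_
  gcongr with x
  exact le_iSup (fun n => (l n x : ℝ≥0∞)) n

lemma controlsP_mono (hl : l ∈ controlsP μ ℱ f) (hl' : l' ∈ controls ℱ)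
    (h : ∀ n x, l n x ≤ l' n x) : l' ∈ controlsP μ ℱ f :=
  ⟨hl', fun n => (hl.2 n).mono fun x hx => hx.trans (ENNReal.coe_le_coe.2 (h n x))⟩

lemma controlsQ_mono (hl : l ∈ controlsQ μ ℱ f) (hl' : l' ∈ controls ℱ)
    (h : ∀ n x, l n x ≤ l' n x) : l' ∈ controlsQ μ ℱ f :=
  ⟨hl', fun n => (hl.2 n).mono fun x hx => hx.trans (ENNReal.coe_le_coe.2 (h n x))⟩

lemma controlsCond_mono (hl : l ∈ controlsCond μ ℱ f) (hl' : l' ∈ controls ℱ)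
    (h : ∀ n x, l n x ≤ l' n x) : l' ∈ controlsCond μ ℱ f :=
  ⟨hl', fun n => (hl.2 n).mono fun x hx => hx.trans (by gcongr; exact h n x)⟩

lemma nnnorm_le_of_mem_controlsP (hl : l ∈ controlsP μ ℱ f) (n : ℕ) :
    ∀ᵐ x ∂Measure.pi μ, ‖f (n + 1) x‖₊ ≤ l n x :=
  (hl.2 n).mono fun x hx => by
    rw [enorm_eq_nnnorm] at hx
    exact_mod_cast hx

lemma sum_sq_le_of_mem_controlsQ (hl : l ∈ controlsQ μ ℱ f) (n : ℕ) :
    ∀ᵐ x ∂Measure.pi μ, ∑ k ∈ Finset.range (n + 1), ‖f (k + 1) x - f k x‖₊ ^ 2 ≤ l n x ^ 2 :=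
  (hl.2 n).mono fun x hx => by
    have h1 := quadVarUpTo_succ_le_iff.1 hx
    simp only [mdiff, Pi.sub_apply, enorm_eq_nnnorm] at h1
    exact_mod_cast h1

lemma tsum_rpow_half_rpow (D : ℕ → ℝ≥0∞) (r : ℕ) :
    ((∑' k, D k) ^ (1 / 2 : ℝ)) ^ ((2 * (r + 1) : ℕ) : ℝ) =
      ⨆ n, (∑ k ∈ Finset.range (n + 1), D k) ^ (r + 1) := by
  rw [ENNReal.rpow_natCast, pow_mul, ENNReal.rpow_half_sq, ENNReal.tsum_eq_iSup_sum_succ,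
    ENNReal.iSup_pow_succ]

variable [∀ i, IsProbabilityMeasure (μ i)]

lemma tsum_lintegral_le_of_mem_controlsCond (hf : f ∈ martingales μ ℱ)
    (hl : l ∈ controlsCond μ ℱ f) :
    ∑' n, ∫⁻ x, ‖mdiff f (n + 1) x‖ₑ ^ 2 ∂Measure.pi μ ≤
      ∫⁻ x, controlLim l x ^ 2 ∂Measure.pi μ := by
  have h1 : ∀ n, ∫⁻ x, ‖mdiff f (n + 1) x‖ₑ ^ 2 ∂Measure.pi μ =
      ∫⁻ x, condLExp (prodFiltration ℱ n) (Measure.pi μ)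
        (fun y => ‖mdiff f (n + 1) y‖ₑ ^ 2) x ∂Measure.pi μ := fun n => by
    have := lintegral_mul_condLExp (ν := Measure.pi μ) ((prodFiltration ℱ).le n) (φ := fun _ => 1)
      measurable_const (((measurable_mdiff_succ hf n).enorm).pow_const 2)
    simpa using this.symm
  simp_rw [h1]
  rw [← lintegral_tsum fun n => (measurable_condLExp' _ _ _).aemeasurable]
  refine lintegral_mono_ae ?_
  filter_upwards [ae_all_iff.2 hl.2] with x hx
  rw [ENNReal.tsum_eq_iSup_sum_succ]
  refine iSup_le fun n => (hx n).trans ?_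
  gcongr
  exact le_iSup (fun n => (l n x : ℝ≥0∞)) n

/-- The abstract transform is realised by the martingale transform of `f` with the same weights, so
it remains to compare the operators, transform the controls, and supply an `L_Q` estimate for
bounded controls. -/
lemma TransformClosed.of_martingales {Q : ℝ} {A : ℝ≥0}
    {Op : (ℕ → (∀ i, Ω i) → ℝ) → (∀ i, Ω i) → ℝ≥0∞}
    {Ctrl : (ℕ → (∀ i, Ω i) → ℝ) → Set (ℕ → (∀ i, Ω i) → ℝ≥0)}
    (hm : ∀ f ∈ martingales μ ℱ, Measurable (Op f)) (hc : ∀ f, Ctrl f ⊆ controls ℱ)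
    (he : ∀ f l l', l ∈ Ctrl f → l' ∈ controls ℱ → (∀ n x, l n x ≤ l' n x) → l' ∈ Ctrl f)
    (hCtrl : ∀ f ∈ martingales μ ℱ, ∀ l ∈ Ctrl f, ∀ w : ℕ → (∀ i, Ω i) → ℝ≥0,
      Adapted (prodFiltration ℱ) w → Antitone w →
      (fun n x => ctrlTransform (fun k => l k x) (fun k => w k x) n) ∈
        Ctrl (mtransform (fun n x => (w n x : ℝ)) f))
    (hOp : ∀ f ∈ martingales μ ℱ, ∀ w : ℕ → (∀ i, Ω i) → ℝ≥0,
      Adapted (prodFiltration ℱ) w → Antitone w →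
      ∀ᵐ x ∂Measure.pi μ, ∀ W : ℝ≥0, (∀ n, 1 ≤ W * w n x) →
        Op f x ≤ 2 * W * Op (mtransform (fun n x => (w n x : ℝ)) f) x)
    (hb : ∀ f ∈ martingales μ ℱ, ∀ l ∈ Ctrl f, ∀ K : ℝ≥0, (∀ n x, l n x ≤ K) →
      ∫⁻ x, Op f x ^ Q ∂Measure.pi μ ≤ A * ∫⁻ x, controlLim l x ^ Q ∂Measure.pi μ) :
    TransformClosed μ ℱ Q A fun T l => ∃ f ∈ martingales μ ℱ, l ∈ Ctrl f ∧ T = Op f where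
  measurable := by
    rintro T l ⟨f, hf, -, rfl⟩
    exact hm f hf
  control := by
    rintro T l ⟨f, -, hl, -⟩
    exact hc f hl
  enlarge := by
    rintro T l l' ⟨f, hf, hl, rfl⟩ hl' h
    exact ⟨f, hf, he f l l' hl hl' h, rfl⟩
  transform := by
    rintro T l w ⟨f, hf, hl, rfl⟩ hw hwa ⟨B, hB⟩
    exact ⟨_, ⟨_, mtransform_mem_martingales hf hw hB, hCtrl f hf l hl w hw hwa, rfl⟩,
      hOp f hf w hw hwa⟩
  base := by
    rintro T l ⟨f, hf, hl, rfl⟩ η K - - hK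
    exact hb f hf l hl K hK

lemma transformClosed_maximal_controlsCond :
    TransformClosed μ ℱ 2 4 fun T l => ∃ f ∈ martingales μ ℱ, l ∈ controlsCond μ ℱ f ∧
      T = maximal f := by
  refine .of_martingales (fun f hf => measurable_maximal hf) (fun f l hl => hl.1)
    (fun f l l' => controlsCond_mono)
    (fun f hf l hl w hw hwa => ctrlTransform_mem_controlsCond hf hl hw hwa)
    (fun f hf w hw hwa => hf.2.mono fun x h0 W h => maximal_le_mtransform hwa h0 h)
    fun f hf l hl _ _ => ?_
  simp_rw [ENNReal.rpow_two]
  refine (lintegral_maximal_sq_le hf.1 hf.2).trans ?_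
  push_cast
  gcongr
  exact tsum_lintegral_le_of_mem_controlsCond hf hl

lemma transformClosed_quadVar_controlsCond :
    TransformClosed μ ℱ 2 1 fun T l => ∃ f ∈ martingales μ ℱ, l ∈ controlsCond μ ℱ f ∧
      T = quadVar f := by
  refine .of_martingales (fun f hf => measurable_quadVar hf) (fun f l hl => hl.1)
    (fun f l l' => controlsCond_mono)
    (fun f hf l hl w hw hwa => ctrlTransform_mem_controlsCond hf hl hw hwa)
    (fun f hf w hw hwa => Filter.Eventually.of_forall fun x W h => quadVar_le_mtransform x h)
    fun f hf l hl _ _ => ?_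
  simp_rw [ENNReal.rpow_two, quadVar_eq, ENNReal.rpow_half_sq]
  rw [lintegral_tsum fun n => (((measurable_mdiff_succ hf n).enorm).pow_const 2).aemeasurable,
    ENNReal.coe_one, one_mul]
  exact tsum_lintegral_le_of_mem_controlsCond hf hl

end BaseEstimates

section BaseMoments

/-- The parameter `j` lets the exponent exceed all `p i`. Powers of two suffice, and they are what
the doubling induction provides; monotone convergence removes the restriction to finite `n`. -/
lemma exists_transformClosed_maximal_controlsQ (d j : ℕ) : ∃ A : ℝ≥0, ∀ (Ω : Fin d → Type*)
    [mΩ : ∀ i, MeasurableSpace (Ω i)] (μ : ∀ i, Measure (Ω i)) [∀ i, IsProbabilityMeasure (μ i)]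
    (ℱ : ∀ i, Filtration ℕ (mΩ i)),
    TransformClosed μ ℱ ((2 ^ (j + 1) : ℕ) : ℝ) A fun T l => ∃ f ∈ martingales μ ℱ,
      l ∈ controlsQ μ ℱ f ∧ T = maximal f := by
  obtain ⟨A, hA⟩ := lintegral_runMax_pow_le j
  refine ⟨A, fun Ω mΩ μ _ ℱ => .of_martingales (fun f hf => measurable_maximal hf)
    (fun f l hl => hl.1) (fun f l l' => controlsQ_mono)
    (fun f hf l hl w hw hwa => ctrlTransform_mem_controlsQ hl hw hwa)
    (fun f hf w hw hwa => hf.2.mono fun x h0 W h => maximal_le_mtransform hwa h0 h)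
    fun f hf l hl K hK => ?_⟩
  obtain ⟨m, hm⟩ : ∃ m, 2 ^ (j + 1) = m + 1 := Nat.exists_eq_succ_of_ne_zero (by positivity)
  refine lintegral_rpow_le_of_iSup (Nat.cast_nonneg _)
    (V := fun n x => (runMax f n x : ℝ≥0∞) ^ 2 ^ (j + 1)) (fun n => ?_) (fun a b hab x => ?_)
    (fun x => ?_) fun n => ?_
  · exact ((adapted_runMax hf.1.stronglyAdapted).measurable
      (i := n)).coe_nnreal_ennreal.pow_const _
  · exact pow_le_pow_left₀ zero_le (ENNReal.coe_le_coe.2 (runMax_mono hab x)) _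
  · rw [ENNReal.rpow_natCast, maximal_eq_iSup_runMax, hm, ENNReal.iSup_pow_succ]
  · simp_rw [ENNReal.rpow_natCast]
    exact hA _ _ _ _ f l hf.1 hf.2 hl.1.1 hl.1.2
      (fun n => ⟨K, Filter.Eventually.of_forall fun x => hK n x⟩) (sum_sq_le_of_mem_controlsQ hl) n

lemma exists_transformClosed_quadVar_controlsP (d r : ℕ) : ∃ A : ℝ≥0, ∀ (Ω : Fin d → Type*)
    [mΩ : ∀ i, MeasurableSpace (Ω i)] (μ : ∀ i, Measure (Ω i)) [∀ i, IsProbabilityMeasure (μ i)]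
    (ℱ : ∀ i, Filtration ℕ (mΩ i)),
    TransformClosed μ ℱ ((2 * (r + 1) : ℕ) : ℝ) A fun T l => ∃ f ∈ martingales μ ℱ,
      l ∈ controlsP μ ℱ f ∧ T = quadVar f := by
  obtain ⟨A, hA⟩ := lintegral_sum_sq_pow_le r
  refine ⟨A, fun Ω mΩ μ _ ℱ => .of_martingales (fun f hf => measurable_quadVar hf)
    (fun f l hl => hl.1) (fun f l l' => controlsP_mono)
    (fun f hf l hl w hw hwa => ctrlTransform_mem_controlsP hf hl hw hwa)
    (fun f hf w hw hwa => Filter.Eventually.of_forall fun x W h => quadVar_le_mtransform x h)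
    fun f hf l hl K hK => ?_⟩
  refine lintegral_rpow_le_of_iSup (Nat.cast_nonneg _)
    (V := fun n x => (∑ k ∈ Finset.range (n + 1), ‖mdiff f (k + 1) x‖ₑ ^ 2) ^ (r + 1))
    (fun n => ?_) (fun a b hab x => ?_) (fun x => ?_) fun n => ?_
  · exact (Finset.measurable_fun_sum _ fun k _ =>
      ((measurable_mdiff_succ hf k).enorm).pow_const 2).pow_const _
  · exact pow_le_pow_left₀ zero_le
      (Finset.sum_le_sum_of_subset (Finset.range_mono (by omega))) _
  · rw [quadVar_eq, tsum_rpow_half_rpow]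
  · simp_rw [ENNReal.rpow_natCast]
    exact hA _ _ _ _ f l hf.1 hf.2 hl.1.1 hl.1.2
      (fun n => ⟨K, Filter.Eventually.of_forall fun x => hK n x⟩) (nnnorm_le_of_mem_controlsP hl) n

lemma exists_transformClosed_condQuadVar_controlsP (d r : ℕ) : ∃ A : ℝ≥0, ∀ (Ω : Fin d → Type*)
    [mΩ : ∀ i, MeasurableSpace (Ω i)] (μ : ∀ i, Measure (Ω i)) [∀ i, IsProbabilityMeasure (μ i)]
    (ℱ : ∀ i, Filtration ℕ (mΩ i)),
    TransformClosed μ ℱ ((2 * (r + 1) : ℕ) : ℝ) A fun T l => ∃ f ∈ martingales μ ℱ,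
      l ∈ controlsP μ ℱ f ∧ T = condQuadVar μ ℱ f := by
  obtain ⟨A, hA⟩ := lintegral_sum_condLExp_pow_le r
  refine ⟨A, fun Ω mΩ μ _ ℱ => .of_martingales (fun f hf => measurable_condQuadVar f)
    (fun f l hl => hl.1) (fun f l l' => controlsP_mono)
    (fun f hf l hl w hw hwa => ctrlTransform_mem_controlsP hf hl hw hwa)
    (fun f hf w hw hwa => condQuadVar_le_mtransform hf hw)
    fun f hf l hl K hK => ?_⟩
  refine lintegral_rpow_le_of_iSup (Nat.cast_nonneg _)
    (V := fun n x => (∑ k ∈ Finset.range (n + 1), condLExp (prodFiltration ℱ k) (Measure.pi μ)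
      (fun y => ‖mdiff f (k + 1) y‖ₑ ^ 2) x) ^ (r + 1))
    (fun n => ?_) (fun a b hab x => ?_) (fun x => ?_) fun n => ?_
  · exact (Finset.measurable_fun_sum _ fun k _ => measurable_condLExp' _ _ _).pow_const _
  · exact pow_le_pow_left₀ zero_le
      (Finset.sum_le_sum_of_subset (Finset.range_mono (by omega))) _
  · rw [condQuadVar, tsum_rpow_half_rpow]
  · simp_rw [ENNReal.rpow_natCast]
    exact hA _ _ _ _ f l hf.1 hf.2 hl.1.1 hl.1.2
      (fun n => ⟨K, Filter.Eventually.of_forall fun x => hK n x⟩) (nnnorm_le_of_mem_controlsP hl) n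

end BaseMoments

/-- The quasi-triangle inequality of the mixed quasi-norm. -/
lemma mixedNorm_add_le_quasi {d : ℕ} {p : Fin d → ℝ≥0∞} (hp0 : ∀ i, 0 < p i)
    (hp : ∀ i, p i < ∞) : ∃ C : ℝ≥0, 1 ≤ C ∧ ∀ (Ω : Fin d → Type*)
    [∀ i, MeasurableSpace (Ω i)] (μ : ∀ i, Measure (Ω i)) [∀ i, IsProbabilityMeasure (μ i)]
    (f g : (∀ i, Ω i) → ℝ≥0∞), Measurable f → Measurable g →
    mixedNorm μ p (fun x => f x + g x) ≤ C * (mixedNorm μ p f + mixedNorm μ p g) := by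
  obtain ⟨C, hC1, hC⟩ := iterNorm_add_le_quasi (fun i => (p i).toReal) (List.finRange d)
    fun i _ => ENNReal.toReal_pos (hp0 i).ne' (hp i).ne
  refine ⟨C, hC1, fun Ω _ μ _ f g hf hg => ?_⟩
  have hne : ∀ i, Nonempty (Ω i) := fun i => (μ i).nonempty_of_neZero
  let x : ∀ i, Ω i := fun i => (hne i).some
  rw [mixedNorm_eq_iterNorm μ hp0 hp _ x, mixedNorm_eq_iterNorm μ hp0 hp _ x,
    mixedNorm_eq_iterNorm μ hp0 hp _ x]
  exact hC Ω μ f g hf hg x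

/-! ### Explicit predictable controls, and the passage between the two predictable spaces. -/

section Controls

variable {d : ℕ} {Ω : Fin d → Type*} [mΩ : ∀ i, MeasurableSpace (Ω i)]
  {μ : ∀ i, Measure (Ω i)} {ℱ : ∀ i, Filtration ℕ (mΩ i)}
  {f : ℕ → (∀ i, Ω i) → ℝ} {l : ℕ → (∀ i, Ω i) → ℝ≥0}

lemma measurable_controlLim (hl : l ∈ controls ℱ) : Measurable (controlLim l) := by
  unfold controlLim
  exact Measurable.iSup fun n => (hl.1.measurable (i := n)).coe_nnreal_ennreal

lemma maximal_le_controlLim (hf : f ∈ martingales μ ℱ) (hl : l ∈ controlsP μ ℱ f) :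
    ∀ᵐ x ∂Measure.pi μ, maximal f x ≤ controlLim l x := by
  filter_upwards [hf.2, ae_all_iff.2 hl.2] with x h0 h
  refine iSup_le fun n => ?_
  cases n with
  | zero => simp [h0]
  | succ n => exact (h n).trans (le_iSup (fun n => (l n x : ℝ≥0∞)) n)

lemma quadVar_le_controlLim (hl : l ∈ controlsQ μ ℱ f) :
    ∀ᵐ x ∂Measure.pi μ, quadVar f x ≤ controlLim l x := by
  filter_upwards [ae_all_iff.2 hl.2] with x h
  rw [quadVar_eq_iSup]
  exact iSup_le fun n => (h n).trans (le_iSup (fun n => (l n x : ℝ≥0∞)) n)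

/-- A predictable bound on `S_{n+1}(f)` bounds the next jump, so `|f_{n+1}| ≤ λ_n + |f_n|`. The
increasing majorant of `|f_n|` costs `M(f)` in the limit, which the estimate of `M(f)` by `λ_∞` pays
for. -/
lemma add_runMax_mem_controlsP (hf : f ∈ martingales μ ℱ) (hl : l ∈ controlsQ μ ℱ f) :
    (fun n x => l n x + runMax f n x) ∈ controlsP μ ℱ f := by
  refine ⟨⟨fun n => (hl.1.1 n).add (adapted_runMax hf.1.stronglyAdapted n),
    fun a b hab x => add_le_add (hl.1.2 hab x) (runMax_mono hab x)⟩, fun n => ?_⟩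
  filter_upwards [sum_sq_le_of_mem_controlsQ hl n] with x hx
  have h1 : ‖f (n + 1) x - f n x‖₊ ≤ l n x := by
    refine (pow_le_pow_iff_left₀ zero_le zero_le two_ne_zero).1 ?_
    exact (Finset.single_le_sum (f := fun k => ‖f (k + 1) x - f k x‖₊ ^ 2)
      (fun _ _ => zero_le) (by simp)).trans hx
  rw [enorm_eq_nnnorm, ENNReal.coe_le_coe]
  calc ‖f (n + 1) x‖₊ = ‖(f (n + 1) x - f n x) + f n x‖₊ := by congr 1; ring
    _ ≤ ‖f (n + 1) x - f n x‖₊ + ‖f n x‖₊ := nnnorm_add_le _ _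
    _ ≤ _ := add_le_add h1 (nnnorm_le_runMax le_rfl)

lemma controlLim_add_le {X : Type*} (a b : ℕ → X → ℝ≥0) (x : X) :
    controlLim (fun n x => a n x + b n x) x ≤ controlLim a x + controlLim b x :=
  iSup_le fun n => by
    push_cast
    exact add_le_add (le_iSup (fun n => (a n x : ℝ≥0∞)) n) (le_iSup (fun n => (b n x : ℝ≥0∞)) n)

/-- The square root of the sum `∑_{k < n} |f_{k+1} - f_k|²`. -/
def sqFun {X : Type*} (f : ℕ → X → ℝ) (n : ℕ) (x : X) : ℝ≥0 :=
  NNReal.sqrt (∑ k ∈ Finset.range n, ‖f (k + 1) x - f k x‖₊ ^ 2)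

lemma controlLim_sqFun_le {X : Type*} (f : ℕ → X → ℝ) (x : X) : controlLim (sqFun f) x ≤ quadVar f x := by
  refine iSup_le fun n => ?_
  rw [quadVar_eq, ENNReal.le_rpow_half_iff, ← ENNReal.coe_pow, sqFun, NNReal.sq_sqrt]
  push_cast
  exact ENNReal.sum_le_tsum (f := fun k => ‖mdiff f (k + 1) x‖ₑ ^ 2) _

/-- The next jump is at most `2 λ_n`, so `S_{n+1}(f) ≤ 2 λ_n + S_n(f)`; `l` is written twice as a
sum so that the quasi-triangle inequality applies directly. -/
lemma add_sqFun_mem_controlsQ (hf : f ∈ martingales μ ℱ) (hl : l ∈ controlsP μ ℱ f) :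
    (fun n x => (l n x + l n x) + sqFun f n x) ∈ controlsQ μ ℱ f := by
  refine ⟨⟨fun n => ((hl.1.1 n).add (hl.1.1 n)).add ?_, fun a b hab x => ?_⟩, fun n => ?_⟩
  · refine NNReal.continuous_sqrt.measurable.comp ?_
    exact Finset.measurable_fun_sum _ fun k hk => (measurable_nnnorm.comp ((measurable_sub hf.1
      k).mono ((prodFiltration ℱ).mono (Finset.mem_range.1 hk)) le_rfl)).pow_const 2
  · refine add_le_add (add_le_add (hl.1.2 hab x) (hl.1.2 hab x)) ?_
    unfold sqFun
    rw [NNReal.sqrt_le_sqrt]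
    exact Finset.sum_le_sum_of_subset (Finset.range_mono hab)
  · filter_upwards [hf.2, ae_all_iff.2 (nnnorm_le_of_mem_controlsP hl)] with x h0 h
    have h1 := nnnorm_sub_le_two_mul hl.1.2 h0 h n
    have h2 : ∑ k ∈ Finset.range (n + 1), ‖f (k + 1) x - f k x‖₊ ^ 2 ≤
        ((l n x + l n x) + sqFun f n x) ^ 2 := by
      rw [Finset.sum_range_succ]
      calc _ ≤ sqFun f n x ^ 2 + (2 * l n x) ^ 2 := by
            rw [sqFun, NNReal.sq_sqrt]
            gcongr
        _ ≤ _ := by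
            rw [← two_mul, add_sq, add_comm, add_assoc]
            gcongr
            exact le_add_self
    rw [quadVarUpTo_succ_le_iff]
    simp only [mdiff, Pi.sub_apply, enorm_eq_nnnorm]
    exact_mod_cast h2

/-- The square root of the sum `∑_{k ≤ n} E_k |f_{k+1} - f_k|²`, with infinite terms omitted. -/
def condSqFun (μ : ∀ i, Measure (Ω i)) (ℱ : ∀ i, Filtration ℕ (mΩ i))
    (f : ℕ → (∀ i, Ω i) → ℝ) (n : ℕ) (x : ∀ i, Ω i) : ℝ≥0 :=
  NNReal.sqrt (∑ k ∈ Finset.range (n + 1), (condLExp (prodFiltration ℱ k) (Measure.pi μ)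
    (fun y => ‖mdiff f (k + 1) y‖ₑ ^ 2) x).toNNReal)

lemma controlLim_condSqFun_le (x : ∀ i, Ω i) :
    controlLim (condSqFun μ ℱ f) x ≤ condQuadVar μ ℱ f x := by
  refine iSup_le fun n => ?_
  rw [condQuadVar, ENNReal.le_rpow_half_iff, ← ENNReal.coe_pow, condSqFun, NNReal.sq_sqrt]
  push_cast
  exact (Finset.sum_le_sum fun k _ => ENNReal.coe_toNNReal_le_self).trans
    (ENNReal.sum_le_tsum _)

/-- Conditioning on `F_k` makes the partial sums of `s(f)²` predictable already. Controls are
finite-valued, so infinite terms are dropped, which is harmless where `s(f)` is finite. -/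
lemma condSqFun_mem_controlsCond (h : ∀ᵐ x ∂Measure.pi μ, condQuadVar μ ℱ f x < ∞) :
    condSqFun μ ℱ f ∈ controlsCond μ ℱ f := by
  refine ⟨⟨fun n => ?_, fun a b hab x => ?_⟩, fun n => ?_⟩
  · refine NNReal.continuous_sqrt.measurable.comp (Finset.measurable_fun_sum _ fun k hk => ?_)
    exact ((measurable_condLExp _ _ _).mono ((prodFiltration ℱ).mono
      (Nat.lt_succ_iff.1 (Finset.mem_range.1 hk))) le_rfl).ennreal_toNNReal
  · unfold condSqFun
    rw [NNReal.sqrt_le_sqrt]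
    exact Finset.sum_le_sum_of_subset (Finset.range_mono (by omega))
  · filter_upwards [h] with x hx
    rw [← ENNReal.coe_pow, condSqFun, NNReal.sq_sqrt]
    push_cast
    refine Finset.sum_le_sum fun k _ => (ENNReal.coe_toNNReal ?_).ge
    have h1 : ∑' k, condLExp (prodFiltration ℱ k) (Measure.pi μ)
        (fun y => ‖mdiff f (k + 1) y‖ₑ ^ 2) x ≠ ∞ := by
      rw [condQuadVar] at hx
      exact ((ENNReal.rpow_lt_top_iff_of_pos (by norm_num)).1 hx).ne
    exact ENNReal.ne_top_of_tsum_ne_top h1 k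

end Controls

/-- The estimates between a maximal or square function and the limits of its controls. -/
structure ControlEstimate {d : ℕ} (p : Fin d → ℝ≥0∞) (c : ℝ≥0) {Ω : Fin d → Type*}
    [mΩ : ∀ i, MeasurableSpace (Ω i)] (μ : ∀ i, Measure (Ω i)) (ℱ : ∀ i, Filtration ℕ (mΩ i)) :
    Prop where
  maximal_le_controlsQ : ∀ f ∈ martingales μ ℱ, ∀ l ∈ controlsQ μ ℱ f,
    mixedNorm μ p (maximal f) ≤ c * mixedNorm μ p (controlLim l)
  quadVar_le_controlsP : ∀ f ∈ martingales μ ℱ, ∀ l ∈ controlsP μ ℱ f,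
    mixedNorm μ p (quadVar f) ≤ c * mixedNorm μ p (controlLim l)
  condQuadVar_le_controlsP : ∀ f ∈ martingales μ ℱ, ∀ l ∈ controlsP μ ℱ f,
    mixedNorm μ p (condQuadVar μ ℱ f) ≤ c * mixedNorm μ p (controlLim l)
  maximal_le_controlsCond : (∀ i, p i < 2) → ∀ f ∈ martingales μ ℱ, ∀ l ∈ controlsCond μ ℱ f,
    mixedNorm μ p (maximal f) ≤ c * mixedNorm μ p (controlLim l)
  quadVar_le_controlsCond : (∀ i, p i < 2) → ∀ f ∈ martingales μ ℱ, ∀ l ∈ controlsCond μ ℱ f,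
    mixedNorm μ p (quadVar f) ≤ c * mixedNorm μ p (controlLim l)

theorem exists_controlEstimate {d : ℕ} {p : Fin d → ℝ≥0∞} (hp0 : ∀ i, 0 < p i)
    (hp : ∀ i, p i < ∞) : ∃ c : ℝ≥0, 0 < c ∧ ∀ (Ω : Fin d → Type*)
    [mΩ : ∀ i, MeasurableSpace (Ω i)] (μ : ∀ i, Measure (Ω i)) [∀ i, IsProbabilityMeasure (μ i)]
    (ℱ : ∀ i, Filtration ℕ (mΩ i)), ControlEstimate p c μ ℱ := by
  obtain ⟨N, hN⟩ : ∃ N : ℕ, ∀ i, (p i).toReal < N := by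
    obtain ⟨N, hN⟩ := exists_nat_gt (∑ i, (p i).toReal)
    exact ⟨N, fun i => (Finset.single_le_sum (f := fun i => (p i).toReal)
      (fun _ _ => ENNReal.toReal_nonneg) (Finset.mem_univ i)).trans_lt hN⟩
  have h2N : ∀ i, (p i).toReal < (2 ^ (N + 1) : ℕ) := fun i => (hN i).trans_le (by
    exact_mod_cast (Nat.lt_two_pow_self.le.trans (Nat.pow_le_pow_right two_pos N.le_succ)))
  have hN2 : ∀ i, (p i).toReal < (2 * (N + 1) : ℕ) := fun i => (hN i).trans_le (by
    exact_mod_cast (by omega))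
  obtain ⟨A₁, hA₁⟩ := exists_transformClosed_maximal_controlsQ d N
  obtain ⟨A₂, hA₂⟩ := exists_transformClosed_quadVar_controlsP d N
  obtain ⟨A₃, hA₃⟩ := exists_transformClosed_condQuadVar_controlsP d N
  obtain ⟨C₁, -, hC₁⟩ := mixedNorm_extrapolation hp0 hp
    (by exact_mod_cast Nat.one_le_two_pow) h2N A₁
  obtain ⟨C₂, -, hC₂⟩ := mixedNorm_extrapolation hp0 hp (by exact_mod_cast (by omega)) hN2 A₂
  obtain ⟨C₃, -, hC₃⟩ := mixedNorm_extrapolation hp0 hp (by exact_mod_cast (by omega)) hN2 A₃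
  -- The constant has to be fixed before the condition `p i < 2` is assumed; if the condition fails,
  -- any value serves.
  obtain ⟨C₄, hC₄⟩ : ∃ C : ℝ≥0, (∀ i, p i < 2) → ∀ (Ω : Fin d → Type _)
      [mΩ : ∀ i, MeasurableSpace (Ω i)] (μ : ∀ i, Measure (Ω i)) [∀ i, IsProbabilityMeasure (μ i)]
      (ℱ : ∀ i, Filtration ℕ (mΩ i)), ∀ f ∈ martingales μ ℱ, ∀ l ∈ controlsCond μ ℱ f,
      mixedNorm μ p (maximal f) ≤ C * mixedNorm μ p (controlLim l) ∧
      mixedNorm μ p (quadVar f) ≤ C * mixedNorm μ p (controlLim l) := by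
    by_cases h2 : ∀ i, p i < 2
    · have h2' : ∀ i, (p i).toReal < 2 := fun i => by
        simpa using (ENNReal.toReal_lt_toReal (hp i).ne ENNReal.ofNat_ne_top).2 (h2 i)
      obtain ⟨C, -, hC⟩ := mixedNorm_extrapolation hp0 hp one_le_two h2' 4
      obtain ⟨D, -, hD⟩ := mixedNorm_extrapolation hp0 hp one_le_two h2' 1
      refine ⟨C + D, fun _ Ω mΩ μ _ ℱ f hf l hl => ⟨?_, ?_⟩⟩
      · refine (hC Ω μ ℱ _ transformClosed_maximal_controlsCond _ _ ⟨f, hf, hl, rfl⟩).trans ?_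
        gcongr
        exact le_self_add
      · refine (hD Ω μ ℱ _ transformClosed_quadVar_controlsCond _ _ ⟨f, hf, hl, rfl⟩).trans ?_
        gcongr
        exact le_add_self
    · exact ⟨0, fun h => absurd h h2⟩
  refine ⟨C₁ + C₂ + C₃ + C₄ + 1, by positivity, fun Ω mΩ μ _ ℱ => ⟨fun f hf l hl => ?_,
    fun f hf l hl => ?_, fun f hf l hl => ?_, fun h2 f hf l hl => ?_, fun h2 f hf l hl => ?_⟩⟩
  · refine (hC₁ Ω μ ℱ _ (hA₁ Ω μ ℱ) _ _ ⟨f, hf, hl, rfl⟩).trans ?_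
    gcongr
    simp only [add_assoc]
    exact le_self_add
  · refine (hC₂ Ω μ ℱ _ (hA₂ Ω μ ℱ) _ _ ⟨f, hf, hl, rfl⟩).trans ?_
    gcongr
    simp only [add_assoc]
    exact le_add_left le_self_add
  · refine (hC₃ Ω μ ℱ _ (hA₃ Ω μ ℱ) _ _ ⟨f, hf, hl, rfl⟩).trans ?_
    gcongr
    simp only [add_assoc]
    exact le_add_left (le_add_left le_self_add)
  · refine (hC₄ h2 Ω μ ℱ f hf l hl).1.trans ?_
    gcongr
    exact le_add_right le_add_self
  · refine (hC₄ h2 Ω μ ℱ f hf l hl).2.trans ?_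
    gcongr
    exact le_add_right le_add_self

lemma ENNReal.le_mul_biInf {ι : Type*} {S : Set ι} {F : ι → ℝ≥0∞} {c : ℝ≥0} (hc : 0 < c)
    {a : ℝ≥0∞} (h : ∀ l ∈ S, a ≤ c * F l) : a ≤ c * ⨅ l ∈ S, F l := by
  have hc' : (c : ℝ≥0∞) ≠ 0 := by simpa using hc.ne'
  rw [← ENNReal.div_le_iff' hc' ENNReal.coe_ne_top]
  exact le_iInf₂ fun l hl => ENNReal.div_le_of_le_mul' (h l hl)

end MixedHardy

end

theorem mainTheorem8 (d : ℕ) (hd : 1 ≤ d) (p : Fin d → ℝ≥0∞)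
    (hp_pos : ∀ i, 0 < p i) (hp_fin : ∀ i, p i < ∞) :
    ∃ c : ℝ≥0, 0 < c ∧
      ∀ (Ω : Fin d → Type*) [mΩ : ∀ i, MeasurableSpace (Ω i)]
        (μ : ∀ i, Measure (Ω i)) [∀ i, IsProbabilityMeasure (μ i)]
        (ℱ : ∀ i, Filtration ℕ (mΩ i)) (_ : ∀ i, ⨆ n, ℱ i n = mΩ i),
        (∀ f ∈ martingales μ ℱ,
          ((∀ i, p i < 2) →
            normHM μ p f ≤ c * normHs μ ℱ p f ∧ normHS μ p f ≤ c * normHs μ ℱ p f) ∧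
          (normHM μ p f ≤ normP μ ℱ p f ∧ normHS μ p f ≤ normQ μ ℱ p f) ∧
          (normHS μ p f ≤ c * normP μ ℱ p f ∧ normHM μ p f ≤ c * normQ μ ℱ p f) ∧
          (normP μ ℱ p f ≤ c * normQ μ ℱ p f ∧ normQ μ ℱ p f ≤ c * normP μ ℱ p f) ∧
          (normHs μ ℱ p f ≤ c * normP μ ℱ p f ∧ normHs μ ℱ p f ≤ c * normQ μ ℱ p f)) ∧
        spaceP μ ℱ p = spaceQ μ ℱ p := by
  obtain ⟨a, ha, hest⟩ := exists_controlEstimate hp_pos hp_fin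
  obtain ⟨b, hb, hquasi⟩ := mixedNorm_add_le_quasi hp_pos hp_fin
  -- One constant for both conversions: `b` is the quasi-triangle constant and `a` the constant of
  -- the control estimates. The sum of two copies of `λ` needs `b` twice; the other conversion needs
  -- only `b (1 + a)`, covered since `b ≥ 1`.
  set e : ℝ≥0 := b * (2 * b + a) with he
  have he0 : 0 < e := by positivity
  refine ⟨a + e + a * e, by positivity, fun Ω mΩ μ _ ℱ _ => ?_⟩
  have E := hest Ω μ ℱ
  have hQ := hquasi Ω μ
  have ha_le : ∀ t : ℝ≥0∞, (a : ℝ≥0∞) * t ≤ (a + e + a * e : ℝ≥0) * t := fun t => by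
    gcongr
    rw [add_assoc]
    exact le_self_add
  have he_le : ∀ t : ℝ≥0∞, (e : ℝ≥0∞) * t ≤ (a + e + a * e : ℝ≥0) * t := fun t => by
    gcongr
    exact le_add_right le_add_self
  have hae_le : ∀ t : ℝ≥0∞, (a : ℝ≥0∞) * (e * t) ≤ (a + e + a * e : ℝ≥0) * t := fun t => by
    rw [← mul_assoc, ← ENNReal.coe_mul]
    gcongr
    exact le_add_self
  have hPl : ∀ f ∈ martingales μ ℱ, ∀ l ∈ controlsQ μ ℱ f,
      normP μ ℱ p f ≤ e * mixedNorm μ p (controlLim l) := by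
    intro f hf l hl
    refine (iInf₂_le _ (add_runMax_mem_controlsP hf hl)).trans ?_
    refine (mixedNorm_mono_ae μ p (g := fun x => controlLim l x + maximal f x)
      (Filter.Eventually.of_forall fun x => (controlLim_add_le _ _ x).trans ?_)).trans ?_
    · rw [maximal_eq_iSup_runMax]
      rfl
    refine (hQ _ _ (measurable_controlLim hl.1) (measurable_maximal hf)).trans ?_
    have h1 := E.maximal_le_controlsQ f hf l hl
    have hb2 : (1 : ℝ≥0∞) ≤ 2 * b := by
      exact_mod_cast hb.trans (by rw [two_mul]; exact le_self_add)
    calc (b : ℝ≥0∞) * (mixedNorm μ p (controlLim l) + mixedNorm μ p (maximal f))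
        ≤ b * (2 * b * mixedNorm μ p (controlLim l) + a * mixedNorm μ p (controlLim l)) := by
          gcongr
          exact le_mul_of_one_le_left' hb2
      _ = e * mixedNorm μ p (controlLim l) := by rw [he]; push_cast; ring
  have hQl : ∀ f ∈ martingales μ ℱ, ∀ l ∈ controlsP μ ℱ f,
      normQ μ ℱ p f ≤ e * mixedNorm μ p (controlLim l) := by
    intro f hf l hl
    refine (iInf₂_le _ (add_sqFun_mem_controlsQ hf hl)).trans ?_
    refine (mixedNorm_mono_ae μ p (g := fun x => (controlLim l x + controlLim l x) + quadVar f x)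
      (Filter.Eventually.of_forall fun x => (controlLim_add_le _ _ x).trans
        (add_le_add (controlLim_add_le _ _ x) (controlLim_sqFun_le f x)))).trans ?_
    have hlm := measurable_controlLim hl.1
    refine (hQ _ _ (hlm.add hlm) (measurable_quadVar hf)).trans ?_
    have h1 := E.quadVar_le_controlsP f hf l hl
    have h2 := hQ _ _ hlm hlm
    calc (b : ℝ≥0∞) * (mixedNorm μ p (fun x => controlLim l x + controlLim l x) +
          mixedNorm μ p (quadVar f))
        ≤ b * (b * (mixedNorm μ p (controlLim l) + mixedNorm μ p (controlLim l)) +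
          a * mixedNorm μ p (controlLim l)) := by gcongr
      _ = e * mixedNorm μ p (controlLim l) := by rw [he]; push_cast; ring
  have hPQ : ∀ f ∈ martingales μ ℱ, normP μ ℱ p f ≤ e * normQ μ ℱ p f := fun f hf =>
    ENNReal.le_mul_biInf he0 (hPl f hf)
  have hQP : ∀ f ∈ martingales μ ℱ, normQ μ ℱ p f ≤ e * normP μ ℱ p f := fun f hf =>
    ENNReal.le_mul_biInf he0 (hQl f hf)
  have hsP : ∀ f ∈ martingales μ ℱ, normHs μ ℱ p f ≤ a * normP μ ℱ p f := fun f hf =>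
    ENNReal.le_mul_biInf ha (E.condQuadVar_le_controlsP f hf)
  have hs : (∀ i, p i < 2) → ∀ f ∈ martingales μ ℱ,
      normHM μ p f ≤ a * normHs μ ℱ p f ∧ normHS μ p f ≤ a * normHs μ ℱ p f := by
    intro h2 f hf
    by_cases htop : normHs μ ℱ p f = ∞
    · rw [htop, ENNReal.mul_top (by simpa using ha.ne')]
      exact ⟨le_top, le_top⟩
    have hl := condSqFun_mem_controlsCond
      (ae_lt_top_of_mixedNorm_ne_top μ hp_pos hp_fin (measurable_condQuadVar f) htop)
    have h1 : mixedNorm μ p (controlLim (condSqFun μ ℱ f)) ≤ normHs μ ℱ p f :=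
      mixedNorm_mono_ae μ p (Filter.Eventually.of_forall controlLim_condSqFun_le)
    exact ⟨(E.maximal_le_controlsCond h2 f hf _ hl).trans (by gcongr),
      (E.quadVar_le_controlsCond h2 f hf _ hl).trans (by gcongr)⟩
  have hlt : ∀ {t u : ℝ≥0∞}, t ≤ e * u → u < ∞ → t < ∞ := fun h hu =>
    h.trans_lt (ENNReal.mul_lt_top ENNReal.coe_lt_top hu)
  refine ⟨fun f hf => ⟨fun h2 => ⟨(hs h2 f hf).1.trans (ha_le _), (hs h2 f hf).2.trans (ha_le _)⟩,
    ⟨le_iInf₂ fun l hl => mixedNorm_mono_ae μ p (maximal_le_controlLim hf hl),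
      le_iInf₂ fun l hl => mixedNorm_mono_ae μ p (quadVar_le_controlLim hl)⟩,
    ⟨(ENNReal.le_mul_biInf ha (E.quadVar_le_controlsP f hf)).trans (ha_le _),
      (ENNReal.le_mul_biInf ha (E.maximal_le_controlsQ f hf)).trans (ha_le _)⟩,
    ⟨(hPQ f hf).trans (he_le _), (hQP f hf).trans (he_le _)⟩,
    ⟨(hsP f hf).trans (ha_le _), (hsP f hf).trans ((mul_le_mul' le_rfl (hPQ f hf)).trans
      (hae_le _))⟩⟩, ?_⟩
  refine Set.ext fun f => ⟨?_, ?_⟩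
  -- A finite infimum produces a control with finite norm, so the norm comparison gives equality of
  -- the spaces.
  · rintro ⟨hf, l, hl, hfin⟩
    have := hlt (hQl f hf l hl) hfin
    simp only [normQ, iInf_lt_iff] at this
    obtain ⟨l', hl', h'⟩ := this
    exact ⟨hf, l', hl', h'⟩
  · rintro ⟨hf, l, hl, hfin⟩
    have := hlt (hPl f hf l hl) hfin
    simp only [normP, iInf_lt_iff] at this
    obtain ⟨l', hl', h'⟩ := this
    exact ⟨hf, l', hl', h'⟩
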